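/- Let $L$ be a field of characteristic zero with algebraic closure $\overline L$ and $I=\mathrm{Gal}(\overline L/L)$, and let $G$ be a connected reductive group over $L$ which is quasi-split, i.e. the centralizer $T$ in $G$ of a maximal $L$-split torus $S\subset G$ is a torus. (The case of interest is that $L$ is the completion of the maximal unramified extension of a $p$-adic field $F$ and $G$ is the base change of a connected reductive $F$-group; then quasi-splitness is automatic.) Let $X_*(T)$ be the group of cocharacters of $T$ over $\overline L$, $X_*(T)_I$ its group of $I$-coinvariants, $W_0=N(L)/T(L)$ the relative Weyl group, where $N$ is the normalizer of $T$ in $G$, and $$W=X_*(T)_I\rtimes W_0$$ the Iwahori--Weyl group of $G$, with translation elements $t_\lambda$ for $\lambda\in X_*(T)_I$. It acts on $V=X_*(T)_I\otimes\mathbb R$ by affine transformations, $t_\lambda$ acting as translation by the image of $\lambda$ and $W_0$ linearly. The affine Weyl group $W_a\subset W$ is the subgroup generated by $W_0$ and the $t_{\underline{\alpha}^\vee}$, where $\underline{\alpha}^\vee$ runs through the images in $X_*(T)_I$ of the absolute coroots of $(G,T)$. Fix an alcove $\mathfrak a$ in $V$, i.e. a connected component of the complement of the hyperplanes of the affine reflections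 in $W_a$, and let $\mathbb S\subset W_a$ be the set of reflections in the walls of $\mathfrak a$. Let $\ell(w)$ be the number of reflection hyperplanes separating $\mathfrak a$ and $w\mathfrak a$, and let $\le$ be the Bruhat order on $W$, the partial order generated by the relations $rw\le w$ for affine reflections $r\in W_a$ with $\ell(rw)<\ell(w)$. Let $K\subset\mathbb S$ be a subset which generates a finite subgroup $W_K$. Fix a Borel subgroup $B\supset T$ of $G$ defined over $L$. Let $\mu$ be a minuscule cocharacter of $G$ over $\overline L$, i.e. the weights of $\mathrm{Ad}\circ\mu$ on $\mathrm{Lie}\,G$ lie in $\{-1,0,1\}$. Let $\underline\mu\in X_*(T)_I$ be the image of the $B$-dominant cocharacter in $X_*(T)$ that is $G(\overline L)$-conjugate to $\mu$, put $$\mathrm{Adm}(\{\mu\})=\{w\in W \mid w\le t_{x(\underline\mu)}\text{ for some }x\in W_0\},$$ and let $\mathrm{Adm}(\{\mu\})_K$ be the image of $\mathrm{Adm}(\{\mu\})$ in $W_K\backslash W/W_K$. If $\lambda\in X_*(T)_I$ is such that the image of $t_\lambda$ in $W_K\backslash W/W_K$ lies in $\mathrm{Adm}(\{\mu\})_K$,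 then there is a cocharacter $v_2\in X_*(T)$ which maps to $\lambda$ in $X_*(T)_I$ and is conjugate to $\mu$ by an element of $G(\overline L)$. -/

import Mathlib

open scoped TensorProduct MatrixGroups

noncomputable section

/-! Linear algebraic groups over a field `L` of characteristic zero are described by their
`Ω`-points, `Ω` an algebraic closure of `L`: they are the subgroups of `GL n Ω` that are the zero
locus of polynomials over `L` in the entries of `g` and of `g⁻¹`. -/

namespace AlgGroup

variable (L : Type*) {Ω : Type*} [Field L] [Field Ω] [Algebra L Ω] {n : ℕ}

/-- Indices of the coordinates on `GL n`: the entries of `g` and the entries of `g⁻¹`. -/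
abbrev CoordIdx (n : ℕ) : Type := (Fin n × Fin n) ⊕ (Fin n × Fin n)

/-- The coordinates of a point of `GL n`. -/
def coords {R : Type*} [CommRing R] (g : GL (Fin n) R) : CoordIdx n → R :=
  Sum.elim (fun p => g.1 p.1 p.2) (fun p => (g⁻¹).1 p.1 p.2)

/-- `H` is the zero locus in `GL n Ω` of a set of polynomials with coefficients in `L`.
With `L := Ω` this says that `H` is Zariski closed. -/
def IsClosedOver (H : Subgroup (GL (Fin n) Ω)) : Prop :=
  ∃ P : Set (MvPolynomial (CoordIdx n) L),
    ∀ g : GL (Fin n) Ω, g ∈ H ↔ ∀ f ∈ P, MvPolynomial.aeval (coords g) f = 0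

variable {L}

/-- A closed subgroup is connected iff it has no proper closed subgroup of finite index. -/
def IsConnectedGroup (H : Subgroup (GL (Fin n) Ω)) : Prop :=
  IsClosedOver Ω H ∧
    ∀ H' : Subgroup (GL (Fin n) Ω), IsClosedOver Ω H' → H' ≤ H → H'.relIndex H ≠ 0 → H' = H

/-- Every element of `U` is a unipotent matrix. -/
def IsUnipotentGroup (U : Subgroup (GL (Fin n) Ω)) : Prop :=
  ∀ u ∈ U, IsNilpotent (u.1 - 1)

/-- Connected reductive: connected, with trivial unipotent radical. -/
def IsConnectedReductive (G : Subgroup (GL (Fin n) Ω)) : Prop :=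
  IsConnectedGroup G ∧
    ∀ U : Subgroup (GL (Fin n) Ω), IsConnectedGroup U → U ≤ G →
      (∀ g ∈ G, ∀ u ∈ U, g * u * g⁻¹ ∈ U) → IsUnipotentGroup U → U = ⊥

/-- A torus: a connected diagonalizable group. -/
def IsTorus (T : Subgroup (GL (Fin n) Ω)) : Prop :=
  IsConnectedGroup T ∧ ∃ P : GL (Fin n) Ω, ∀ t ∈ T, (P * t * P⁻¹).1.IsDiag

variable (L) in
/-- An `L`-split torus: a torus defined over `L` and diagonalizable over `L`. -/
def IsSplitTorus (S : Subgroup (GL (Fin n) Ω)) : Prop :=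
  IsClosedOver L S ∧ IsConnectedGroup S ∧
    ∃ P : GL (Fin n) L, ∀ s ∈ S,
      (Matrix.GeneralLinearGroup.map (algebraMap L Ω) P * s *
        (Matrix.GeneralLinearGroup.map (algebraMap L Ω) P)⁻¹).1.IsDiag

/-- `X` lies in the Lie algebra of `G`, i.e. `1 + ε X` is a point of `G` over the dual numbers:
every polynomial vanishing on `G` vanishes there (the inverse of `1 + ε X` is `1 - ε X`). -/
def IsInLie (G : Subgroup (GL (Fin n) Ω)) (X : Matrix (Fin n) (Fin n) Ω) : Prop :=
  ∀ f : MvPolynomial (CoordIdx n) Ω,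
    (∀ g ∈ G, MvPolynomial.aeval (coords g) f = 0) →
    MvPolynomial.aeval (R := Ω)
      (Sum.elim
        (fun p => (TrivSqZeroExt.inl ((1 : Matrix (Fin n) (Fin n) Ω) p.1 p.2) +
          TrivSqZeroExt.inr (X p.1 p.2) : DualNumber Ω))
        (fun p => (TrivSqZeroExt.inl ((1 : Matrix (Fin n) (Fin n) Ω) p.1 p.2) -
          TrivSqZeroExt.inr (X p.1 p.2) : DualNumber Ω))) f = 0

/-- A homomorphism `𝔾_m → GL n` on points is algebraic: its entries are Laurent polynomials. -/
def IsAlgebraicHom (ν : Ωˣ →* GL (Fin n) Ω) : Prop :=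
  ∀ i j, ∃ f : LaurentPolynomial Ω, ∀ z : Ωˣ, (ν z).1 i j = f.eval₂ (RingHom.id Ω) z

/-- Cocharacters of `G` (over the algebraic closure). -/
def IsCocharacter (G : Subgroup (GL (Fin n) Ω)) (ν : Ωˣ →* GL (Fin n) Ω) : Prop :=
  IsAlgebraicHom ν ∧ ∀ z, ν z ∈ G

/-- `ν` and `ν'` are conjugate by an element of `G`. -/
def IsConjIn (G : Subgroup (GL (Fin n) Ω)) (ν ν' : Ωˣ →* GL (Fin n) Ω) : Prop :=
  ∃ g ∈ G, ∀ z, g * ν z * g⁻¹ = ν' z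

/-- `ν` is minuscule: the weights of `Ad ∘ ν` on `Lie G` lie in `{-1, 0, 1}`. -/
def IsMinuscule (G : Subgroup (GL (Fin n) Ω)) (ν : Ωˣ →* GL (Fin n) Ω) : Prop :=
  ∀ m : ℤ, ∀ X : Matrix (Fin n) (Fin n) Ω, X ≠ 0 → IsInLie G X →
    (∀ z : Ωˣ, (ν z).1 * X * ((ν z)⁻¹).1 = ((z ^ m : Ωˣ) : Ω) • X) → m = -1 ∨ m = 0 ∨ m = 1

/-- The action of the Galois group on `GL n Ω`, entry by entry. -/
def galGL (σ : Ω ≃ₐ[L] Ω) : GL (Fin n) Ω →* GL (Fin n) Ω :=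
  Matrix.GeneralLinearGroup.map (σ : Ω →+* Ω)

theorem galGL_apply (σ : Ω ≃ₐ[L] Ω) (g : GL (Fin n) Ω) (i j : Fin n) :
    (galGL σ g).1 i j = σ (g.1 i j) := rfl

theorem coords_galGL (σ : Ω ≃ₐ[L] Ω) (g : GL (Fin n) Ω) :
    coords (galGL σ g) = fun k => σ (coords g k) := by
  funext k
  rcases k with p | p
  · rfl
  · simp only [coords, Sum.elim_inr]
    rw [← map_inv]
    rfl

theorem galGL_mem {H : Subgroup (GL (Fin n) Ω)} (hH : IsClosedOver L H) (σ : Ω ≃ₐ[L] Ω)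
    {g : GL (Fin n) Ω} (hg : g ∈ H) : galGL σ g ∈ H := by
  obtain ⟨P, hP⟩ := hH
  rw [hP] at hg ⊢
  intro f hf
  have h := MvPolynomial.comp_aeval_apply (coords g) (σ : Ω →ₐ[L] Ω) f
  rw [hg f hf, map_zero] at h
  rw [coords_galGL]
  exact h.symm

theorem galGL_symm_apply (σ : Ω ≃ₐ[L] Ω) (g : GL (Fin n) Ω) :
    galGL σ (galGL σ.symm g) = g := by
  ext i j
  simp [galGL_apply]

theorem exists_laurent_conj (σ : Ω ≃ₐ[L] Ω) (f : LaurentPolynomial Ω) :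
    ∃ f' : LaurentPolynomial Ω, ∀ z : Ωˣ, f'.eval₂ (RingHom.id Ω) z =
      σ (f.eval₂ (RingHom.id Ω) (Units.map ((σ.symm : Ω →+* Ω) : Ω →* Ω) z)) := by
  induction f using LaurentPolynomial.induction_on' with
  | add p q hp hq =>
    obtain ⟨p', hp⟩ := hp
    obtain ⟨q', hq⟩ := hq
    exact ⟨p' + q', fun z => by rw [map_add, map_add, map_add, hp, hq]⟩
  | C_mul_T m a =>
    refine ⟨LaurentPolynomial.C (σ a) * LaurentPolynomial.T m, fun z => ?_⟩
    rw [LaurentPolynomial.eval₂_C_mul_T, LaurentPolynomial.eval₂_C_mul_T, ← map_zpow]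
    simp

theorem IsTorus.commute {T : Subgroup (GL (Fin n) Ω)} (hT : IsTorus T)
    {s t : GL (Fin n) Ω} (hs : s ∈ T) (ht : t ∈ T) : s * t = t * s := by
  obtain ⟨-, P, hP⟩ := hT
  have key : (P * s * P⁻¹) * (P * t * P⁻¹) = (P * t * P⁻¹) * (P * s * P⁻¹) := by
    apply Units.ext
    rw [Units.val_mul (P * s * P⁻¹), Units.val_mul (P * t * P⁻¹), ← (hP s hs).diagonal_diag, ← (hP t ht).diagonal_diag,
      Matrix.diagonal_mul_diagonal, Matrix.diagonal_mul_diagonal]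
    congr 1
    funext i
    exact mul_comm _ _
  have h2 : P * (s * t) * P⁻¹ = P * (t * s) * P⁻¹ := by
    calc P * (s * t) * P⁻¹ = (P * s * P⁻¹) * (P * t * P⁻¹) := by group
      _ = (P * t * P⁻¹) * (P * s * P⁻¹) := key
      _ = P * (t * s) * P⁻¹ := by group
  exact mul_left_cancel (mul_right_cancel h2)

end AlgGroup

open AlgGroup

/-- A quasi-split connected reductive group `G` over `L` with a maximal `L`-split torus `S`.
Quasi-splitness says that the centralizer of `S` in `G` is a torus. -/
structure QuasiSplitGroup (L Ω : Type*) [Field L] [Field Ω] [Algebra L Ω] (n : ℕ) where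
  G : Subgroup (GL (Fin n) Ω)
  S : Subgroup (GL (Fin n) Ω)
  definedOver : IsClosedOver L G
  reductive : IsConnectedReductive G
  S_le : S ≤ G
  S_split : IsSplitTorus L S
  S_maximal : ∀ S' : Subgroup (GL (Fin n) Ω), S' ≤ G → IsSplitTorus L S' → S ≤ S' → S' = S
  quasiSplit : IsTorus (Subgroup.centralizer (S : Set (GL (Fin n) Ω)) ⊓ G)

namespace QuasiSplitGroup

variable {L Ω : Type*} [Field L] [Field Ω] [Algebra L Ω] {n : ℕ} (D : QuasiSplitGroup L Ω n)

/-- The maximal torus `T`, the centralizer of `S` in `G`. -/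
def T : Subgroup (GL (Fin n) Ω) := Subgroup.centralizer (D.S : Set (GL (Fin n) Ω)) ⊓ D.G

instance : CommGroup D.T :=
  { (inferInstance : Group D.T) with
    mul_comm := fun s t => Subtype.ext (D.quasiSplit.commute s.2 t.2) }

theorem galGL_mem_T (σ : Ω ≃ₐ[L] Ω) {t : GL (Fin n) Ω} (ht : t ∈ D.T) : galGL σ t ∈ D.T := by
  refine ⟨Subgroup.mem_centralizer_iff.2 fun s hs => ?_, galGL_mem D.definedOver σ ht.2⟩
  have h := Subgroup.mem_centralizer_iff.1 ht.1 (galGL σ.symm s) (galGL_mem D.S_split.1 _ hs)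
  have h' := congrArg (galGL σ) h
  rwa [map_mul, map_mul, galGL_symm_apply] at h'

/-- The Galois action on the points of `T`. -/
def galT (σ : Ω ≃ₐ[L] Ω) : D.T →* D.T :=
  ((galGL σ).comp D.T.subtype).codRestrict D.T fun t => D.galGL_mem_T σ t.2

/-- The character group `X^*(T)` (over the algebraic closure), written additively. -/
def Char : AddSubgroup (Additive (D.T →* Ωˣ)) where
  carrier := {χ | ∃ f : MvPolynomial (CoordIdx n) Ω, ∀ t : D.T,
    ((Additive.toMul χ t : Ωˣ) : Ω) = MvPolynomial.aeval (coords (t : GL (Fin n) Ω)) f}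
  zero_mem' := ⟨1, fun t => by simp⟩
  add_mem' := by
    rintro χ ψ ⟨f, hf⟩ ⟨g, hg⟩
    exact ⟨f * g, fun t => by simp [hf, hg]⟩
  neg_mem' := by
    rintro χ ⟨f, hf⟩
    refine ⟨MvPolynomial.rename Sum.swap f, fun t => ?_⟩
    have h := hf t⁻¹
    rw [MvPolynomial.aeval_rename]
    have hc : coords (t : GL (Fin n) Ω) ∘ Sum.swap = coords ((t⁻¹ : D.T) : GL (Fin n) Ω) := by
      funext k
      rcases k with p | p <;> simp [coords]
    rw [hc, ← h]
    simp

/-- The cocharacter group `X_*(T)` (over the algebraic closure), written additively. -/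
def Cochar : AddSubgroup (Additive (Ωˣ →* D.T)) where
  carrier := {ν | IsAlgebraicHom (D.T.subtype.comp (Additive.toMul ν))}
  zero_mem' := fun i j =>
    ⟨LaurentPolynomial.C ((1 : Matrix (Fin n) (Fin n) Ω) i j), fun z => by simp⟩
  add_mem' := by
    intro ν ν' h h' i j
    choose f hf using h
    choose f' hf' using h'
    refine ⟨∑ k, f i k * f' k j, fun z => ?_⟩
    simp only [map_sum, map_mul, ← hf, ← hf']
    simp [Matrix.mul_apply]
  neg_mem' := by
    intro ν h i j
    obtain ⟨f, hf⟩ := h i j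
    refine ⟨LaurentPolynomial.invert f, fun z => ?_⟩
    have h1 : ∀ p : LaurentPolynomial Ω, (LaurentPolynomial.invert p).eval₂ (RingHom.id Ω) z =
        p.eval₂ (RingHom.id Ω) z⁻¹ := by
      intro p
      induction p using LaurentPolynomial.induction_on' with
      | add p q hp hq => simp [hp, hq]
      | C_mul_T m a => simp
    rw [h1, ← hf z⁻¹]
    simp

/-- A cocharacter of `T` as a homomorphism into `GL n Ω`. -/
def toGL (ν : D.Cochar) : Ωˣ →* GL (Fin n) Ω := D.T.subtype.comp (Additive.toMul ν.1)

theorem toGL_injective : Function.Injective D.toGL := by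
  intro ν ν' h
  apply Subtype.ext
  apply Additive.toMul.injective
  ext1 z
  exact Subtype.ext (DFunLike.congr_fun h z)

/-- The value at a point of a character of `T`. -/
def evalChar (χ : D.Char) (t : D.T) : Ωˣ := (Additive.toMul χ.1 : D.T →* Ωˣ) t

/-- The Galois action on cocharacters: `(σ ν)(z) = σ (ν (σ⁻¹ z))`. -/
def gal (σ : Ω ≃ₐ[L] Ω) : D.Cochar →+ D.Cochar where
  toFun ν := ⟨Additive.ofMul (((D.galT σ).comp (Additive.toMul ν.1)).comp
    (Units.map ((σ.symm : Ω →+* Ω) : Ω →* Ω))), by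
      intro i j
      obtain ⟨f, hf⟩ := ν.2 i j
      obtain ⟨f', hf'⟩ := exists_laurent_conj σ f
      exact ⟨f', fun z => by rw [hf', ← hf]; rfl⟩⟩
  map_zero' := by
    apply D.toGL_injective
    ext1 z
    simp [toGL]
  map_add' ν ν' := by
    apply D.toGL_injective
    ext1 z
    simp [toGL]

/-- The kernel of `X_*(T) → X_*(T)_I`. -/
def coinvKer : AddSubgroup D.Cochar :=
  AddSubgroup.closure {ξ | ∃ (σ : Ω ≃ₐ[L] Ω) (ν : D.Cochar), ξ = D.gal σ ν - ν}

/-- The coinvariants `X_*(T)_I` for the absolute Galois group `I` of `L`. -/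
abbrev Coinv : Type _ := D.Cochar ⧸ D.coinvKer

variable {D} {ι : Type*} (R : RootPairing ι ℤ D.Char D.Cochar)

/-- `R` is the root datum of `(G, T)`: the pairing is the natural one, the roots are the nonzero
weights of `T` on `Lie G`, and the coroot of `α` is the cocharacter `α^∨` for which the reflection
`ν ↦ ν - ⟨α, ν⟩ α^∨` is induced by an element of the normalizer of `T` in `G`. -/
structure IsRootDatum : Prop where
  pairing : ∀ (χ : D.Char) (ν : D.Cochar) (z : Ωˣ),
    D.evalChar χ ((Additive.toMul ν.1 : Ωˣ →* D.T) z) = z ^ (R.toLinearMap χ ν)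
  root : ∀ χ : D.Char, χ ∈ Set.range R.root ↔
    χ ≠ 0 ∧ ∃ X : Matrix (Fin n) (Fin n) Ω, X ≠ 0 ∧ IsInLie D.G X ∧
      ∀ t : D.T, (t : GL (Fin n) Ω).1 * X * ((t : GL (Fin n) Ω)⁻¹).1 = (D.evalChar χ t : Ω) • X
  coroot : ∀ i, ∃ g ∈ D.G, g ∈ Subgroup.normalizer (D.T : Set (GL (Fin n) Ω)) ∧
    ∀ (ν : D.Cochar) (z : Ωˣ), g * D.toGL ν z * g⁻¹ = D.toGL (R.coreflection i ν) z

variable {R} in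
/-- The simple roots are permuted by the Galois group. Such bases correspond to the Borel
subgroups of `G` that contain `T` and are defined over `L`. -/
def IsGaloisStable (b : R.Base) : Prop :=
  ∀ (σ : Ω ≃ₐ[L] Ω), ∀ i ∈ b.support, ∃ j ∈ b.support,
    ∀ t : D.T, ((D.evalChar (R.root j) (D.galT σ t) : Ωˣ) : Ω) = σ (D.evalChar (R.root i) t : Ω)

variable {R} in
/-- Dominant cocharacters of `T`. -/
def IsDominant (b : R.Base) (ν : D.Cochar) : Prop :=
  ∀ i ∈ b.support, 0 ≤ R.toLinearMap (R.root i) ν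

/-- The absolute Weyl group, acting on `X_*(T)`. -/
def absWeyl : Subgroup (D.Cochar ≃ₗ[ℤ] D.Cochar) :=
  Subgroup.closure (Set.range R.coreflection)

/-- The relative Weyl group `W₀ = N(L) / T(L)`, as a subgroup of the absolute Weyl group: the
elements that are induced by an element of `G(L)` normalizing `T`. -/
def relWeyl : Subgroup (D.Cochar ≃ₗ[ℤ] D.Cochar) where
  carrier := {w | w ∈ absWeyl R ∧ ∃ g : GL (Fin n) L,
    Matrix.GeneralLinearGroup.map (algebraMap L Ω) g ∈ D.G ∧
    Matrix.GeneralLinearGroup.map (algebraMap L Ω) g ∈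
      Subgroup.normalizer (D.T : Set (GL (Fin n) Ω)) ∧
    ∀ (ν : D.Cochar) (z : Ωˣ), Matrix.GeneralLinearGroup.map (algebraMap L Ω) g * D.toGL ν z *
      (Matrix.GeneralLinearGroup.map (algebraMap L Ω) g)⁻¹ = D.toGL (w ν) z}
  one_mem' := ⟨one_mem _, 1, by simp [one_mem], by simp [one_mem], fun ν z => by simp⟩
  mul_mem' := by
    rintro w w' ⟨hw, g, h1, h2, h3⟩ ⟨hw', g', h1', h2', h3'⟩
    refine ⟨mul_mem hw hw', g * g', ?_, ?_, fun ν z => ?_⟩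
    · rw [map_mul]; exact mul_mem h1 h1'
    · rw [map_mul]; exact mul_mem h2 h2'
    · rw [LinearEquiv.mul_apply, ← h3, ← h3', map_mul]; group
  inv_mem' := by
    rintro w ⟨hw, g, h1, h2, h3⟩
    refine ⟨inv_mem hw, g⁻¹, ?_, ?_, fun ν z => ?_⟩
    · rw [map_inv]; exact inv_mem h1
    · rw [map_inv]; exact inv_mem h2
    · have h := h3 (w⁻¹ ν) z
      have h' : w (w⁻¹ ν) = ν := w.apply_symm_apply ν
      rw [h'] at h
      rw [← h, map_inv]; group

theorem relWeyl_gal (w : relWeyl R) (σ : Ω ≃ₐ[L] Ω) (ν : D.Cochar) :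
    w.1 (D.gal σ ν) = D.gal σ (w.1 ν) := by
  obtain ⟨w, hw, g, h1, h2, h3⟩ := w
  apply D.toGL_injective
  ext1 z
  rw [← h3]
  have hg : galGL σ (Matrix.GeneralLinearGroup.map (algebraMap L Ω) g) =
      Matrix.GeneralLinearGroup.map (algebraMap L Ω) g := by
    ext i j
    simp [galGL_apply]
  have hgal : ∀ ξ : D.Cochar, D.toGL (D.gal σ ξ) z =
      galGL σ (D.toGL ξ (Units.map ((σ.symm : Ω →+* Ω) : Ω →* Ω) z)) := fun ξ => rfl
  rw [hgal, hgal, ← h3, map_mul, map_mul, map_inv, hg]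

theorem coinvKer_map_le (w : relWeyl R) :
    D.coinvKer.map (w.1.toAddEquiv : D.Cochar →+ D.Cochar) ≤ D.coinvKer := by
  rw [coinvKer, AddMonoidHom.map_closure, AddSubgroup.closure_le]
  rintro _ ⟨_, ⟨σ, ν, rfl⟩, rfl⟩
  apply AddSubgroup.subset_closure
  refine ⟨σ, w.1 ν, ?_⟩
  rw [map_sub]
  exact congrArg (· - w.1 ν) (relWeyl_gal R w σ ν)

/-- The action of an element of `W₀` on `X_*(T)_I`. -/
def coinvEquiv (w : relWeyl R) : D.Coinv ≃+ D.Coinv :=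
  QuotientAddGroup.congr _ _ w.1.toAddEquiv (by
    refine le_antisymm (coinvKer_map_le R w) fun ξ hξ => ?_
    refine ⟨(w⁻¹).1 ξ, coinvKer_map_le R w⁻¹ ⟨ξ, hξ, rfl⟩, ?_⟩
    exact w.1.apply_symm_apply ξ)

/-- The action of `W₀` on `X_*(T)_I`, written multiplicatively. -/
def coinvAut : relWeyl R →* MulAut (Multiplicative D.Coinv) where
  toFun w :=
    { toFun := fun ξ => Multiplicative.ofAdd (coinvEquiv R w ξ.toAdd)
      invFun := fun ξ => Multiplicative.ofAdd ((coinvEquiv R w).symm ξ.toAdd)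
      left_inv := fun ξ => by simp
      right_inv := fun ξ => by simp
      map_mul' := fun ξ η => by simp }
  map_one' := by
    ext ξ
    induction ξ using Multiplicative.rec with | _ ξ
    induction ξ using QuotientAddGroup.induction_on
    rfl
  map_mul' w w' := by
    ext ξ
    induction ξ using Multiplicative.rec with | _ ξ
    induction ξ using QuotientAddGroup.induction_on
    rfl

/-- The Iwahori--Weyl group `W = X_*(T)_I ⋊ W₀`. -/
abbrev IwahoriWeyl : Type _ := Multiplicative D.Coinv ⋊[coinvAut R] relWeyl R

/-- The translation element `t_λ`. -/
def transl (l : D.Coinv) : IwahoriWeyl R := SemidirectProduct.inl (Multiplicative.ofAdd l)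

variable (D) in
/-- The real vector space `V = X_*(T)_I ⊗ ℝ`, the apartment of `S` with a special vertex as
origin. -/
abbrev Apartment : Type _ := ℝ ⊗[ℤ] D.Coinv

/-- The affine action of `W` on the apartment: `t_λ w` maps `v` to `w v + λ`. -/
def act (g : IwahoriWeyl R) (v : Apartment D) : Apartment D :=
  LinearMap.baseChange ℝ (coinvEquiv R g.right).toAddMonoidHom.toIntLinearMap v +
    (1 : ℝ) ⊗ₜ[ℤ] (Multiplicative.toAdd g.left)

/-- The affine Weyl group `W_a = X_*(T_sc)_I ⋊ W₀`: it is generated by `W₀` and the translations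
by the images of the absolute coroots. -/
def affineWeyl : Subgroup (IwahoriWeyl R) :=
  Subgroup.closure (Set.range (fun i => transl R (QuotientAddGroup.mk (R.coroot i))) ∪
    Set.range SemidirectProduct.inr)

/-- `r` is an affine reflection of `W_a`; its hyperplane is its set of fixed points. -/
def IsAffineReflection (r : IwahoriWeyl R) : Prop :=
  r ∈ affineWeyl R ∧ ∃ (f : Module.Dual ℝ (Apartment D)) (c : ℝ) (u : Apartment D),
    f u = 2 ∧ ∀ v, act R r v = v - (f v - c) • u

/-- `x` and `y` lie strictly on the same side of the hyperplane of `r`. -/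
def SameSide (r : IwahoriWeyl R) (x y : Apartment D) : Prop :=
  ∀ v ∈ segment ℝ x y, act R r v ≠ v

/-- Alcoves: the connected components of the complement of all the reflection hyperplanes. -/
def IsAlcove (A : Set (Apartment D)) : Prop :=
  ∃ x, (∀ r, IsAffineReflection R r → act R r x ≠ x) ∧
    A = {y | ∀ r, IsAffineReflection R r → SameSide R r x y}

/-- The simple reflections `𝕊`: the reflections in the walls of the alcove `A`. The hyperplane of
`s` is a wall iff it has a point that lies strictly on the side of `A` of every other one. -/
def simpleReflections (A : Set (Apartment D)) : Set (IwahoriWeyl R) :=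
  {s | IsAffineReflection R s ∧ ∃ y, act R s y = y ∧
    ∀ r, IsAffineReflection R r → r ≠ s → ∀ x ∈ A, SameSide R r x y}

/-- The length of `w`: the number of reflection hyperplanes that separate `A` and `w A`. -/
def length (A : Set (Apartment D)) (w : IwahoriWeyl R) : ℕ :=
  Set.ncard {r | IsAffineReflection R r ∧ ∀ x ∈ A, ∀ y ∈ A, ¬ SameSide R r x (act R w y)}

/-- The Bruhat order on `W`: it is generated by `r w < w` for reflections `r` of `W_a` with
`ℓ (r w) < ℓ w`. -/
def BruhatLE (A : Set (Apartment D)) : IwahoriWeyl R → IwahoriWeyl R → Prop :=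
  Relation.ReflTransGen fun u w =>
    ∃ r, IsAffineReflection R r ∧ u = r * w ∧ length R A u < length R A w

variable {R} in
/-- The `μ`-admissible set: the `w ∈ W` with `w ≤ t_{x(μ')}` for some `x ∈ W₀`, where `μ'` is the
image in `X_*(T)_I` of a dominant representative of the conjugacy class of `μ` in `X_*(T)`. -/
def Adm (b : R.Base) (A : Set (Apartment D)) (μ : Ωˣ →* GL (Fin n) Ω) : Set (IwahoriWeyl R) :=
  {w | ∃ μ' : D.Cochar, IsConjIn D.G μ (D.toGL μ') ∧ IsDominant b μ' ∧
    ∃ x : relWeyl R, BruhatLE R A w (transl R (coinvEquiv R x (QuotientAddGroup.mk μ')))}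

variable {R} in
/-- `Adm(μ)_K`, the image of `Adm(μ)` in `W_K \ W / W_K`, with `W_K` generated by `K`. -/
def AdmK (b : R.Base) (A : Set (Apartment D)) (K : Set (IwahoriWeyl R))
    (μ : Ωˣ →* GL (Fin n) Ω) :
    Set (DoubleCoset.Quotient (Subgroup.closure K : Set (IwahoriWeyl R)) (Subgroup.closure K)) :=
  DoubleCoset.mk (Subgroup.closure K) (Subgroup.closure K) '' Adm b A μ

end QuasiSplitGroup

end

/-! The proof has a geometric half, which turns admissibility into a convexity statement about `l`,
and a combinatorial half, which lifts `l` to the Weyl orbit of a minuscule cocharacter.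

Geometric half. The finite group `W_K` fixes a point `v` in the closure of the alcove, namely the
barycentre of the `W_K`-orbit of a point of the alcove. Let `ν` be the dominant conjugate of `μ` and
let `C` be the convex hull in the apartment of the images of its absolute Weyl orbit. A translation
by `x(ν)` displaces `v` by an element of `C`. If `ℓ(rw) < ℓ(w)`, the hyperplane of `r` separates the
alcove from its image under `w`, so it weakly separates `v` from `wv`; then `rwv - v` is a convex
combination of `wv - v` and its image under the linear part of `r`. So the displacement stays in `C`
down the Bruhat order (`BruhatLE.displacement_mem`). If `t_l = h w k` with `h, k` in `W_K`,
evaluating at `v` puts the image of `l` in `C`. Moreover `W_a` is the kernel of the class in the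
coinvariants modulo coroots, so `ν - l` lies in the image of the coroot lattice
(`exists_of_transl_mem_AdmK`).

Combinatorial half. Galois acts on the roots through a finite group that preserves a base. After
moving this base by the Weyl group, `l` may be taken dominant with the base still Galois-stable.
Membership in `C` then makes `ν - l` congruent to a nonnegative integral combination of simple
coroots. As long as this combination is nonzero, positivity of an invariant form and dominance of
`l` give a simple root `α` occurring in it, some Galois conjugate of which pairs positively with the
current orbit element `uν`. Minuscularity makes this pairing `1`, so reflecting subtracts exactly
one coroot, which is `α^∨` in the coinvariants
(`IsCoinvariantKernel.exists_weyl_sub_mem_of_nonneg`). The descent ends at an orbit element mapping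
to `l`. All congruences are integral, so torsion in the coinvariants does no harm. -/

namespace RootPairing

/-! ### Weyl group combinatorics of a root pairing with a base. -/

variable {ι M N : Type*} [AddCommGroup M] [AddCommGroup N] (P : RootPairing ι ℤ M N)

/-- A pair of a map on the coweight side and a permutation of the index set that respect
coroots and the pairing with roots. -/
def IsCompatible (g : N → N) (e : Equiv.Perm ι) : Prop :=
  (∀ i, g (P.coroot i) = P.coroot (e i)) ∧
    ∀ i ν, P.toLinearMap (P.root (e i)) (g ν) = P.toLinearMap (P.root i) ν

/-- The Weyl group, acting on the coweight side. -/
def coweyl : Subgroup (N ≃ₗ[ℤ] N) := Subgroup.closure (Set.range P.coreflection)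

theorem coreflection_mem_coweyl (i : ι) : P.coreflection i ∈ P.coweyl :=
  Subgroup.subset_closure ⟨i, rfl⟩

theorem coreflection_apply' (i : ι) (ν : N) :
    P.coreflection i ν = ν - P.toLinearMap (P.root i) ν • P.coroot i := rfl

theorem toLinearMap_injective : Function.Injective P.toLinearMap := P.toPerfPair.injective

theorem isAddTorsionFree_left (P : RootPairing ι ℤ M N) : IsAddTorsionFree M :=
  Function.Injective.isAddTorsionFree
    ((LinearMap.ltoFun ℤ N ℤ ℤ ∘ₗ P.toLinearMap).toAddMonoidHom)
    (DFunLike.coe_injective.comp P.toLinearMap_injective)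

theorem isAddTorsionFree_right (P : RootPairing ι ℤ M N) : IsAddTorsionFree N :=
  P.flip.isAddTorsionFree_left

theorem isCompatible_coreflection (i : ι) :
    P.IsCompatible (P.coreflection i) (P.reflectionPerm i) := by
  refine ⟨fun j => by simp, fun j ν => ?_⟩
  simp only [root_reflectionPerm, reflection_apply, coreflection_apply', map_sub, map_smul,
    LinearMap.sub_apply, LinearMap.smul_apply, smul_eq_mul, LinearMap.flip_apply, coroot',
    root_coroot_eq_pairing, pairing_same]
  ring

variable {P}

theorem IsCompatible.comp {g g' : N → N} {e e' : Equiv.Perm ι} (h : P.IsCompatible g e)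
    (h' : P.IsCompatible g' e') : P.IsCompatible (g ∘ g') (e * e') :=
  ⟨fun i => by simp [h'.1, h.1], fun i ν => by simp [h.2, h'.2]⟩

theorem IsCompatible.symm {g : N ≃ₗ[ℤ] N} {e : Equiv.Perm ι} (h : P.IsCompatible g e) :
    P.IsCompatible g.symm e⁻¹ := by
  refine ⟨fun i => ?_, fun i ν => ?_⟩
  · rw [LinearEquiv.symm_apply_eq, h.1]; simp
  · have := h.2 (e⁻¹ i) (g.symm ν)
    simpa using this.symm

theorem exists_isCompatible_of_mem_coweyl {g : N ≃ₗ[ℤ] N} (hg : g ∈ P.coweyl) :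
    ∃ e, P.IsCompatible g e := by
  induction hg using Subgroup.closure_induction with
  | mem x hx => obtain ⟨i, rfl⟩ := hx; exact ⟨_, P.isCompatible_coreflection i⟩
  | one => exact ⟨1, fun i => rfl, fun i ν => rfl⟩
  | mul x y _ _ hx hy =>
    obtain ⟨e, he⟩ := hx
    obtain ⟨e', he'⟩ := hy
    exact ⟨e * e', he.comp he'⟩
  | inv x _ hx =>
    obtain ⟨e, he⟩ := hx
    exact ⟨e⁻¹, he.symm⟩

theorem IsCompatible.root_eq_sum {g : N → N} {e : Equiv.Perm ι} (h : P.IsCompatible g e)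
    (hg : Function.Surjective g) {i : ι} {s : Finset ι} {f : ι → ℤ}
    (hi : P.root i = ∑ j ∈ s, f j • P.root j) :
    P.root (e i) = ∑ j ∈ s, f j • P.root (e j) := by
  apply P.toLinearMap_injective
  ext ν
  obtain ⟨ν, rfl⟩ := hg ν
  have := congrArg (fun χ => P.toLinearMap χ ν) hi
  simpa [h.2] using this

theorem IsCompatible.reflectionPerm_self {g : N → N} {e : Equiv.Perm ι} (h : P.IsCompatible g e)
    (hg : ∀ ν, g (-ν) = - g ν) (i : ι) :
    e (P.reflectionPerm i i) = P.reflectionPerm (e i) (e i) := by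
  apply P.coroot.injective
  rw [← h.1]
  simp [hg, h.1]

theorem IsCompatible.conj_coreflection {g : N ≃ₗ[ℤ] N} {e : Equiv.Perm ι}
    (h : P.IsCompatible g e) (i : ι) : g * P.coreflection i = P.coreflection (e i) * g := by
  ext ν
  simp [coreflection_apply', h.1, h.2]

namespace Base

variable {b : P.Base}

theorem root_sum_injective {f g : ι → ℤ}
    (h : ∑ j ∈ b.support, f j • P.root j = ∑ j ∈ b.support, g j • P.root j) :
    ∀ j ∈ b.support, f j = g j := by
  have h1 := linearIndepOn_iff'.mp b.linearIndepOn_root b.support (fun j => f j - g j)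
    subset_rfl (by simp [sub_smul, h])
  intro j hj
  exact sub_eq_zero.mp (h1 j hj)

theorem coroot_sum_injective {f g : ι → ℤ}
    (h : ∑ j ∈ b.support, f j • P.coroot j = ∑ j ∈ b.support, g j • P.coroot j) :
    ∀ j ∈ b.support, f j = g j :=
  root_sum_injective (b := b.flip) h

theorem isPos_iff_exists_nonneg {i : ι} : b.IsPos i ↔
    ∃ f : ι → ℤ, (∀ j, 0 ≤ f j) ∧ P.root i = ∑ j ∈ b.support, f j • P.root j := by
  constructor
  · intro h
    obtain ⟨f, -, hf, hi⟩ := b.exists_root_eq_sum_int i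
    refine ⟨f, ?_, hi⟩
    rcases hf with hf | hf
    · exact hf.le
    · rw [isPos_iff, height_eq_sum hi] at h
      exact absurd h (not_lt.2 (Finset.sum_nonpos fun j _ => hf.le j))
  · rintro ⟨f, hf, hi⟩
    rw [isPos_iff', height_eq_sum hi]
    exact Finset.sum_nonneg fun j _ => hf j

/-- The coefficients of a root are determined by linear independence and share one sign, so a single
positive one decides. -/
theorem isPos_of_coeff_pos {i k : ι} {f : ι → ℤ} (hi : P.root i = ∑ j ∈ b.support, f j • P.root j)
    (hk : k ∈ b.support) (hfk : 0 < f k) : b.IsPos i := by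
  obtain ⟨g, -, hg, hi'⟩ := b.exists_root_eq_sum_int i
  have := root_sum_injective (hi.symm.trans hi') k hk
  rcases hg with hg | hg
  · exact isPos_iff_exists_nonneg.2 ⟨g, hg.le, hi'⟩
  · have := hg.le k
    simp at this
    omega

/-- A simple reflection changes only the coefficient at its own simple root. A positive root other
than `j` has another positive coefficient, since the only multiples of a simple root that are roots
are plus or minus itself. -/
theorem IsPos.reflectionPerm_of_ne [Finite ι] {i j : ι} (hi : b.IsPos i) (hj : j ∈ b.support) (hij : i ≠ j) :
    b.IsPos (P.reflectionPerm j i) := by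
  classical
  obtain ⟨f, hf, hi'⟩ := isPos_iff_exists_nonneg.1 hi
  by_cases h : ∃ k ∈ b.support, k ≠ j ∧ 0 < f k
  · obtain ⟨k, hk, hkj, hfk⟩ := h
    have h2 : P.root (P.reflectionPerm j i) = ∑ l ∈ b.support,
        (f l - if l = j then P.pairing i j else 0) • P.root l := by
      simp only [sub_smul, Finset.sum_sub_distrib, ← hi', ite_smul, zero_smul,
        Finset.sum_ite_eq', hj, if_true]
      simp [reflection_apply]
    exact isPos_of_coeff_pos h2 hk (by simp [hkj, hfk])
  · exfalso
    push Not at h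
    have h1 : P.root i = f j • P.root j := by
      rw [hi']
      refine Finset.sum_eq_single_of_mem j hj fun k hk hkj => ?_
      rw [le_antisymm (h k hk hkj) (hf k), zero_smul]
    have := P.isAddTorsionFree_left
    have := P.isAddTorsionFree_right
    rcases b.eq_one_or_neg_one_of_mem_support_of_smul_mem j hj (f j) ⟨i, h1⟩ with h2 | h2
    · rw [h2, one_smul] at h1
      exact hij (P.root.injective h1)
    · have := hf j
      omega

theorem isPos_reflectionPerm_self {i : ι} : b.IsPos (P.reflectionPerm i i) ↔ ¬ b.IsPos i :=
  IsPos.neg_iff_not b i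

/-- Induction on the height: a positive root pairs positively with some simple root, and reflecting
in that simple root lowers the height while keeping positivity. Reflecting back is the step `h₂`. -/
theorem IsPos.induction_reflect [Finite ι] {i : ι} (h₀ : b.IsPos i) {p : ι → Prop}
    (h₁ : ∀ i ∈ b.support, p i)
    (h₂ : ∀ i j, b.IsPos i → p i → j ∈ b.support → i ≠ j → p (P.reflectionPerm j i)) : p i := by
  generalize hN : (b.height i).natAbs = n
  induction n using Nat.strongRecOn generalizing i with
  | ind n ih =>
    obtain ⟨j, hj, hj'⟩ := h₀.exists_mem_support_pos_pairingIn
    rw [P.zero_lt_pairingIn_iff'] at hj'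
    rcases eq_or_ne i j with rfl | hij
    · exact h₁ i hj
    have hk := h₀.reflectionPerm_of_ne hj hij
    have h3 : b.height (P.reflectionPerm j i) < b.height i := by
      have := P.reflection_apply_root' ℤ (i := j) (j := i)
      rw [← root_reflectionPerm, sub_eq_add_neg, ← neg_smul] at this
      rw [b.height_add_zsmul this, height_one_of_mem_support hj]
      simpa using hj'
    have h4 : (b.height (P.reflectionPerm j i)).natAbs < n := by
      rw [isPos_iff] at hk h₀
      omega
    have h5 := h₂ _ j hk (ih _ h4 hk rfl) hj (by
      rintro h
      rw [h] at h3
      have h6 := congrArg (P.reflectionPerm j) h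
      rw [reflectionPerm_self] at h6
      rw [h6] at h₀
      exact isPos_reflectionPerm_self.1 h₀ (isPos_of_mem_support hj))
    simpa using h5

/-- Positive roots arise from simple ones by simple reflections that preserve positivity at each
stage, and the same reflections preserve positivity of coroots for the dual base. -/
theorem IsPos.flip [Finite ι] {i : ι} (h : b.IsPos i) : b.flip.IsPos i := by
  refine h.induction_reflect (fun i hi => isPos_of_mem_support (b := b.flip) hi) ?_
  intro i j _ hi hj hij
  exact hi.reflectionPerm_of_ne (b := b.flip) hj hij

theorem IsPos.coroot_eq_sum [Finite ι] {i : ι} (h : b.IsPos i) :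
    ∃ f : ι → ℤ, (∀ j, 0 ≤ f j) ∧ P.coroot i = ∑ j ∈ b.support, f j • P.coroot j :=
  isPos_iff_exists_nonneg.1 h.flip

/-- Products of simple coreflections. -/
def word (P : RootPairing ι ℤ M N) (l : List ι) : N ≃ₗ[ℤ] N := (l.map P.coreflection).prod

/-- Conjugating a reflection by a simple one gives the reflection in the reflected root, so
reflection induction reaches all positive roots; opposite roots have the same reflection. -/
theorem coreflection_mem_closure_simple [Finite ι] (i : ι) :
    P.coreflection i ∈ Subgroup.closure (P.coreflection '' (b.support : Set ι)) := by
  have key : ∀ i, b.IsPos i →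
      P.coreflection i ∈ Subgroup.closure (P.coreflection '' (b.support : Set ι)) := by
    intro i hi
    refine hi.induction_reflect
      (p := fun i => P.coreflection i ∈ Subgroup.closure (P.coreflection '' (b.support : Set ι)))
      (fun i hi => Subgroup.subset_closure (Set.mem_image_of_mem _ hi)) ?_
    intro i j _ hi hj _
    have h := (P.isCompatible_coreflection j).conj_coreflection i
    rw [← mul_inv_eq_iff_eq_mul.2 h]
    have h2 : P.coreflection j ∈ Subgroup.closure (P.coreflection '' (b.support : Set ι)) :=
      Subgroup.subset_closure ⟨j, hj, rfl⟩
    exact mul_mem (mul_mem h2 hi) (inv_mem h2)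
  by_cases h : b.IsPos i
  · exact key i h
  · have h2 := key _ (isPos_reflectionPerm_self.2 h)
    have h3 : P.coreflection (P.reflectionPerm i i) = P.coreflection i := by
      ext ν
      simp [coreflection_apply']
    rwa [h3] at h2

theorem exists_word [Finite ι] {g : N ≃ₗ[ℤ] N} (hg : g ∈ P.coweyl) (b : P.Base) :
    ∃ l : List ι, (∀ i ∈ l, i ∈ b.support) ∧ g = word P l := by
  have h : P.coweyl ≤ Subgroup.closure (P.coreflection '' (b.support : Set ι)) := by
    rw [coweyl, Subgroup.closure_le]
    rintro _ ⟨i, rfl⟩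
    exact coreflection_mem_closure_simple i
  have hg' := h hg
  clear hg h
  induction hg' using Subgroup.closure_induction with
  | mem x hx =>
    obtain ⟨i, hi, rfl⟩ := hx
    exact ⟨[i], by simpa using hi, by simp [word]⟩
  | one => exact ⟨[], by simp, by simp [word]⟩
  | mul x y _ _ hx hy =>
    obtain ⟨l, hl, rfl⟩ := hx
    obtain ⟨l', hl', rfl⟩ := hy
    refine ⟨l ++ l', fun i hi => ?_, by simp [word]⟩
    rcases List.mem_append.1 hi with hi | hi
    exacts [hl i hi, hl' i hi]
  | inv x _ hx =>
    obtain ⟨l, hl, rfl⟩ := hx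
    refine ⟨l.reverse, fun i hi => hl i (List.mem_reverse.1 hi), ?_⟩
    rw [word, word, List.prod_inv_reverse, List.map_reverse, List.map_map]
    congr 2

/-- The permutation of the index set induced by a product of coreflections. -/
def wordPerm (P : RootPairing ι ℤ M N) (l : List ι) : Equiv.Perm ι :=
  (l.map P.reflectionPerm).prod

theorem isCompatible_word (l : List ι) : P.IsCompatible (word P l) (wordPerm P l) := by
  induction l with
  | nil => exact ⟨fun i => rfl, fun i ν => rfl⟩
  | cons i l ih =>
    have := (P.isCompatible_coreflection i).comp ih
    simpa only [word, wordPerm, List.map_cons, List.prod_cons] using! this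

/-- The exchange condition. Read from the right, the word makes `k` negative at some letter `j`;
just before that letter the root is `j` itself, so the preceding part `t` satisfies `t s_k = s_j t`
and the letter cancels. -/
theorem exchange [Finite ι] {l : List ι} (hl : ∀ i ∈ l, i ∈ b.support) {k : ι} (hk : k ∈ b.support)
    (h : ¬ b.IsPos (wordPerm P l k)) :
    ∃ l' : List ι, (∀ i ∈ l', i ∈ b.support) ∧ l'.length < l.length ∧
      word P l' = word P l * P.coreflection k := by
  induction l with
  | nil => exact absurd (isPos_of_mem_support hk) h
  | cons j t ih =>
    have ht : ∀ i ∈ t, i ∈ b.support := fun i hi => hl i (by simp [hi])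
    by_cases h1 : b.IsPos (wordPerm P t k)
    · have h2 : wordPerm P t k = j := by
        by_contra h2
        exact h (h1.reflectionPerm_of_ne (hl j (by simp)) h2)
      refine ⟨t, ht, by simp, ?_⟩
      have h3 := (isCompatible_word (P := P) t).conj_coreflection k
      rw [h2] at h3
      have h4 : word P (j :: t) = P.coreflection j * word P t := by simp [word]
      rw [h4, mul_assoc, h3, ← mul_assoc, ← sq, coreflection_sq, one_mul]
    · obtain ⟨l', hl', h2, h3⟩ := ih ht h1
      refine ⟨j :: l', ?_, by simpa using h2, ?_⟩
      · intro i hi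
        rcases List.mem_cons.1 hi with rfl | hi
        exacts [hl i (by simp), hl' i hi]
      · have h4 : ∀ t, word P (j :: t) = P.coreflection j * word P t := fun t => by simp [word]
        rw [h4, h4, h3, mul_assoc]

/-- Induction on the length. If `t` keeps the last letter `k` positive, then `μ - t s_k μ` is `μ - t
μ` plus `⟨α_k, μ⟩ ≥ 0` times a positive coroot; otherwise the exchange condition shortens the word.
-/
theorem sub_word_eq_sum [Finite ι] {μ : N} (hμ : ∀ i ∈ b.support, 0 ≤ P.toLinearMap (P.root i) μ)
    {l : List ι} (hl : ∀ i ∈ l, i ∈ b.support) :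
    ∃ f : ι → ℤ, (∀ j, 0 ≤ f j) ∧ μ - word P l μ = ∑ j ∈ b.support, f j • P.coroot j := by
  generalize hn : l.length = n
  induction n using Nat.strongRecOn generalizing l with
  | ind n ih =>
    rcases List.eq_nil_or_concat' l with rfl | ⟨t, k, rfl⟩
    · exact ⟨0, by simp, by simp [word]⟩
    have ht : ∀ i ∈ t, i ∈ b.support := fun i hi => hl i (by simp [hi])
    have hk : k ∈ b.support := hl k (by simp)
    have h1 : word P (t ++ [k]) = word P t * P.coreflection k := by simp [word]
    simp only [List.length_append, List.length_cons, List.length_nil] at hn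
    by_cases h : b.IsPos (wordPerm P t k)
    · obtain ⟨f, hf, h2⟩ := ih t.length (by omega) ht rfl
      obtain ⟨g, hg, h3⟩ := h.coroot_eq_sum
      refine ⟨fun j => f j + P.toLinearMap (P.root k) μ * g j, fun j =>
        add_nonneg (hf j) (mul_nonneg (hμ k hk) (hg j)), ?_⟩
      simp only [add_smul, mul_smul, Finset.sum_add_distrib, ← h2, ← Finset.smul_sum, ← h3]
      rw [h1, LinearEquiv.mul_apply, coreflection_apply', map_sub, map_smul,
        (isCompatible_word (P := P) t).1]
      abel
    · obtain ⟨l', hl', h2, h3⟩ := exchange ht hk h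
      rw [h1, ← h3]
      exact ih l'.length (by omega) hl' rfl

/-- A dominant element dominates its orbit under the Weyl group. -/
theorem sub_weyl_eq_sum [Finite ι] {μ : N} (hμ : ∀ i ∈ b.support, 0 ≤ P.toLinearMap (P.root i) μ)
    {g : N ≃ₗ[ℤ] N} (hg : g ∈ P.coweyl) :
    ∃ f : ι → ℤ, (∀ j, 0 ≤ f j) ∧ μ - g μ = ∑ j ∈ b.support, f j • P.coroot j := by
  obtain ⟨l, hl, rfl⟩ := exists_word hg b
  exact sub_word_eq_sum hμ hl

/-- Every nonvanishing odd function on the roots is positive on the simple roots after applying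
an element of the Weyl group. -/
theorem exists_forall_support_pos [Finite ι] (b : P.Base) (x : ι → ℤ)
    (hx : ∀ i, x (P.reflectionPerm i i) = - x i) (hx0 : ∀ i, x i ≠ 0) :
    ∃ g ∈ P.coweyl, ∃ e, P.IsCompatible g e ∧ ∀ j ∈ b.support, 0 < x (e j) := by
  classical
  have := Fintype.ofFinite ι
  -- Induction on the number of positive roots that the word sends to negative values of `x`.
  -- Appending a simple `j` with negative value lowers it, since `j` permutes the other positive
  -- roots. Oddness of `x` suffices; additivity is not needed.
  suffices h : ∀ n : ℕ, ∀ l : List ι,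
      (Finset.univ.filter fun i => b.IsPos i ∧ x (wordPerm P l i) < 0).card = n →
      ∃ l', ∀ j ∈ b.support, 0 < x (wordPerm P l' j) by
    obtain ⟨l, hl⟩ := h _ [] rfl
    refine ⟨word P l, ?_, wordPerm P l, isCompatible_word l, hl⟩
    refine Subgroup.list_prod_mem _ fun y hy => ?_
    obtain ⟨i, -, rfl⟩ := List.mem_map.1 hy
    exact P.coreflection_mem_coweyl i
  intro n
  induction n using Nat.strongRecOn with
  | ind n ih =>
    intro l hl
    by_cases h : ∀ j ∈ b.support, 0 < x (wordPerm P l j)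
    · exact ⟨l, h⟩
    push Not at h
    obtain ⟨j, hj, hxj⟩ := h
    have hxj : x (wordPerm P l j) < 0 := lt_of_le_of_ne hxj (hx0 _)
    have h1 : ∀ i, wordPerm P (l ++ [j]) i = wordPerm P l (P.reflectionPerm j i) := fun i => by
      simp [wordPerm]
    refine ih _ ?_ (l ++ [j]) rfl
    rw [← hl, ← Finset.card_map (P.reflectionPerm j).toEmbedding]
    apply Finset.card_lt_card
    rw [Finset.ssubset_iff_of_subset]
    · refine ⟨j, by simpa [hxj] using isPos_of_mem_support hj, ?_⟩
      simp only [Finset.mem_map, Finset.mem_filter, Finset.mem_univ, true_and, not_exists, not_and,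
        Equiv.coe_toEmbedding]
      rintro i ⟨hi, -⟩ hij
      have h2 : i = P.reflectionPerm j j := by
        rw [← P.reflectionPerm_self j i, hij]
      rw [h2] at hi
      exact isPos_reflectionPerm_self.1 hi (isPos_of_mem_support hj)
    · intro i' hi'
      simp only [Finset.mem_map, Finset.mem_filter, Finset.mem_univ, true_and,
        Equiv.coe_toEmbedding] at hi' ⊢
      obtain ⟨i, ⟨hi, hxi⟩, rfl⟩ := hi'
      rw [h1] at hxi
      refine ⟨hi.reflectionPerm_of_ne hj ?_, hxi⟩
      rintro rfl
      rw [(isCompatible_word (P := P) l).reflectionPerm_self (by simp), hx] at hxi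
      omega

end Base

end RootPairing

/-! ### Coinvariants under a finite group of symmetries: lifting when `l` is dominant. -/

namespace RootPairing

variable {ι M N H : Type*} [AddCommGroup M] [AddCommGroup N] {P : RootPairing ι ℤ M N}
  [Group H] [Fintype H]

/-- A finite group acts on the root datum by permutations of the index set, and `K` plays the role
of the kernel of the projection of `N` to the coinvariants. -/
structure IsCoinvariantKernel (P : RootPairing ι ℤ M N) (ρ : H →* Equiv.Perm ι)
    (K : AddSubgroup N) : Prop where
  compatible : ∀ h, ∃ g : N ≃ₗ[ℤ] N, P.IsCompatible g (ρ h)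
  coroot_sub_mem : ∀ h i, P.coroot (ρ h i) - P.coroot i ∈ K
  norm_eq_zero : ∀ i, ∀ ν ∈ K, ∑ h, P.toLinearMap (P.root (ρ h i)) ν = 0

/-- The pairing with the norm of a root. -/
def normPairing (P : RootPairing ι ℤ M N) (ρ : H →* Equiv.Perm ι) (i : ι) : N →ₗ[ℤ] ℤ :=
  ∑ h, P.toLinearMap (P.root (ρ h i))

theorem normPairing_apply (ρ : H →* Equiv.Perm ι) (i : ι) (ν : N) :
    normPairing P ρ i ν = ∑ h, P.toLinearMap (P.root (ρ h i)) ν := by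
  simp [normPairing]

theorem normPairing_perm (ρ : H →* Equiv.Perm ι) (h : H) (i : ι) :
    normPairing P ρ (ρ h i) = normPairing P ρ i := by
  ext ν
  rw [normPairing_apply, normPairing_apply]
  exact Fintype.sum_equiv (Equiv.mulRight h) _ _ (fun h' => by simp)

theorem IsCompatible.pairing {g : N → N} {e : Equiv.Perm ι} (h : P.IsCompatible g e) (i j : ι) :
    P.pairing (e i) (e j) = P.pairing i j := by
  rw [← root_coroot_eq_pairing, ← root_coroot_eq_pairing, ← h.1, h.2]

/-- Elements of the coroot lattice are combinations of simple coroots. -/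
theorem exists_eq_sum_coroot (b : P.Base) {θ : N}
    (hθ : θ ∈ Submodule.span ℤ (Set.range P.coroot)) :
    ∃ n : ι → ℤ, θ = ∑ j ∈ b.support, n j • P.coroot j := by
  classical
  rw [← b.span_int_coroot_support, ← Finset.coe_image, Submodule.mem_span_finset] at hθ
  obtain ⟨f, -, hf⟩ := hθ
  refine ⟨fun j => f (P.coroot j), ?_⟩
  rw [← hf, Finset.sum_image P.coroot.injective.injOn]

namespace IsCoinvariantKernel

variable {ρ : H →* Equiv.Perm ι} {K : AddSubgroup N}

theorem pairing_perm (hK : P.IsCoinvariantKernel ρ K) (h : H) (i j : ι) :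
    P.pairing (ρ h i) j = P.pairing i (ρ h⁻¹ j) := by
  obtain ⟨g, hg⟩ := hK.compatible h
  rw [← hg.pairing i (ρ h⁻¹ j)]
  simp

theorem normPairing_coroot (hK : P.IsCoinvariantKernel ρ K) (i j : ι) :
    normPairing P ρ i (P.coroot j) = ∑ h, P.pairing i (ρ h j) := by
  rw [normPairing_apply]
  exact Fintype.sum_equiv (Equiv.inv H) _ _ (fun h => by
    rw [root_coroot_eq_pairing, hK.pairing_perm]; rfl)

variable {B : LinearMap.BilinForm ℤ N}

/-- Nonsingularity of the Cartan matrix over `ℚ`. After clearing denominators, the solution gives an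
integral combination of simple coroots killed by all simple roots, hence `B`-orthogonal to itself.
-/
theorem eq_zero_of_pairing_eq_zero [Finite ι] (b : P.Base) (hB : ∀ ν, ν ≠ 0 → 0 < B ν ν)
    (hBc : ∀ i ν, 2 * B ν (P.coroot i) =
      P.toLinearMap (P.root i) ν * B (P.coroot i) (P.coroot i))
    (m : ι → ℚ) (hm : ∀ i ∈ b.support, ∑ j ∈ b.support, m j * P.pairing i j = 0) :
    ∀ j ∈ b.support, m j = 0 := by
  classical
  obtain ⟨⟨d, hd⟩, hdm⟩ := IsLocalization.exist_integer_multiples_of_finset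
    (nonZeroDivisors ℤ) (b.support.image m)
  have hd0 : (d : ℚ) ≠ 0 := by exact_mod_cast nonZeroDivisors.ne_zero hd
  have h1 : ∀ j, ∃ z : ℤ, j ∈ b.support → (z : ℚ) = d * m j := by
    intro j
    by_cases hj : j ∈ b.support
    · obtain ⟨z, hz⟩ := hdm (m j) (Finset.mem_image_of_mem m hj)
      exact ⟨z, fun _ => by simpa using hz⟩
    · exact ⟨0, fun h => absurd h hj⟩
  choose z hz using h1
  have h2 : ∀ i ∈ b.support, ∑ j ∈ b.support, z j * P.pairing i j = 0 := by
    intro i hi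
    have : ((∑ j ∈ b.support, z j * P.pairing i j : ℤ) : ℚ) = 0 := by
      push_cast
      rw [Finset.sum_congr rfl (g := fun j => (d : ℚ) * (m j * P.pairing i j))
        (fun j hj => by rw [hz j hj, mul_assoc]), ← Finset.mul_sum, hm i hi, mul_zero]
    exact_mod_cast this
  set ν : N := ∑ j ∈ b.support, z j • P.coroot j with hν
  clear_value ν
  have h3 : ∀ i ∈ b.support, P.toLinearMap (P.root i) ν = 0 := by
    intro i hi
    rw [hν, map_sum, ← h2 i hi]
    exact Finset.sum_congr rfl fun j _ => by simp
  have h4 : B ν ν = 0 := by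
    have h5 : 2 * B ν ν = 0 := by
      nth_rewrite 2 [hν]
      rw [map_sum, Finset.mul_sum]
      refine Finset.sum_eq_zero fun j hj => ?_
      rw [map_smul, smul_eq_mul, mul_left_comm, hBc, h3 j hj]
      simp
    omega
  have h6 : ν = 0 := by
    by_contra h
    have := hB ν h
    omega
  intro j hj
  have h7 := Base.coroot_sum_injective (b := b) (f := z) (g := 0) (by simpa [hν] using h6) j hj
  have h8 := hz j hj
  rw [h7] at h8
  simpa [hd0] using h8.symm

/-- The functional on `N` that is the sum of the coefficients along the orbit of a simple coroot
vanishes on the kernel. -/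
theorem exists_fundamental [Finite ι] (hK : P.IsCoinvariantKernel ρ K) (b : P.Base)
    (hb : ∀ h, ∀ i ∈ b.support, ρ h i ∈ b.support)
    (hB : ∀ ν, ν ≠ 0 → 0 < B ν ν)
    (hBc : ∀ i ν, 2 * B ν (P.coroot i) =
      P.toLinearMap (P.root i) ν * B (P.coroot i) (P.coroot i))
    {a : ι} (ha : a ∈ b.support) :
    ∃ φ : N →+ ℚ, (∀ ν ∈ K, φ ν = 0) ∧ ∀ n : ι → ℤ,
      φ (∑ j ∈ b.support, n j • P.coroot j) = ∑ h, (n (ρ h a) : ℚ) := by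
  classical
  have := Fintype.ofFinite ι
  -- `L i` is the norm pairing of `i` written in the coefficients of simple coroots, and `A` is the
  -- wanted functional in these coefficients.
  let L : b.support → (ι → ℚ) →ₗ[ℚ] ℚ := fun i =>
    ∑ j ∈ b.support, ((normPairing P ρ i (P.coroot j) : ℤ) : ℚ) • LinearMap.proj j
  let A : (ι → ℚ) →ₗ[ℚ] ℚ := ∑ h, LinearMap.proj (ρ h a)
  have hL : ∀ i c, L i c = ∑ j ∈ b.support, (∑ h, c (ρ h j)) * (P.pairing i j : ℚ) := by
    intro i c
    simp only [L, LinearMap.sum_apply, LinearMap.smul_apply, LinearMap.proj_apply, smul_eq_mul,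
      hK.normPairing_coroot, Int.cast_sum, Finset.sum_mul]
    rw [Finset.sum_comm, Finset.sum_comm (s := b.support)]
    refine Fintype.sum_equiv (Equiv.inv H) _ _ fun h => ?_
    refine Finset.sum_bij' (fun j _ => ρ h j) (fun j _ => ρ h⁻¹ j) (fun j hj => hb h j hj)
      (fun j hj => hb _ j hj) (by simp) (by simp) fun j _ => ?_
    simp [mul_comm]
  have hker : ⨅ i, LinearMap.ker (L i) ≤ LinearMap.ker A := by
    intro c hc
    simp only [Submodule.mem_iInf, LinearMap.mem_ker] at hc ⊢
    have h1 := eq_zero_of_pairing_eq_zero b hB hBc (fun j => ∑ h, c (ρ h j))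
      (fun i hi => by rw [← hL ⟨i, hi⟩, hc]) a ha
    simpa [A] using h1
  -- Since `A` vanishes on the common kernel of the `L i`, it is a combination of them; the same
  -- combination of norm pairings is defined on all of `N` and kills `K`.
  have hmem := mem_span_of_iInf_ker_le_ker hker
  rw [Submodule.mem_span_range_iff_exists_fun] at hmem
  obtain ⟨d, hd⟩ := hmem
  refine ⟨∑ i, (AddMonoidHom.mulLeft (d i)).comp
    ((Int.castAddHom ℚ).comp (normPairing P ρ (i : ι)).toAddMonoidHom), ?_, ?_⟩
  · intro ν hν
    simp only [AddMonoidHom.finsetSum_apply, AddMonoidHom.comp_apply]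
    refine Finset.sum_eq_zero fun i _ => ?_
    have : normPairing P ρ (i : ι) ν = 0 := by
      rw [normPairing_apply]; exact hK.norm_eq_zero _ ν hν
    simp [this]
  · intro n
    have h1 : A (fun j => (n j : ℚ)) = ∑ h, (n (ρ h a) : ℚ) := by simp [A]
    rw [← h1, ← hd]
    simp only [AddMonoidHom.finsetSum_apply, AddMonoidHom.comp_apply, LinearMap.sum_apply,
      LinearMap.smul_apply, L]
    refine Finset.sum_congr rfl fun i _ => ?_
    simp [mul_comm, Finset.mul_sum]

/-- Coroots in one orbit agree modulo `K`, so all coefficients of an orbit can be collected on a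
representative. The collected coefficient is nonnegative because its multiple by the group order is
a sum of the given orbit sums. -/
theorem exists_nonneg_coeff [Finite ι] (hK : P.IsCoinvariantKernel ρ K) (b : P.Base)
    (hb : ∀ h, ∀ i ∈ b.support, ρ h i ∈ b.support) (n : ι → ℤ)
    (hn : ∀ a ∈ b.support, 0 ≤ ∑ h, n (ρ h a)) :
    ∃ k : ι → ℕ, ∑ j ∈ b.support, n j • P.coroot j - ∑ j ∈ b.support, k j • P.coroot j ∈ K := by
  classical
  let S : Setoid ι :=
    { r := fun i j => ∃ h, ρ h i = j
      iseqv := ⟨fun i => ⟨1, by simp⟩, fun ⟨h, hh⟩ => ⟨h⁻¹, by simp [← hh]⟩,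
        fun ⟨h, hh⟩ ⟨h', hh'⟩ => ⟨h' * h, by simp [hh, hh']⟩⟩ }
  let r : ι → ι := fun i => (Quotient.mk S i).out
  have hr : ∀ i, ∃ h, ρ h i = r i := fun i => S.symm (Quotient.mk_out (s := S) i)
  have hr2 : ∀ h i, r (ρ h i) = r i := fun h i => by
    have : Quotient.mk S (ρ h i) = Quotient.mk S i := Quotient.sound (S.symm ⟨h, rfl⟩)
    simp only [r, this]
  have hrb : ∀ i ∈ b.support, r i ∈ b.support := fun i hi => by
    obtain ⟨h, hh⟩ := hr i
    rw [← hh]; exact hb h i hi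
  let k : ι → ℤ := fun i => ∑ j ∈ b.support with r j = i, n j
  have hk : ∀ i, 0 ≤ k i := by
    intro i
    have h1 : (Fintype.card H : ℤ) * k i = ∑ j ∈ b.support with r j = i, ∑ h, n (ρ h j) := by
      rw [Finset.sum_comm, ← nsmul_eq_mul, ← Finset.card_univ, ← Finset.sum_const]
      refine Finset.sum_congr rfl fun h _ => ?_
      refine Finset.sum_bij' (fun j _ => ρ h⁻¹ j) (fun j _ => ρ h j) ?_ ?_ (by simp) (by simp)
        (by simp)
      · intro j hj
        rw [Finset.mem_filter] at hj ⊢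
        exact ⟨hb _ _ hj.1, by rw [hr2, hj.2]⟩
      · intro j hj
        rw [Finset.mem_filter] at hj ⊢
        exact ⟨hb _ _ hj.1, by rw [hr2, hj.2]⟩
    have h2 : 0 ≤ (Fintype.card H : ℤ) * k i := by
      rw [h1]
      exact Finset.sum_nonneg fun j hj => hn j (Finset.mem_filter.1 hj).1
    exact nonneg_of_mul_nonneg_right h2 (by exact_mod_cast Fintype.card_pos)
  refine ⟨fun i => (k i).toNat, ?_⟩
  have h3 : ∑ j ∈ b.support, (k j).toNat • P.coroot j = ∑ j ∈ b.support, n j • P.coroot (r j) := by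
    have h4 : ∀ j, (k j).toNat • P.coroot j = k j • P.coroot j := fun j => by
      rw [← natCast_zsmul, Int.toNat_of_nonneg (hk j)]
    simp_rw [h4, k, Finset.sum_smul]
    refine Eq.trans ?_ (Finset.sum_fiberwise_of_maps_to hrb fun j => n j • P.coroot (r j))
    refine Finset.sum_congr rfl fun i _ => Finset.sum_congr rfl fun j hj => ?_
    rw [(Finset.mem_filter.1 hj).2]
  rw [h3, ← Finset.sum_sub_distrib]
  refine sum_mem fun j _ => ?_
  rw [← smul_sub]
  refine zsmul_mem ?_ _
  obtain ⟨h, hh⟩ := hr j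
  rw [← neg_sub, ← hh]
  exact neg_mem (hK.coroot_sub_mem h j)

end IsCoinvariantKernel

theorem toLinearMap_weyl_le_one {μ : N} (hmin : ∀ i, P.toLinearMap (P.root i) μ ≤ 1)
    {u : N ≃ₗ[ℤ] N} (hu : u ∈ P.coweyl) (i : ι) : P.toLinearMap (P.root i) (u μ) ≤ 1 := by
  obtain ⟨e, he⟩ := exists_isCompatible_of_mem_coweyl hu
  have : P.toLinearMap (P.root i) (u μ) = P.toLinearMap (P.root (e⁻¹ i)) μ := by
    simpa using he.2 (e⁻¹ i) μ
  rw [this]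
  exact hmin _

namespace IsCoinvariantKernel

variable {ρ : H →* Equiv.Perm ι} {K : AddSubgroup N} {B : LinearMap.BilinForm ℤ N}

/-- The minuscule descent, by induction on the sum of the coefficients `k`. A suitable reflection
applied to `u μ` subtracts one coroot, which modulo `K` is a simple coroot occurring in the
combination. -/
theorem exists_weyl_sub_mem_of_nonneg [Finite ι] (hK : P.IsCoinvariantKernel ρ K) (b : P.Base)
    (hb : ∀ h, ∀ i ∈ b.support, ρ h i ∈ b.support)
    (hB : ∀ ν, ν ≠ 0 → 0 < B ν ν)
    (hBc : ∀ i ν, 2 * B ν (P.coroot i) =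
      P.toLinearMap (P.root i) ν * B (P.coroot i) (P.coroot i))
    {μ l : N} (hmin : ∀ i, P.toLinearMap (P.root i) μ ≤ 1)
    (hl : ∀ i ∈ b.support, 0 ≤ normPairing P ρ i l) (k : ι → ℕ)
    {u : N ≃ₗ[ℤ] N} (hu : u ∈ P.coweyl)
    (hk : u μ - l - ∑ j ∈ b.support, k j • P.coroot j ∈ K) :
    ∃ u ∈ P.coweyl, u μ - l ∈ K := by
  classical
  generalize hs : ∑ j ∈ b.support, k j = s
  induction s generalizing k u with
  | zero =>
    refine ⟨u, hu, ?_⟩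
    rw [Finset.sum_eq_zero_iff] at hs
    rwa [Finset.sum_eq_zero fun j hj => by rw [hs j hj, zero_smul], sub_zero] at hk
  | succ s ih =>
    obtain ⟨j₀, hj₀, hkj₀⟩ : ∃ j ∈ b.support, k j ≠ 0 := by
      by_contra! h
      rw [Finset.sum_eq_zero h] at hs
      omega
    set θ : N := ∑ j ∈ b.support, k j • P.coroot j with hθ
    -- `θ'` is the norm of `θ`. It is nonzero because the coefficients are nonnegative and not all
    -- zero, and its pairing with any conjugate of a root is the norm pairing of that root with `θ`.
    set θ' : N := ∑ h, ∑ j ∈ b.support, k j • P.coroot (ρ h j) with hθ'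
    clear_value θ θ'
    have h1 : θ' = ∑ j ∈ b.support, (∑ h, (k (ρ h j) : ℤ)) • P.coroot j := by
      simp_rw [Finset.sum_smul]
      rw [Finset.sum_comm (s := b.support), hθ']
      refine Fintype.sum_equiv (Equiv.inv H) _ _ fun h => ?_
      refine Finset.sum_bij' (fun j _ => ρ h j) (fun j _ => ρ h⁻¹ j) (fun j hj => hb h j hj)
        (fun j hj => hb _ j hj) (by simp) (by simp) fun j _ => ?_
      simp
    have h2 : θ' ≠ 0 := by
      intro h
      rw [h1] at h
      have h3 := Base.coroot_sum_injective (b := b) (g := 0) (by simpa using h) j₀ hj₀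
      have h4 : (k (ρ 1 j₀) : ℤ) ≤ ∑ h, (k (ρ h j₀) : ℤ) :=
        Finset.single_le_sum (f := fun h => (k (ρ h j₀) : ℤ)) (fun _ _ => by positivity)
          (Finset.mem_univ 1)
      simp only [map_one, Equiv.Perm.coe_one, id_eq, Pi.zero_apply] at h3 h4
      omega
    have h3 : ∀ h, ∀ j, P.toLinearMap (P.root (ρ h j)) θ' = normPairing P ρ j θ := by
      intro h j
      rw [hθ, map_sum, hθ', map_sum]
      simp_rw [map_sum, map_nsmul, hK.normPairing_coroot, root_coroot_eq_pairing]
      rw [Finset.sum_comm]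
      refine Finset.sum_congr rfl fun i _ => ?_
      rw [Finset.smul_sum]
      refine Fintype.sum_equiv (Equiv.mulLeft h⁻¹) _ _ fun h' => ?_
      rw [hK.pairing_perm]
      simp
    -- Expanding one argument of `B θ' θ' > 0` in coroots leaves a nonnegative combination of the
    -- norm pairings with `θ` at those `i` where `k i ≠ 0`, so one of these is positive.
    obtain ⟨j, hj, hkj, hpos⟩ : ∃ j ∈ b.support, k j ≠ 0 ∧ 0 < normPairing P ρ j θ := by
      by_contra! h
      have h4 := hB θ' h2
      have h5 : B θ' θ' ≤ 0 := by
        nth_rewrite 2 [hθ']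
        rw [map_sum]
        refine Finset.sum_nonpos fun g _ => ?_
        rw [map_sum]
        refine Finset.sum_nonpos fun i hi => ?_
        rw [map_nsmul]
        by_cases hki : k i = 0
        · simp [hki]
        refine nsmul_nonpos ?_ _
        have h6 := hBc (ρ g i) θ'
        rw [h3] at h6
        have h7 := hB (P.coroot (ρ g i)) (P.ne_zero' _)
        have := mul_nonpos_of_nonpos_of_nonneg (h i hi hki) h7.le
        omega
      omega
    -- Modulo `K`, `u μ` is `l + θ`, and `l` is dominant.
    have h4 : 0 < normPairing P ρ j (u μ) := by
      have h5 : normPairing P ρ j (u μ - l - θ) = 0 := by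
        rw [normPairing_apply]
        exact hK.norm_eq_zero j _ hk
      rw [map_sub, map_sub] at h5
      have := hl j hj
      omega
    obtain ⟨h, hh⟩ : ∃ h, 0 < P.toLinearMap (P.root (ρ h j)) (u μ) := by
      by_contra! h
      rw [normPairing_apply] at h4
      exact absurd (Finset.sum_nonpos fun g _ => h g) (not_le.2 h4)
    have h5 : P.toLinearMap (P.root (ρ h j)) (u μ) = 1 :=
      le_antisymm (toLinearMap_weyl_le_one hmin hu _) hh
    refine ih (fun i => k i - if i = j then 1 else 0)
      (u := P.coreflection (ρ h j) * u) (mul_mem (P.coreflection_mem_coweyl _) hu) ?_ ?_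
    · have h6 : ∑ i ∈ b.support, (k i - if i = j then 1 else 0) • P.coroot i = θ - P.coroot j := by
        rw [eq_sub_iff_add_eq]
        have h7 : P.coroot j = ∑ i ∈ b.support, (if i = j then 1 else 0) • P.coroot i := by
          simp [hj]
        rw [h7, hθ, ← Finset.sum_add_distrib]
        refine Finset.sum_congr rfl fun i _ => ?_
        rw [← add_smul]
        congr 1
        split_ifs with hij
        · subst hij; omega
        · omega
      rw [h6, LinearEquiv.mul_apply, coreflection_apply', h5, one_smul]
      have h8 := sub_mem hk (hK.coroot_sub_mem h j)
      convert h8 using 1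
      abel
    · have h7 : ∑ i ∈ b.support, (k i - if i = j then 1 else 0) + 1 = ∑ i ∈ b.support, k i := by
        have h8 : 1 = ∑ i ∈ b.support, if i = j then 1 else 0 := by simp [hj]
        conv_lhs => rw [h8]
        rw [← Finset.sum_add_distrib]
        refine Finset.sum_congr rfl fun i _ => ?_
        split_ifs with hij
        · subst hij; omega
        · omega
      omega

/-- For the functional `φ` measuring one orbit of simple coroots, `φ l ≤ φ (u μ) ≤ φ μ` for some
`u`, the second inequality because `μ` is dominant. Hence the orbit sums of the coefficients of `μ -
l` are nonnegative, and the descent starts at `u = 1`. -/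
theorem exists_weyl_sub_mem_of_dominant [Finite ι] (hK : P.IsCoinvariantKernel ρ K) (b : P.Base)
    (hb : ∀ h, ∀ i ∈ b.support, ρ h i ∈ b.support)
    (hB : ∀ ν, ν ≠ 0 → 0 < B ν ν)
    (hBc : ∀ i ν, 2 * B ν (P.coroot i) =
      P.toLinearMap (P.root i) ν * B (P.coroot i) (P.coroot i))
    {μ l : N} (hmin : ∀ i, P.toLinearMap (P.root i) μ ≤ 1)
    (hμ : ∀ i ∈ b.support, 0 ≤ P.toLinearMap (P.root i) μ)
    (hl : ∀ i ∈ b.support, 0 ≤ normPairing P ρ i l)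
    (hQ : ∃ θ ∈ Submodule.span ℤ (Set.range P.coroot), μ - l - θ ∈ K)
    (hC : ∀ φ : N →+ ℚ, (∀ ν ∈ K, φ ν = 0) → ∃ u ∈ P.coweyl, φ l ≤ φ (u μ)) :
    ∃ u ∈ P.coweyl, u μ - l ∈ K := by
  classical
  obtain ⟨θ, hθ, hθK⟩ := hQ
  obtain ⟨n, hn⟩ := exists_eq_sum_coroot b hθ
  have h1 : ∀ a ∈ b.support, 0 ≤ ∑ h, n (ρ h a) := by
    intro a ha
    obtain ⟨φ, hφ, hφ'⟩ := hK.exists_fundamental b hb hB hBc ha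
    obtain ⟨u, hu, hle⟩ := hC φ hφ
    obtain ⟨f, hf, hfu⟩ := Base.sub_weyl_eq_sum hμ hu
    have h2 := hφ _ hθK
    have h3 := congrArg φ hfu
    have h4 : (0 : ℚ) ≤ ∑ h, (f (ρ h a) : ℚ) :=
      Finset.sum_nonneg fun h _ => by exact_mod_cast hf _
    rw [map_sub, map_sub, hn, hφ'] at h2
    rw [map_sub, hφ'] at h3
    have h5 : (0 : ℚ) ≤ ∑ h, (n (ρ h a) : ℚ) := by linarith
    exact_mod_cast h5
  obtain ⟨k, hk⟩ := hK.exists_nonneg_coeff b hb n h1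
  refine hK.exists_weyl_sub_mem_of_nonneg b hb hB hBc hmin hl k (one_mem _) ?_
  rw [hn] at hθK
  convert add_mem hθK hk using 1
  simp

end IsCoinvariantKernel

end RootPairing

/-! ### Reduction of the lifting statement to dominant `l`. -/

namespace RootPairing

variable {ι M N H : Type*} [AddCommGroup M] [AddCommGroup N] {P : RootPairing ι ℤ M N}

theorem IsCompatible.mem_span_coroot {g : N ≃ₗ[ℤ] N} {e : Equiv.Perm ι} (h : P.IsCompatible g e)
    {θ : N} (hθ : θ ∈ Submodule.span ℤ (Set.range P.coroot)) :
    g θ ∈ Submodule.span ℤ (Set.range P.coroot) := by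
  induction hθ using Submodule.span_induction with
  | mem x hx =>
    obtain ⟨i, rfl⟩ := hx
    rw [h.1]
    exact Submodule.subset_span ⟨_, rfl⟩
  | zero => simp
  | add x y _ _ hx hy => rw [map_add]; exact add_mem hx hy
  | smul a x _ hx => rw [map_smul]; exact Submodule.smul_mem _ _ hx

theorem sub_weyl_mem_span_coroot {g : N ≃ₗ[ℤ] N} (hg : g ∈ P.coweyl) :
    ∀ μ, μ - g μ ∈ Submodule.span ℤ (Set.range P.coroot) := by
  induction hg using Subgroup.closure_induction with
  | mem x hx =>
    obtain ⟨i, rfl⟩ := hx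
    intro μ
    rw [coreflection_apply', sub_sub_cancel]
    exact Submodule.smul_mem _ _ (Submodule.subset_span ⟨i, rfl⟩)
  | one => simp
  | mul x y _ _ hx hy =>
    intro μ
    have := add_mem (hx (y μ)) (hy μ)
    rw [LinearEquiv.mul_apply]
    convert this using 1
    abel
  | inv x _ hx =>
    intro μ
    have h := neg_mem (hx (x⁻¹ μ))
    have h' : x (x⁻¹ μ) = μ := x.apply_symm_apply μ
    rw [h'] at h
    convert h using 1
    abel

namespace Base

variable {b : P.Base}

theorem height_eq_sum_height {i : ι} {f : ι → ℤ} {e : ι → ι}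
    (h : P.root i = ∑ l ∈ b.support, f l • P.root (e l)) :
    b.height i = ∑ l ∈ b.support, f l * b.height (e l) := by
  choose g _ _ hg using b.exists_root_eq_sum_int
  have h1 : P.root i = ∑ m ∈ b.support, (∑ l ∈ b.support, f l * g (e l) m) • P.root m := by
    simp_rw [Finset.sum_smul, mul_smul]
    rw [Finset.sum_comm, h]
    refine Finset.sum_congr rfl fun l _ => ?_
    conv_lhs => rw [hg (e l), Finset.smul_sum]
  rw [height_eq_sum h1, Finset.sum_comm]
  refine Finset.sum_congr rfl fun l _ => ?_
  rw [height_eq_sum (hg (e l)), Finset.mul_sum]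

theorem height_perm {g : N ≃ₗ[ℤ] N} {e : Equiv.Perm ι} (h : P.IsCompatible g e)
    (he : ∀ i ∈ b.support, e i ∈ b.support) (i : ι) : b.height (e i) = b.height i := by
  obtain ⟨f, -, -, hf⟩ := b.exists_root_eq_sum_int i
  rw [height_eq_sum_height (h.root_eq_sum g.surjective hf), height_eq_sum hf]
  refine Finset.sum_congr rfl fun l hl => ?_
  rw [height_one_of_mem_support (he l hl), mul_one]

/-- A symmetry of the root datum that preserves positivity permutes the simple roots. -/
theorem mem_support_of_isPos_perm {g : N ≃ₗ[ℤ] N} {e : Equiv.Perm ι} (h : P.IsCompatible g e)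
    (he : ∀ i, b.IsPos i → b.IsPos (e i)) (he' : ∀ i, b.IsPos i → b.IsPos (e⁻¹ i))
    {j : ι} (hj : j ∈ b.support) : e j ∈ b.support := by
  classical
  obtain ⟨f, hf, hfj⟩ := isPos_iff_exists_nonneg.1 (he j (isPos_of_mem_support hj))
  have h1 := h.symm.root_eq_sum g.symm.surjective hfj
  rw [show e⁻¹ (e j) = j by simp] at h1
  have h2 := height_eq_sum_height h1
  rw [height_one_of_mem_support hj] at h2
  have h3 : ∀ l ∈ b.support, f l ≤ f l * b.height (e⁻¹ l) := fun l hl => by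
    have := he' l (isPos_of_mem_support hl)
    rw [isPos_iff] at this
    nlinarith [hf l]
  -- Applying `e⁻¹` to the expansion of the root `e j` and taking heights gives `1 = ∑ f l * height
  -- (e⁻¹ l)`, where each height is at least `1`. So only one coefficient survives, and it equals
  -- `1`.
  have h4 : ∑ l ∈ b.support, f l ≤ 1 := h2 ▸ Finset.sum_le_sum h3
  obtain ⟨l, hl, hfl⟩ : ∃ l ∈ b.support, f l ≠ 0 := by
    by_contra! h5
    rw [Finset.sum_eq_zero fun l hl => by rw [h5 l hl, zero_smul]] at hfj
    exact P.ne_zero _ hfj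
  have h5 : ∀ l' ∈ b.support, l' ≠ l → f l' = 0 := by
    intro l' hl' hne
    have h6 := Finset.sum_le_sum_of_subset_of_nonneg (f := f) (s := {l', l}) (t := b.support)
      (by simp [Finset.insert_subset_iff, hl, hl']) (fun i _ _ => hf i)
    rw [Finset.sum_pair hne] at h6
    have := hf l
    have := hf l'
    omega
  have h6 : f l = 1 := by
    have h7 := Finset.single_le_sum (f := f) (fun i _ => hf i) hl
    have := hf l
    omega
  rw [Finset.sum_eq_single_of_mem l hl fun l' hl' hne => by rw [h5 l' hl' hne, zero_smul], h6,
    one_smul] at hfj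
  rw [P.root.injective hfj]
  exact hl

end Base

namespace IsCoinvariantKernel

variable [Group H] [Fintype H] {ρ : H →* Equiv.Perm ι} {K : AddSubgroup N}
  {B : LinearMap.BilinForm ℤ N}

/-- Replacing the base by its image under `w` amounts to keeping the base and pulling the group
action and `K` back along `w`. -/
theorem transport (hK : P.IsCoinvariantKernel ρ K) {w : N ≃ₗ[ℤ] N} {e : Equiv.Perm ι}
    (hw : P.IsCompatible w e) :
    P.IsCoinvariantKernel ((MulAut.conj e⁻¹).toMonoidHom.comp ρ)
      (K.comap (w.toLinearMap.toAddMonoidHom)) := by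
  refine ⟨fun h => ?_, fun h i => ?_, fun i ν hν => ?_⟩
  · obtain ⟨g, hg⟩ := hK.compatible h
    refine ⟨(w.trans g).trans w.symm, ?_⟩
    have := hw.symm.comp (hg.comp hw)
    simpa [mul_assoc] using! this
  · have := hK.coroot_sub_mem h (e i)
    simpa [hw.1] using this
  · have := hK.norm_eq_zero (e i) (w ν) hν
    rw [← this]
    refine Finset.sum_congr rfl fun h _ => ?_
    rw [← hw.2]
    simp

/-- The elements of the coinvariants that are bounded by the Weyl group orbit of a minuscule
element, and congruent to it modulo coroots, lift to the orbit. -/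
theorem exists_weyl_sub_mem [Finite ι] (hK : P.IsCoinvariantKernel ρ K) (b : P.Base)
    (hb : ∀ h, ∀ i ∈ b.support, ρ h i ∈ b.support)
    (hB : ∀ ν, ν ≠ 0 → 0 < B ν ν)
    (hBc : ∀ i ν, 2 * B ν (P.coroot i) =
      P.toLinearMap (P.root i) ν * B (P.coroot i) (P.coroot i))
    {μ l : N} (hmin : ∀ i, P.toLinearMap (P.root i) μ ≤ 1)
    (hμ : ∀ i ∈ b.support, 0 ≤ P.toLinearMap (P.root i) μ)
    (hQ : ∃ θ ∈ Submodule.span ℤ (Set.range P.coroot), μ - l - θ ∈ K)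
    (hC : ∀ φ : N →+ ℚ, (∀ ν ∈ K, φ ν = 0) → ∃ u ∈ P.coweyl, φ l ≤ φ (u μ)) :
    ∃ u ∈ P.coweyl, u μ - l ∈ K := by
  classical
  have := Fintype.ofFinite ι
  -- With `C` above all heights, the sign of `x` below is that of the norm pairing with `l`, ties
  -- being broken by the height. Thus `x` never vanishes, and it is invariant because the base is
  -- stable under the group.
  obtain ⟨C, hC0, hCb⟩ : ∃ C : ℤ, 0 < C ∧ ∀ i, |b.height i| < C := by
    refine ⟨∑ i, |b.height i| + 1, by positivity, fun i => ?_⟩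
    have := Finset.single_le_sum (f := fun i => |b.height i|) (fun i _ => abs_nonneg _)
      (Finset.mem_univ i)
    omega
  choose g hg using hK.compatible
  let x : ι → ℤ := fun i => C * normPairing P ρ i l + b.height i
  have hnneg : ∀ i, normPairing P ρ (P.reflectionPerm i i) l = - normPairing P ρ i l := by
    intro i
    rw [normPairing_apply, normPairing_apply, ← Finset.sum_neg_distrib]
    refine Finset.sum_congr rfl fun h _ => ?_
    rw [(hg h).reflectionPerm_self (by simp)]
    simp
  have hxneg : ∀ i, x (P.reflectionPerm i i) = - x i := by
    intro i
    have h2 : b.height (P.reflectionPerm i i) = - b.height i := b.height_reflectionPerm_self i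
    simp only [x, hnneg, h2]
    ring
  have hx_sign : ∀ i, 0 ≤ x i → 0 ≤ normPairing P ρ i l := by
    intro i hi
    by_contra! h
    have h1 := (abs_lt.1 (hCb i)).2
    simp only [x] at hi
    nlinarith
  have hx0 : ∀ i, x i ≠ 0 := by
    intro i hi
    have h1 := hx_sign i hi.ge
    have h2 := hx_sign (P.reflectionPerm i i) (by rw [hxneg, hi, neg_zero])
    have h3 := hnneg i
    have h4 : normPairing P ρ i l = 0 := by omega
    simp only [x, h4, mul_zero, zero_add] at hi
    exact b.height_ne_zero i hi
  have hxinv : ∀ h i, x (ρ h i) = x i := fun h i => by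
    simp only [x, normPairing_perm, Base.height_perm (hg h) (hb h)]
  -- The image of `b` under `w` is the base whose positive roots are those with `x > 0`. Invariance
  -- of `x` makes it stable under the group, and `l` is dominant for it.
  obtain ⟨w, hwW, e, hw, hpos⟩ := Base.exists_forall_support_pos b x hxneg hx0
  have hxsum : ∀ i, ∀ f : ι → ℤ, P.root i = ∑ j ∈ b.support, f j • P.root j →
      x (e i) = ∑ j ∈ b.support, f j * x (e j) := by
    intro i f hf
    have h1 := hw.root_eq_sum w.surjective hf
    have h2 : normPairing P ρ (e i) l = ∑ j ∈ b.support, f j * normPairing P ρ (e j) l := by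
      simp_rw [normPairing_apply, Finset.mul_sum]
      rw [Finset.sum_comm]
      refine Finset.sum_congr rfl fun h _ => ?_
      have h3 := ((hg h).comp hw).root_eq_sum ((g h).surjective.comp w.surjective) hf
      simp only [Equiv.Perm.mul_apply] at h3
      simp [h3]
    simp only [x, h2, Base.height_eq_sum_height h1, Finset.mul_sum, mul_add,
      Finset.sum_add_distrib]
    congr 1
    exact Finset.sum_congr rfl fun j _ => by ring
  have hxpos : ∀ i, b.IsPos i → 0 < x (e i) := by
    intro i hi
    obtain ⟨f, hf, hfi⟩ := Base.isPos_iff_exists_nonneg.1 hi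
    refine lt_of_le_of_ne ?_ (hx0 _).symm
    rw [hxsum i f hfi]
    exact Finset.sum_nonneg fun j hj => mul_nonneg (hf j) (hpos j hj).le
  have hxpos' : ∀ i, 0 < x (e i) → b.IsPos i := by
    intro i hi
    by_contra h
    have h1 := hxpos _ (Base.isPos_reflectionPerm_self.2 h)
    rw [hw.reflectionPerm_self (by simp), hxneg] at h1
    omega
  have hK' := hK.transport hw
  have hperm : ∀ h i, b.IsPos i → b.IsPos ((e⁻¹ * ρ h * e) i) := by
    intro h i hi
    apply hxpos'
    have : e ((e⁻¹ * ρ h * e) i) = ρ h (e i) := by simp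
    rw [this, hxinv]
    exact hxpos i hi
  have hb' : ∀ h, ∀ i ∈ b.support, ((MulAut.conj e⁻¹).toMonoidHom.comp ρ) h i ∈ b.support := by
    intro h i hi
    obtain ⟨g', hg'⟩ := hK'.compatible h
    refine Base.mem_support_of_isPos_perm hg' ?_ ?_ hi
    · intro i hi
      simpa using hperm h i hi
    · intro i hi
      have := hperm h⁻¹ i hi
      simpa [mul_assoc] using this
  have hlw : ∀ i ∈ b.support,
      0 ≤ normPairing P ((MulAut.conj e⁻¹).toMonoidHom.comp ρ) i (w.symm l) := by
    intro i hi
    have h1 := hx_sign _ (hpos i hi).le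
    rw [normPairing_apply] at h1 ⊢
    convert h1 using 1
    refine Finset.sum_congr rfl fun h _ => ?_
    rw [← hw.2]
    simp
  -- The dominant case is applied to `w⁻¹ l` and the pulled-back kernel. The element `μ` itself is
  -- not moved: `μ - w⁻¹ μ` lies in the coroot lattice, and the orbit is stable under `w`.
  obtain ⟨u, hu, huK⟩ := hK'.exists_weyl_sub_mem_of_dominant b hb' hB hBc hmin hμ hlw
    (by
      obtain ⟨θ, hθ, hθK⟩ := hQ
      refine ⟨w.symm θ + (μ - w⁻¹ μ), add_mem (hw.symm.mem_span_coroot hθ)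
        (sub_weyl_mem_span_coroot (inv_mem hwW) μ), ?_⟩
      have h1 : w (w⁻¹ μ) = μ := w.apply_symm_apply μ
      simp only [AddSubgroup.mem_comap, LinearMap.toAddMonoidHom_coe, LinearEquiv.coe_coe, map_sub,
        map_add, LinearEquiv.apply_symm_apply, h1]
      convert hθK using 1
      abel)
    (by
      intro φ hφ
      obtain ⟨u, hu, hle⟩ := hC (φ.comp w.symm.toLinearMap.toAddMonoidHom) (by
        intro ν hν
        exact hφ _ (by simpa using hν))
      exact ⟨w⁻¹ * u, mul_mem (inv_mem hwW) hu, hle⟩)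
  refine ⟨w * u, mul_mem hwW hu, ?_⟩
  simpa using huK

end IsCoinvariantKernel

end RootPairing

/-! ### Conjugation and the Galois action on the Lie algebra. -/

noncomputable section

open AlgGroup

namespace AlgGroup

variable {Ω : Type*} [Field Ω] {n : ℕ}

/-- Conjugation by `g` in the coordinates of `GL n`. -/
def conjCoord (g : GL (Fin n) Ω) : CoordIdx n → MvPolynomial (CoordIdx n) Ω :=
  Sum.elim
    (fun p => ∑ k, ∑ l, MvPolynomial.C (g.1 p.1 k * (g⁻¹).1 l p.2) * MvPolynomial.X (Sum.inl (k, l)))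
    (fun p => ∑ k, ∑ l, MvPolynomial.C (g.1 p.1 k * (g⁻¹).1 l p.2) * MvPolynomial.X (Sum.inr (k, l)))

theorem mul_mul_apply_eq_sum {A : Type*} [CommRing A] (a b c : Matrix (Fin n) (Fin n) A)
    (i j : Fin n) : (a * b * c) i j = ∑ k, ∑ l, a i k * c l j * b k l := by
  simp only [Matrix.mul_apply, Finset.sum_mul]
  rw [Finset.sum_comm]
  exact Finset.sum_congr rfl fun k _ => Finset.sum_congr rfl fun l _ => by ring

theorem aeval_conjCoord (g h : GL (Fin n) Ω) (k : CoordIdx n) :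
    MvPolynomial.aeval (coords h) (conjCoord g k) = coords (g * h * g⁻¹) k := by
  rcases k with p | p
  · simp [conjCoord, coords, mul_mul_apply_eq_sum]
  · have : (g * h * g⁻¹)⁻¹ = g * h⁻¹ * g⁻¹ := by group
    simp only [coords, Sum.elim_inr, this]
    simp [conjCoord, mul_mul_apply_eq_sum]

/-- The coordinates of the point `1 + ε X` over the dual numbers. -/
def tangentCoords (X : Matrix (Fin n) (Fin n) Ω) : CoordIdx n → DualNumber Ω :=
  Sum.elim
    (fun p => (TrivSqZeroExt.inl ((1 : Matrix (Fin n) (Fin n) Ω) p.1 p.2) +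
      TrivSqZeroExt.inr (X p.1 p.2) : DualNumber Ω))
    (fun p => (TrivSqZeroExt.inl ((1 : Matrix (Fin n) (Fin n) Ω) p.1 p.2) -
      TrivSqZeroExt.inr (X p.1 p.2) : DualNumber Ω))

theorem sum_conj_one (g : GL (Fin n) Ω) (i j : Fin n) :
    ∑ k, ∑ l, g.1 i k * (g⁻¹).1 l j * (1 : Matrix (Fin n) (Fin n) Ω) k l =
      (1 : Matrix (Fin n) (Fin n) Ω) i j := by
  rw [← mul_mul_apply_eq_sum, mul_one]
  have : g.1 * (g⁻¹).1 = 1 := g.mul_inv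
  rw [this]

theorem aeval_tangentCoords_conjCoord (g : GL (Fin n) Ω) (X : Matrix (Fin n) (Fin n) Ω)
    (k : CoordIdx n) :
    MvPolynomial.aeval (tangentCoords X) (conjCoord g k) =
      tangentCoords (g.1 * X * (g⁻¹).1) k := by
  rcases k with p | p
  all_goals
    simp only [conjCoord, tangentCoords, Sum.elim_inl, Sum.elim_inr, map_sum, map_mul,
      MvPolynomial.aeval_C, MvPolynomial.aeval_X, TrivSqZeroExt.algebraMap_eq_inl,
      mul_mul_apply_eq_sum g.1 X, ← sum_conj_one g p.1 p.2]
    apply TrivSqZeroExt.ext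
    · simp only [TrivSqZeroExt.fst_sum]
      simp
    · simp only [TrivSqZeroExt.snd_sum]
      simp [TrivSqZeroExt.snd_mul]

/-- Conjugation is polynomial in the coordinates: composing an equation of `G` with it gives another
equation of `G`, whose value at `1 + ε X` is that of the original at `1 + ε g X g⁻¹`. -/
theorem IsInLie.conj {G : Subgroup (GL (Fin n) Ω)} {X : Matrix (Fin n) (Fin n) Ω}
    (hX : IsInLie G X) {g : GL (Fin n) Ω} (hg : g ∈ G) : IsInLie G (g.1 * X * (g⁻¹).1) := by
  intro f hf
  have h := hX (MvPolynomial.bind₁ (conjCoord g) f) (by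
    intro h hh
    rw [MvPolynomial.aeval_bind₁]
    simp_rw [aeval_conjCoord]
    exact hf _ (mul_mem (mul_mem hg hh) (inv_mem hg)))
  rw [MvPolynomial.aeval_bind₁] at h
  have h2 := fun k => aeval_tangentCoords_conjCoord g X k
  change MvPolynomial.aeval (tangentCoords _) f = 0
  rw [← h]
  congr 2
  funext k
  exact (h2 k).symm

/-- The map on dual numbers induced by a ring homomorphism. -/
def dualMap (σ : Ω →+* Ω) : DualNumber Ω →+* DualNumber Ω where
  toFun a := TrivSqZeroExt.inl (σ a.fst) + TrivSqZeroExt.inr (σ a.snd)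
  map_one' := by ext <;> simp
  map_zero' := by ext <;> simp
  map_add' a b := by ext <;> simp
  map_mul' a b := by ext <;> simp [TrivSqZeroExt.snd_mul]

variable {L : Type*} [Field L] [Algebra L Ω]

theorem aeval_coords_map (σ : Ω ≃ₐ[L] Ω) (g : GL (Fin n) Ω)
    (f : MvPolynomial (CoordIdx n) Ω) :
    MvPolynomial.aeval (coords (galGL σ g)) (MvPolynomial.map (σ : Ω →+* Ω) f) =
      σ (MvPolynomial.aeval (coords g) f) := by
  rw [coords_galGL, MvPolynomial.aeval_def, MvPolynomial.aeval_def, MvPolynomial.eval₂_map]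
  have := MvPolynomial.eval₂_comp_left (σ : Ω →+* Ω) (algebraMap Ω Ω) (coords g) f
  simpa using! this.symm

/-- As `G` is defined over `L`, its points are stable under `σ`, so applying `σ⁻¹` to the
coefficients of an equation of `G` gives another one. Applying `σ` to its value over the dual
numbers concludes. -/
theorem IsInLie.map_gal {G : Subgroup (GL (Fin n) Ω)} (hG : IsClosedOver L G)
    {X : Matrix (Fin n) (Fin n) Ω} (hX : IsInLie G X) (σ : Ω ≃ₐ[L] Ω) :
    IsInLie G (X.map σ) := by
  intro f hf
  have h := hX (MvPolynomial.map (σ.symm : Ω →+* Ω) f) (by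
    intro g hg
    have h1 := aeval_coords_map σ.symm (galGL σ g) f
    have h2 : galGL σ.symm (galGL σ g) = g := galGL_symm_apply σ.symm g
    rw [h2] at h1
    rw [h1, hf _ (galGL_mem hG σ hg), map_zero])
  change MvPolynomial.aeval (tangentCoords X) _ = 0 at h
  change MvPolynomial.aeval (tangentCoords _) f = 0
  have h3 := congrArg (dualMap (σ : Ω →+* Ω)) h
  rw [MvPolynomial.aeval_def, MvPolynomial.eval₂_comp_left, map_zero, MvPolynomial.eval₂_map] at h3
  rw [MvPolynomial.aeval_def, ← h3]
  congr 1
  · have h4 : ∀ a, algebraMap Ω (DualNumber Ω) a = TrivSqZeroExt.inl a := fun a =>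
      congrFun (TrivSqZeroExt.algebraMap_eq_inl _ _) a
    ext a <;> simp [dualMap, h4]
  · funext k
    rcases k with ⟨i, j⟩ | ⟨i, j⟩
    all_goals
      simp only [tangentCoords, Function.comp_apply, Sum.elim_inl, Sum.elim_inr, Matrix.map_apply]
      by_cases hp : i = j
      · subst hp
        ext <;> simp [dualMap]
      · ext <;> simp [dualMap, Matrix.one_apply_ne hp]

/-- In characteristic zero the exponents of a cocharacter can be read off from its value at the
single point `2`, which is moreover fixed by Galois. -/
theorem two_zpow_injective [CharZero Ω] : Function.Injective fun m : ℤ => (2 : Ω) ^ m := by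
  intro a b h
  have h1 : (((2 : ℚ) ^ a : ℚ) : Ω) = (((2 : ℚ) ^ b : ℚ) : Ω) := by
    push_cast
    exact h
  exact zpow_right_injective₀ (by norm_num) (by norm_num) (Rat.cast_injective h1)

/-- The number `2` as a unit. -/
def unitTwo (Ω : Type*) [Field Ω] [CharZero Ω] : Ωˣ := Units.mk0 2 two_ne_zero

theorem unitTwo_zpow_injective [CharZero Ω] :
    Function.Injective fun m : ℤ => (unitTwo Ω) ^ m := by
  intro a b h
  apply two_zpow_injective (Ω := Ω)
  have := congrArg (Units.val) h
  simpa [unitTwo] using this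

end AlgGroup

/-! ### The Galois action on characters, roots and cocharacters. -/

namespace QuasiSplitGroup

variable {L Ω : Type*} [Field L] [Field Ω] [Algebra L Ω] {n : ℕ} (D : QuasiSplitGroup L Ω n)

/-- The Galois action on characters. -/
def galChar (σ : Ω ≃ₐ[L] Ω) (χ : D.Char) : D.Char :=
  ⟨Additive.ofMul ((Units.map ((σ : Ω →+* Ω) : Ω →* Ω)).comp
    ((Additive.toMul χ.1).comp (D.galT σ.symm))), by
    obtain ⟨f, hf⟩ := χ.2
    refine ⟨MvPolynomial.map (σ : Ω →+* Ω) f, fun t => ?_⟩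
    have h := aeval_coords_map σ (D.galT σ.symm t : GL (Fin n) Ω) f
    have h2 : galGL σ (D.galT σ.symm t : GL (Fin n) Ω) = t := galGL_symm_apply σ t.1
    rw [h2, ← hf] at h
    rw [h]
    rfl⟩

theorem evalChar_galChar (σ : Ω ≃ₐ[L] Ω) (χ : D.Char) (t : D.T) :
    (D.evalChar (D.galChar σ χ) t : Ω) = σ (D.evalChar χ (D.galT σ.symm t)) := rfl

theorem evalChar_injective {χ ψ : D.Char} (h : ∀ t, D.evalChar χ t = D.evalChar ψ t) : χ = ψ := by
  apply Subtype.ext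
  apply Additive.toMul.injective
  ext1 t
  exact h t

theorem galT_galT_symm (σ : Ω ≃ₐ[L] Ω) (t : D.T) : D.galT σ (D.galT σ.symm t) = t :=
  Subtype.ext (galGL_symm_apply σ t.1)

theorem galT_symm_galT (σ : Ω ≃ₐ[L] Ω) (t : D.T) : D.galT σ.symm (D.galT σ t) = t :=
  D.galT_galT_symm σ.symm t

theorem galChar_eq_iff (σ : Ω ≃ₐ[L] Ω) (χ ψ : D.Char) : ψ = D.galChar σ χ ↔
    ∀ t : D.T, (D.evalChar ψ (D.galT σ t) : Ω) = σ (D.evalChar χ t : Ω) := by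
  constructor
  · rintro rfl t
    rw [evalChar_galChar, galT_symm_galT]
  · intro h
    apply D.evalChar_injective
    intro t
    apply Units.ext
    rw [evalChar_galChar, ← h, galT_galT_symm]

theorem galChar_one (χ : D.Char) : D.galChar 1 χ = χ :=
  ((D.galChar_eq_iff 1 χ χ).2 fun t => by
    have : D.galT 1 t = t := Subtype.ext (by ext i j; rfl)
    rw [this]; rfl).symm

theorem galChar_mul (σ τ : Ω ≃ₐ[L] Ω) (χ : D.Char) :
    D.galChar (σ * τ) χ = D.galChar σ (D.galChar τ χ) :=
  ((D.galChar_eq_iff (σ * τ) χ _).2 fun t => by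
    have : D.galT (σ * τ) t = D.galT σ (D.galT τ t) := Subtype.ext (by ext i j; rfl)
    rw [this, (D.galChar_eq_iff σ _ _).1 rfl, (D.galChar_eq_iff τ _ _).1 rfl]
    rfl).symm

theorem evalChar_zero (t : D.T) : D.evalChar 0 t = 1 := rfl

theorem galChar_ne_zero (σ : Ω ≃ₐ[L] Ω) {χ : D.Char} (h : χ ≠ 0) : D.galChar σ χ ≠ 0 := by
  intro h0
  apply h
  have h1 := (D.galChar_eq_iff σ χ 0).1 h0.symm
  apply D.evalChar_injective
  intro t
  apply Units.ext
  have h2 := h1 t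
  rw [evalChar_zero] at h2 ⊢
  apply σ.injective
  rw [← h2]
  simp

variable {D} {ι : Type*} {R : RootPairing ι ℤ D.Char D.Cochar}

/-- Applying `σ` entrywise to a weight vector in the Lie algebra yields a weight vector for the
conjugate character. -/
theorem IsRootDatum.galChar_root_mem (hR : IsRootDatum R) (σ : Ω ≃ₐ[L] Ω) (i : ι) :
    D.galChar σ (R.root i) ∈ Set.range R.root := by
  rw [hR.root]
  obtain ⟨h0, X, hX0, hX, hw⟩ := (hR.root _).1 ⟨i, rfl⟩
  refine ⟨D.galChar_ne_zero σ h0, X.map σ, ?_, hX.map_gal D.definedOver σ, fun t => ?_⟩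
  · intro h
    apply hX0
    ext i j
    have := congrFun (congrFun h i) j
    simpa using this
  · have h1 := congrArg (fun Y : Matrix (Fin n) (Fin n) Ω => Y.map σ) (hw (D.galT σ.symm t))
    have h2 : ∀ s : GL (Fin n) Ω, (s.1).map σ = (galGL σ s).1 := fun s => rfl
    simp only [Matrix.map_mul, h2, map_inv] at h1
    have h3 : galGL σ (D.galT σ.symm t : GL (Fin n) Ω) = t := galGL_symm_apply σ t.1
    rw [h3] at h1
    rw [h1, evalChar_galChar]
    ext i j
    simp

theorem toGL_gal (σ : Ω ≃ₐ[L] Ω) (ν : D.Cochar) (z : Ωˣ) : D.toGL (D.gal σ ν) z =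
    galGL σ (D.toGL ν (Units.map ((σ.symm : Ω →+* Ω) : Ω →* Ω) z)) := rfl

theorem IsRootDatum.pairing_gal [CharZero Ω] (hR : IsRootDatum R) (σ : Ω ≃ₐ[L] Ω) (χ : D.Char)
    (ν : D.Cochar) :
    R.toLinearMap (D.galChar σ χ) (D.gal σ ν) = R.toLinearMap χ ν := by
  apply unitTwo_zpow_injective (Ω := Ω)
  simp only
  rw [← hR.pairing, ← hR.pairing]
  apply Units.ext
  have h1 : (Additive.toMul (D.gal σ ν).1 : Ωˣ →* D.T) (unitTwo Ω) =
      D.galT σ ((Additive.toMul ν.1 : Ωˣ →* D.T) (unitTwo Ω)) := by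
    have h2 : Units.map ((σ.symm : Ω →+* Ω) : Ω →* Ω) (unitTwo Ω) = unitTwo Ω := by
      apply Units.ext
      exact map_ofNat σ.symm 2
    change D.galT σ ((Additive.toMul ν.1 : Ωˣ →* D.T) _) = _
    rw [h2]
  rw [h1, (D.galChar_eq_iff σ χ _).1 rfl, hR.pairing]
  simp [unitTwo, map_ofNat σ 2]

/-- The Galois action on cocharacters by automorphisms. -/
def galEquiv (D : QuasiSplitGroup L Ω n) (σ : Ω ≃ₐ[L] Ω) : D.Cochar ≃ₗ[ℤ] D.Cochar :=
  AddEquiv.toIntLinearEquiv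
    { (D.gal σ : D.Cochar →+ D.Cochar) with
      invFun := D.gal σ.symm
      left_inv := fun ν => by
        apply D.toGL_injective
        ext1 z
        simp only [ZeroHom.toFun_eq_coe, AddMonoidHom.toZeroHom_coe, toGL_gal]
        have h := galGL_symm_apply (n := n) σ.symm
        rw [AlgEquiv.symm_symm] at h
        rw [h]
        congr 1
        ext
        simp
      right_inv := fun ν => by
        apply D.toGL_injective
        ext1 z
        simp only [ZeroHom.toFun_eq_coe, AddMonoidHom.toZeroHom_coe, toGL_gal]
        rw [galGL_symm_apply]
        congr 1
        ext
        simp }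

theorem galEquiv_apply (σ : Ω ≃ₐ[L] Ω) (ν : D.Cochar) : D.galEquiv σ ν = D.gal σ ν := rfl

end QuasiSplitGroup
end

/-! ### The trace form as an invariant form, and lifting to conjugates of `μ`. -/

noncomputable section

open AlgGroup

/-- An isometry that sends one root to another also sends the coroot to the coroot. -/
theorem RootPairing.map_coroot_of_isometry {ι M N : Type*} [AddCommGroup M] [AddCommGroup N]
    {P : RootPairing ι ℤ M N} {B : LinearMap.BilinForm ℤ N} (hB : ∀ ν, ν ≠ 0 → 0 < B ν ν)
    (hBc : ∀ i ν, 2 * B ν (P.coroot i) =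
      P.toLinearMap (P.root i) ν * B (P.coroot i) (P.coroot i))
    {g : N ≃ₗ[ℤ] N} (hg : ∀ ν ν', B (g ν) (g ν') = B ν ν') {i j : ι}
    (hij : ∀ ν, P.toLinearMap (P.root j) (g ν) = P.toLinearMap (P.root i) ν) :
    g (P.coroot i) = P.coroot j := by
  have h2 : P.toLinearMap (P.root j) (g (P.coroot i)) = 2 := by
    rw [hij]
    exact P.root_coroot_two i
  have hpos : 0 < B (P.coroot j) (P.coroot j) := hB _ (P.ne_zero' j)
  -- Suitable multiples of `g (coroot i)` and `coroot j` represent the same functional through `B`,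
  -- hence agree. Pairing with root `j` shows that the two scalars are equal, and `N` is
  -- torsion-free.
  have h3 : ∀ ν, B ν (B (P.coroot j) (P.coroot j) • g (P.coroot i) -
      B (P.coroot i) (P.coroot i) • P.coroot j) = 0 := by
    intro ν
    obtain ⟨ν, rfl⟩ := g.surjective ν
    have h4 := hBc i ν
    have h5 := hBc j (g ν)
    rw [hij] at h5
    rw [map_sub, map_smul, map_smul, hg, smul_eq_mul, smul_eq_mul]
    have h6 : 2 * (B (P.coroot j) (P.coroot j) * B ν (P.coroot i) -
        B (P.coroot i) (P.coroot i) * B (g ν) (P.coroot j)) = 0 := by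
      linear_combination B (P.coroot j) (P.coroot j) * h4 - B (P.coroot i) (P.coroot i) * h5
    exact (mul_eq_zero.1 h6).resolve_left two_ne_zero
  have h4 : B (P.coroot j) (P.coroot j) • g (P.coroot i) -
      B (P.coroot i) (P.coroot i) • P.coroot j = 0 := by
    by_contra h
    exact absurd (h3 _) (hB _ h).ne'
  have h5 : B (P.coroot i) (P.coroot i) = B (P.coroot j) (P.coroot j) := by
    have h6 := congrArg (P.toLinearMap (P.root j)) h4
    have h7 : P.toLinearMap (P.root j) (P.coroot j) = 2 := P.root_coroot_two j
    rw [map_sub, map_smul, map_smul, h2, map_zero, h7, smul_eq_mul, smul_eq_mul] at h6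
    omega
  rw [h5, ← smul_sub] at h4
  have := P.isAddTorsionFree_right
  exact sub_eq_zero.1 ((smul_eq_zero.1 h4).resolve_left hpos.ne')

namespace QuasiSplitGroup

theorem charpoly_conj {Ω : Type*} [Field Ω] {n : ℕ} (g x : GL (Fin n) Ω) :
    (g * x * g⁻¹).1.charpoly = x.1.charpoly := by
  rw [Units.val_mul, Units.val_mul, Matrix.coe_units_inv]
  exact Matrix.charpoly_units_conj g x.1

variable {L Ω : Type*} [Field L] [Field Ω] [Algebra L Ω] {n : ℕ} (D : QuasiSplitGroup L Ω n)

/-- The diagonal entries of a torus that is diagonalized by `P`, as characters. -/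
def weightChar {P : GL (Fin n) Ω} (hP : ∀ t ∈ D.T, (P * t * P⁻¹).1.IsDiag) (i : Fin n) : D.Char :=
  ⟨Additive.ofMul (MonoidHom.toHomUnits
    { toFun := fun t => (P * t.1 * P⁻¹).1 i i
      map_one' := by simp
      map_mul' := fun s t => by
        have h : P * (s * t : D.T).1 * P⁻¹ = (P * s.1 * P⁻¹) * (P * t.1 * P⁻¹) := by
          simp only [Subgroup.coe_mul]; group
        rw [h, Units.val_mul (P * s.1 * P⁻¹), Matrix.mul_apply]
        exact Finset.sum_eq_single_of_mem i (Finset.mem_univ i) fun k _ hk => by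
          rw [hP s.1 s.2 hk.symm, zero_mul] }), by
    refine ⟨conjCoord P (Sum.inl (i, i)), fun t => ?_⟩
    rw [aeval_conjCoord]
    rfl⟩

theorem evalChar_weightChar {P : GL (Fin n) Ω} (hP : ∀ t ∈ D.T, (P * t * P⁻¹).1.IsDiag)
    (i : Fin n) (t : D.T) :
    (D.evalChar (D.weightChar hP i) t : Ω) = (P * t.1 * P⁻¹).1 i i := rfl

variable {D} {ι : Type*} {R : RootPairing ι ℤ D.Char D.Cochar}

theorem IsRootDatum.conj_toGL_eq_diagonal (hR : IsRootDatum R) {P : GL (Fin n) Ω}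
    (hP : ∀ t ∈ D.T, (P * t * P⁻¹).1.IsDiag) (ν : D.Cochar) (z : Ωˣ) :
    (P * D.toGL ν z * P⁻¹).1 =
      Matrix.diagonal fun i => (z : Ω) ^ (R.toLinearMap (D.weightChar hP i) ν) := by
  have h := hP (D.toGL ν z) ((Additive.toMul ν.1 : Ωˣ →* D.T) z).2
  rw [← h.diagonal_diag]
  congr 1
  funext i
  have h1 := congrArg Units.val (hR.pairing (D.weightChar hP i) ν z)
  rw [evalChar_weightChar] at h1
  rw [Units.val_zpow_eq_zpow_val] at h1
  exact h1

open Polynomial in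
theorem IsRootDatum.charpoly_toGL (hR : IsRootDatum R) {P : GL (Fin n) Ω}
    (hP : ∀ t ∈ D.T, (P * t * P⁻¹).1.IsDiag) (ν : D.Cochar) (z : Ωˣ) :
    (D.toGL ν z).1.charpoly =
      ∏ i, (X - C ((z : Ω) ^ (R.toLinearMap (D.weightChar hP i) ν))) := by
  rw [← Matrix.charpoly_diagonal, ← hR.conj_toGL_eq_diagonal hP ν z]
  exact (charpoly_conj P _).symm

/-- The roots of the characteristic polynomial at `2` are the powers of `2` with the weights as
exponents, so the polynomial determines the multiset of weights. -/
theorem IsRootDatum.sum_sq_eq_of_charpoly_eq [CharZero Ω] (hR : IsRootDatum R) {P : GL (Fin n) Ω}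
    (hP : ∀ t ∈ D.T, (P * t * P⁻¹).1.IsDiag) {ν ν' : D.Cochar}
    (h : (D.toGL ν (unitTwo Ω)).1.charpoly = (D.toGL ν' (unitTwo Ω)).1.charpoly) :
    ∑ i, R.toLinearMap (D.weightChar hP i) ν * R.toLinearMap (D.weightChar hP i) ν =
      ∑ i, R.toLinearMap (D.weightChar hP i) ν' * R.toLinearMap (D.weightChar hP i) ν' := by
  rw [hR.charpoly_toGL hP, hR.charpoly_toGL hP] at h
  have h1 := congrArg Polynomial.roots h
  have h2 : ∀ m : Fin n → ℤ, (∏ i, (Polynomial.X - Polynomial.C ((unitTwo Ω : Ω) ^ m i))).roots =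
      (Finset.univ.val.map m).map (fun k : ℤ => (2 : Ω) ^ k) := by
    intro m
    rw [← Polynomial.roots_multiset_prod_X_sub_C ((Finset.univ.val.map m).map _),
      Multiset.map_map, Multiset.map_map]
    rfl
  rw [h2, h2] at h1
  have h3 := Multiset.map_injective two_zpow_injective h1
  have h4 := congrArg (fun s : Multiset ℤ => (s.map fun k => k * k).sum) h3
  simpa only [Multiset.map_map] using! h4

/-- The trace form of the representation of the torus. -/
def traceForm (R : RootPairing ι ℤ D.Char D.Cochar) {P : GL (Fin n) Ω}
    (hP : ∀ t ∈ D.T, (P * t * P⁻¹).1.IsDiag) : LinearMap.BilinForm ℤ D.Cochar :=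
  ∑ i, (LinearMap.mul ℤ ℤ).compl₁₂ (R.toLinearMap (D.weightChar hP i))
    (R.toLinearMap (D.weightChar hP i))

theorem traceForm_apply {P : GL (Fin n) Ω}
    (hP : ∀ t ∈ D.T, (P * t * P⁻¹).1.IsDiag) (ν ν' : D.Cochar) :
    traceForm R hP ν ν' =
      ∑ i, R.toLinearMap (D.weightChar hP i) ν * R.toLinearMap (D.weightChar hP i) ν' := by
  simp [traceForm]

theorem traceForm_comm {P : GL (Fin n) Ω}
    (hP : ∀ t ∈ D.T, (P * t * P⁻¹).1.IsDiag) (ν ν' : D.Cochar) :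
    traceForm R hP ν ν' = traceForm R hP ν' ν := by
  rw [traceForm_apply, traceForm_apply]
  exact Finset.sum_congr rfl fun i _ => mul_comm _ _

/-- A cocharacter on which all weights vanish becomes trivial after diagonalization, and so is
trivial. -/
theorem IsRootDatum.traceForm_pos (hR : IsRootDatum R) {P : GL (Fin n) Ω}
    (hP : ∀ t ∈ D.T, (P * t * P⁻¹).1.IsDiag) (ν : D.Cochar) (hν : ν ≠ 0) :
    0 < traceForm R hP ν ν := by
  rw [traceForm_apply]
  refine lt_of_le_of_ne (Finset.sum_nonneg fun i _ => mul_self_nonneg _) fun h => hν ?_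
  have h1 := (Finset.sum_eq_zero_iff_of_nonneg fun i _ => mul_self_nonneg _).1 h.symm
  apply D.toGL_injective
  ext1 z
  have h2 : P * D.toGL ν z * P⁻¹ = 1 := by
    apply Units.ext
    rw [hR.conj_toGL_eq_diagonal hP]
    have h3 : ∀ i, R.toLinearMap (D.weightChar hP i) ν = 0 := fun i => by
      simpa using h1 i (Finset.mem_univ i)
    simp [h3]
  have h3 : D.toGL ν z = P⁻¹ * (P * D.toGL ν z * P⁻¹) * P := by group
  rw [h3, h2]
  simp [toGL]

theorem traceForm_eq_of_quadratic {P : GL (Fin n) Ω}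
    (hP : ∀ t ∈ D.T, (P * t * P⁻¹).1.IsDiag) (g : D.Cochar →ₗ[ℤ] D.Cochar)
    (h : ∀ ν, traceForm R hP (g ν) (g ν) = traceForm R hP ν ν) (ν ν' : D.Cochar) :
    traceForm R hP (g ν) (g ν') = traceForm R hP ν ν' := by
  have h1 := h (ν + ν')
  simp only [map_add, LinearMap.add_apply, h] at h1
  have h2 := traceForm_comm (R := R) hP (g ν') (g ν)
  have h3 := traceForm_comm (R := R) hP ν' ν
  omega

theorem toGL_val_charpoly_eq_of_conj {ν ν' : D.Cochar} {g : GL (Fin n) Ω} {z : Ωˣ}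
    (h : g * D.toGL ν z * g⁻¹ = D.toGL ν' z) :
    (D.toGL ν z).1.charpoly = (D.toGL ν' z).1.charpoly := by
  rw [← h]
  exact (charpoly_conj g _).symm

/-- The coreflection is induced by conjugation, which preserves characteristic polynomials and hence
the form. Compare `B` at `ν` and the coroot before and after the coreflection, which negates the
coroot. -/
theorem IsRootDatum.traceForm_coroot [CharZero Ω] (hR : IsRootDatum R) {P : GL (Fin n) Ω}
    (hP : ∀ t ∈ D.T, (P * t * P⁻¹).1.IsDiag) (i : ι) (ν : D.Cochar) :
    2 * traceForm R hP ν (R.coroot i) =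
      R.toLinearMap (R.root i) ν * traceForm R hP (R.coroot i) (R.coroot i) := by
  obtain ⟨g, -, -, hg⟩ := hR.coroot i
  have h := traceForm_eq_of_quadratic (R := R) hP (R.coreflection i).toLinearMap (fun ν => by
    rw [traceForm_apply, traceForm_apply]
    exact (hR.sum_sq_eq_of_charpoly_eq hP (toGL_val_charpoly_eq_of_conj (hg ν _))).symm) ν
      (R.coroot i)
  simp only [LinearEquiv.coe_coe, RootPairing.coreflection_apply_self,
    RootPairing.coreflection_apply', map_neg, map_sub, map_smul, LinearMap.sub_apply,
    LinearMap.smul_apply, smul_eq_mul] at h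
  linarith

/-- At the Galois-fixed point `2` the characteristic polynomial has roots in the powers of `2`, so
`σ` does not change it. -/
theorem IsRootDatum.traceForm_gal [CharZero Ω] (hR : IsRootDatum R) {P : GL (Fin n) Ω}
    (hP : ∀ t ∈ D.T, (P * t * P⁻¹).1.IsDiag) (σ : Ω ≃ₐ[L] Ω) (ν ν' : D.Cochar) :
    traceForm R hP (D.gal σ ν) (D.gal σ ν') = traceForm R hP ν ν' := by
  refine traceForm_eq_of_quadratic (R := R) hP (D.galEquiv σ).toLinearMap (fun ν => ?_) ν ν'
  rw [traceForm_apply, traceForm_apply]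
  refine hR.sum_sq_eq_of_charpoly_eq hP ?_
  have h1 : (D.toGL (D.gal σ ν) (unitTwo Ω)).1 = (D.toGL ν (unitTwo Ω)).1.map (σ : Ω →+* Ω) := by
    rw [toGL_gal]
    have h2 : Units.map ((σ.symm : Ω →+* Ω) : Ω →* Ω) (unitTwo Ω) = unitTwo Ω :=
      Units.ext (map_ofNat σ.symm 2)
    rw [h2]
    rfl
  change (D.toGL (D.gal σ ν) (unitTwo Ω)).1.charpoly = _
  rw [h1, Matrix.charpoly_map, hR.charpoly_toGL hP, Polynomial.map_prod]
  refine Finset.prod_congr rfl fun i _ => ?_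
  have h3 : σ (2 : Ω) = 2 := map_ofNat σ 2
  simp [unitTwo, h3]

/-- The Galois action on cocharacters sends the coroot of a root to the coroot of its image. -/
theorem IsRootDatum.gal_coroot [CharZero Ω] (hR : IsRootDatum R) {σ : Ω ≃ₐ[L] Ω} {i j : ι}
    (hij : R.root j = D.galChar σ (R.root i)) : D.gal σ (R.coroot i) = R.coroot j := by
  obtain ⟨P, hP⟩ : ∃ P : GL (Fin n) Ω, ∀ t ∈ D.T, (P * t * P⁻¹).1.IsDiag := D.quasiSplit.2
  exact RootPairing.map_coroot_of_isometry (P := R) (g := D.galEquiv σ) (hR.traceForm_pos hP)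
    (hR.traceForm_coroot hP) (hR.traceForm_gal hP σ) fun ν => by
      rw [hij, galEquiv_apply, hR.pairing_gal]


/-- The Galois action on the roots. -/
abbrev rootAction (hR : IsRootDatum R) : MulAction (Ω ≃ₐ[L] Ω) ι where
  smul σ i := (hR.galChar_root_mem σ i).choose
  one_smul i := R.root.injective (by
    rw [← D.galChar_one (R.root i)]
    exact (hR.galChar_root_mem 1 i).choose_spec)
  mul_smul σ τ i := R.root.injective (by
    have h : ∀ σ i, R.root ((hR.galChar_root_mem σ i).choose) = D.galChar σ (R.root i) :=
      fun σ i => (hR.galChar_root_mem σ i).choose_spec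
    change R.root ((hR.galChar_root_mem (σ * τ) i).choose) =
      R.root ((hR.galChar_root_mem σ ((hR.galChar_root_mem τ i).choose)).choose)
    rw [h, h, h, galChar_mul])

/-- The Galois action on the roots, as a homomorphism. -/
def rootPerm (hR : IsRootDatum R) : (Ω ≃ₐ[L] Ω) →* Equiv.Perm ι :=
  letI := rootAction hR
  MulAction.toPermHom _ ι

theorem root_rootPerm (hR : IsRootDatum R) (σ : Ω ≃ₐ[L] Ω) (i : ι) :
    R.root (rootPerm hR σ i) = D.galChar σ (R.root i) :=
  (hR.galChar_root_mem σ i).choose_spec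

theorem rootPerm_mem_support (hR : IsRootDatum R) {b : R.Base} (hb : IsGaloisStable b)
    (σ : Ω ≃ₐ[L] Ω) {i : ι} (hi : i ∈ b.support) : rootPerm hR σ i ∈ b.support := by
  obtain ⟨j, hj, h⟩ := hb σ i hi
  rw [← galChar_eq_iff, ← root_rootPerm hR] at h
  rwa [← R.root.injective h]

theorem isCompatible_galEquiv [CharZero Ω] (hR : IsRootDatum R) (σ : Ω ≃ₐ[L] Ω) :
    R.IsCompatible (D.galEquiv σ) (rootPerm hR σ) := by
  refine ⟨fun i => ?_, fun i ν => ?_⟩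
  · rw [galEquiv_apply]
    exact hR.gal_coroot (root_rootPerm hR σ i)
  · rw [root_rootPerm, galEquiv_apply, hR.pairing_gal]

/-- The Galois group may be infinite, but it permutes the finite set of roots through a finite
image, which serves as the acting group. The norm pairing kills `σ ν - ν` by reindexing the sum. -/
theorem isCoinvariantKernel_coinvKer [CharZero Ω] [Finite ι] (hR : IsRootDatum R)
    [Fintype (rootPerm hR).range] :
    R.IsCoinvariantKernel (rootPerm hR).range.subtype D.coinvKer := by
  refine ⟨?_, ?_, ?_⟩
  · rintro ⟨_, σ, rfl⟩
    exact ⟨D.galEquiv σ, isCompatible_galEquiv hR σ⟩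
  · rintro ⟨_, σ, rfl⟩ i
    exact AddSubgroup.subset_closure ⟨σ, R.coroot i, by
      rw [← galEquiv_apply, (isCompatible_galEquiv hR σ).1]; rfl⟩
  · intro i ν hν
    induction hν using AddSubgroup.closure_induction with
    | mem x hx =>
      obtain ⟨σ, ν, rfl⟩ := hx
      simp only [map_sub, Finset.sum_sub_distrib, sub_eq_zero]
      refine Fintype.sum_equiv (Equiv.mulLeft (⟨_, σ, rfl⟩ : (rootPerm hR).range)⁻¹) _ _ ?_
      rintro h
      have h1 := (isCompatible_galEquiv hR σ).2 ((rootPerm hR σ)⁻¹ (h.1 i)) ν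
      have h2 : rootPerm hR σ ((rootPerm hR σ)⁻¹ (h.1 i)) = h.1 i := by simp
      rw [h2] at h1
      exact h1
    | zero => simp only [map_zero, Finset.sum_const_zero]
    | add x y _ _ hx hy => simp only [map_add, Finset.sum_add_distrib, hx, hy, add_zero]
    | neg x _ hx => simp only [map_neg, Finset.sum_neg_distrib, hx, neg_zero]

/-- A conjugate of a minuscule cocharacter that lies in `T` pairs with roots to at most `1`. -/
theorem IsRootDatum.pairing_le_one (hR : IsRootDatum R) {μ : Ωˣ →* GL (Fin n) Ω}
    (hmin : IsMinuscule D.G μ) {ν : D.Cochar} (hν : IsConjIn D.G μ (D.toGL ν)) (i : ι) :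
    R.toLinearMap (R.root i) ν ≤ 1 := by
  obtain ⟨g, hg, hgν⟩ := hν
  obtain ⟨-, X, hX0, hX, hw⟩ := (hR.root _).1 ⟨i, rfl⟩
  -- Conjugating a root vector back by `g⁻¹` gives a weight vector for `μ` of weight `⟨α_i, ν⟩`.
  have h := hmin (R.toLinearMap (R.root i) ν) ((g⁻¹).1 * X * (g⁻¹⁻¹).1) ?_
    (hX.conj (inv_mem hg)) ?_
  · omega
  · intro h0
    apply hX0
    have h1 : g.1 * ((g⁻¹).1 * X * (g⁻¹⁻¹).1) * (g⁻¹).1 = X := by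
      rw [inv_inv, ← mul_assoc, ← mul_assoc, Units.mul_inv, one_mul, mul_assoc, Units.mul_inv,
        mul_one]
    rw [← h1, h0]
    simp
  · intro z
    have h1 : D.toGL ν z = g * μ z * g⁻¹ := (hgν z).symm
    have h2 := hw ((Additive.toMul ν.1 : Ωˣ →* D.T) z)
    rw [hR.pairing] at h2
    change (D.toGL ν z).1 * X * ((D.toGL ν z)⁻¹).1 = _ at h2
    have h3 : μ z * g⁻¹ = g⁻¹ * D.toGL ν z := by rw [h1]; group
    have h4 : (g⁻¹)⁻¹ * (μ z)⁻¹ = (D.toGL ν z)⁻¹ * g⁻¹⁻¹ := by rw [h1]; group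
    calc (μ z).1 * ((g⁻¹).1 * X * (g⁻¹⁻¹).1) * ((μ z)⁻¹).1
        = (μ z * g⁻¹).1 * X * ((g⁻¹)⁻¹ * (μ z)⁻¹).1 := by
          simp only [Units.val_mul, mul_assoc]
      _ = (g⁻¹).1 * ((D.toGL ν z).1 * X * ((D.toGL ν z)⁻¹).1) * (g⁻¹⁻¹).1 := by
          rw [h3, h4]
          simp only [Units.val_mul, mul_assoc]
      _ = _ := by
          rw [h2, Matrix.mul_smul, Matrix.smul_mul]

theorem IsRootDatum.exists_conj_of_mem_coweyl (hR : IsRootDatum R) {u : D.Cochar ≃ₗ[ℤ] D.Cochar}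
    (hu : u ∈ R.coweyl) :
    ∃ g ∈ D.G, ∀ ν z, g * D.toGL ν z * g⁻¹ = D.toGL (u ν) z := by
  induction hu using Subgroup.closure_induction with
  | mem x hx =>
    obtain ⟨i, rfl⟩ := hx
    obtain ⟨g, hg, -, h⟩ := hR.coroot i
    exact ⟨g, hg, h⟩
  | one => exact ⟨1, one_mem _, fun ν z => by simp⟩
  | mul x y _ _ hx hy =>
    obtain ⟨g, hg, h⟩ := hx
    obtain ⟨g', hg', h'⟩ := hy
    refine ⟨g * g', mul_mem hg hg', fun ν z => ?_⟩
    rw [LinearEquiv.mul_apply, ← h, ← h']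
    group
  | inv x _ hx =>
    obtain ⟨g, hg, h⟩ := hx
    refine ⟨g⁻¹, inv_mem hg, fun ν z => ?_⟩
    have h1 : x (x⁻¹ ν) = ν := x.apply_symm_apply ν
    have h2 := h (x⁻¹ ν) z
    rw [h1] at h2
    rw [← h2]
    group

theorem IsRootDatum.isConjIn_weyl (hR : IsRootDatum R) {μ : Ωˣ →* GL (Fin n) Ω}
    {ν : D.Cochar} (hν : IsConjIn D.G μ (D.toGL ν)) {u : D.Cochar ≃ₗ[ℤ] D.Cochar}
    (hu : u ∈ R.coweyl) : IsConjIn D.G μ (D.toGL (u ν)) := by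
  obtain ⟨g, hg, h⟩ := hν
  obtain ⟨g', hg', h'⟩ := hR.exists_conj_of_mem_coweyl hu
  refine ⟨g' * g, mul_mem hg' hg, fun z => ?_⟩
  rw [← h', ← h]
  group

/-- Elements of the coinvariants that are congruent to a minuscule cocharacter modulo coroots and
bounded by its orbit lift to conjugates. -/
theorem exists_conj_lift [CharZero Ω] [Finite ι] (hR : IsRootDatum R) {b : R.Base}
    (hb : IsGaloisStable b) {μ : Ωˣ →* GL (Fin n) Ω} (hmin : IsMinuscule D.G μ) {ν : D.Cochar}
    (hν : IsConjIn D.G μ (D.toGL ν)) (hdom : IsDominant b ν) (l : D.Cochar)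
    (hQ : ∃ θ ∈ Submodule.span ℤ (Set.range R.coroot), ν - l - θ ∈ D.coinvKer)
    (hC : ∀ φ : D.Cochar →+ ℚ, (∀ ν ∈ D.coinvKer, φ ν = 0) →
      ∃ u ∈ R.coweyl, φ l ≤ φ (u ν)) :
    ∃ v : D.Cochar, v - l ∈ D.coinvKer ∧ IsConjIn D.G μ (D.toGL v) := by
  obtain ⟨P, hP⟩ : ∃ P : GL (Fin n) Ω, ∀ t ∈ D.T, (P * t * P⁻¹).1.IsDiag := D.quasiSplit.2
  have := Fintype.ofFinite (rootPerm hR).range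
  obtain ⟨u, hu, h⟩ := (isCoinvariantKernel_coinvKer hR).exists_weyl_sub_mem b
    (by
      rintro ⟨_, σ, rfl⟩ i hi
      exact rootPerm_mem_support hR hb σ hi)
    (hR.traceForm_pos hP) (hR.traceForm_coroot hP) (hR.pairing_le_one hmin hν) hdom hQ hC
  exact ⟨u ν, h, hR.isConjIn_weyl hν hu⟩

end QuasiSplitGroup
end

/-! ### Affine reflections: lengths, fixed points of finite parabolic subgroups, displacements. -/

noncomputable section

namespace AffineReflection

variable {V : Type*} [AddCommGroup V] [Module ℝ V]

/-- An affine map that fixes a hyperplane and acts as a reflection. -/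
def IsRefl (a : V →ᵃ[ℝ] V) : Prop :=
  ∃ (F : V →ᵃ[ℝ] ℝ) (u : V), F.linear u = 2 ∧ ∀ v, a v = v - F v • u

/-- The segment from `x` to `y` has no fixed point. -/
def SameSide (a : V →ᵃ[ℝ] V) (x y : V) : Prop := ∀ v ∈ segment ℝ x y, a v ≠ v

theorem SameSide.symm {a : V →ᵃ[ℝ] V} {x y : V} (h : SameSide a x y) : SameSide a y x := by
  intro v hv
  rw [segment_symm] at hv
  exact h v hv

theorem fixed_iff {a : V →ᵃ[ℝ] V} {F : V →ᵃ[ℝ] ℝ} {u : V} (hu : F.linear u = 2)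
    (ha : ∀ v, a v = v - F v • u) (v : V) : a v = v ↔ F v = 0 := by
  have h0 : u ≠ 0 := by
    rintro rfl
    simp at hu
  rw [ha, sub_eq_self, smul_eq_zero]
  simp [h0]

theorem lineMap_mem_segment' {x y : V} {t : ℝ} (h0 : 0 ≤ t) (h1 : t ≤ 1) :
    AffineMap.lineMap x y t ∈ segment ℝ x y := by
  rw [segment_eq_image_lineMap]
  exact ⟨t, ⟨h0, h1⟩, rfl⟩

theorem apply_lineMap_real (F : V →ᵃ[ℝ] ℝ) (x y : V) (t : ℝ) :
    F (AffineMap.lineMap x y t) = (1 - t) * F x + t * F y := by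
  rw [AffineMap.apply_lineMap, AffineMap.lineMap_apply]
  simp only [vsub_eq_sub, smul_eq_mul, vadd_eq_add]
  ring

theorem exists_zero {F : V →ᵃ[ℝ] ℝ} {x y : V} (h : F x * F y < 0) :
    ∃ t : ℝ, 0 < t ∧ t < 1 ∧ F (AffineMap.lineMap x y t) = 0 := by
  have h1 : F x - F y ≠ 0 := by
    intro h0
    have : F x = F y := by linarith
    rw [this] at h
    nlinarith [mul_self_nonneg (F y)]
  refine ⟨F x / (F x - F y), ?_, ?_, ?_⟩
  · rw [div_pos_iff]
    rcases lt_or_gt_of_ne h1 with h2 | h2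
    · right; exact ⟨by nlinarith [mul_self_nonneg (F x)], h2⟩
    · left; exact ⟨by nlinarith [mul_self_nonneg (F x)], h2⟩
  · have h3 : F x / (F x - F y) - 1 = F y / (F x - F y) := by field_simp; ring
    have h4 : F y / (F x - F y) < 0 := by
      rw [div_neg_iff]
      rcases lt_or_gt_of_ne h1 with h2 | h2
      · left; exact ⟨by nlinarith [mul_self_nonneg (F y)], h2⟩
      · right; exact ⟨by nlinarith [mul_self_nonneg (F y)], h2⟩
    linarith
  · rw [apply_lineMap_real]
    field_simp
    ring

/-- An affine function with no zero on a segment has one strict sign there, and conversely; this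
turns separation into a sign condition. -/
theorem sameSide_iff {a : V →ᵃ[ℝ] V} {F : V →ᵃ[ℝ] ℝ} {u : V} (hu : F.linear u = 2)
    (ha : ∀ v, a v = v - F v • u) {x y : V} : SameSide a x y ↔ 0 < F x * F y := by
  constructor
  · intro h
    have hx : F x ≠ 0 := fun h0 => h x (left_mem_segment ℝ x y) ((fixed_iff hu ha x).2 h0)
    have hy : F y ≠ 0 := fun h0 => h y (right_mem_segment ℝ x y) ((fixed_iff hu ha y).2 h0)
    by_contra h1
    obtain ⟨t, h0, h1, ht⟩ := exists_zero (lt_of_le_of_ne (not_lt.1 h1) (mul_ne_zero hx hy))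
    exact h _ (lineMap_mem_segment' h0.le h1.le) ((fixed_iff hu ha _).2 ht)
  · intro h v hv hf
    rw [segment_eq_image_lineMap] at hv
    obtain ⟨t, ⟨h0, h1⟩, rfl⟩ := hv
    rw [fixed_iff hu ha, apply_lineMap_real] at hf
    have h2 : (1 - t) * (F x * F x) + t * (F x * F y) = 0 := by linear_combination F x * hf
    have hx : 0 < F x * F x := by
      refine mul_self_pos.2 ?_
      rintro h3
      simp [h3] at h
    rcases eq_or_lt_of_le h0 with h4 | h4
    · subst h4; linarith
    · have := mul_pos h4 h
      have := mul_nonneg (sub_nonneg.2 h1) hx.le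
      linarith

variable {W : Type*} [Group W] (ρ : W →* (V →ᵃ[ℝ] V))

theorem apply_mul (g h : W) (v : V) : ρ (g * h) v = ρ g (ρ h v) := by
  rw [map_mul]; rfl

theorem apply_inv_apply (g : W) (v : V) : ρ g⁻¹ (ρ g v) = v := by
  rw [← apply_mul]; simp

theorem apply_apply_inv (g : W) (v : V) : ρ g (ρ g⁻¹ v) = v := by
  rw [← apply_mul]; simp

theorem conj_fixed_iff (r w : W) (v : V) : ρ (w⁻¹ * r * w) v = v ↔ ρ r (ρ w v) = ρ w v := by
  rw [apply_mul, apply_mul]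
  constructor
  · intro h
    have := congrArg (ρ w) h
    rwa [apply_apply_inv] at this
  · intro h
    rw [h, apply_inv_apply]

theorem sameSide_conj_iff (r w : W) (x y : V) :
    SameSide (ρ (w⁻¹ * r * w)) x y ↔ SameSide (ρ r) (ρ w x) (ρ w y) := by
  have h : segment ℝ (ρ w x) (ρ w y) = ρ w '' segment ℝ x y := (image_segment ℝ (ρ w) x y).symm
  simp only [SameSide, h, Set.forall_mem_image, ne_eq, conj_fixed_iff]

/-- A set of reflections that is stable under conjugation and locally finite. -/
structure IsReflectionSet (S : Set W) : Prop where
  isRefl : ∀ r ∈ S, IsRefl (ρ r)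
  conj_mem : ∀ g, ∀ r ∈ S, g * r * g⁻¹ ∈ S
  finite : ∀ x y, {r | r ∈ S ∧ ¬ SameSide (ρ r) x y}.Finite

theorem IsRefl.conj {r : W} (hr : IsRefl (ρ r)) (g : W) : IsRefl (ρ (g * r * g⁻¹)) := by
  obtain ⟨F, u, hu, ha⟩ := hr
  refine ⟨F.comp (ρ g⁻¹), (ρ g).linear u, ?_, fun v => ?_⟩
  · have h : (ρ g⁻¹).linear ((ρ g).linear u) = u := by
      have h1 := congrArg AffineMap.linear (map_mul ρ g⁻¹ g)
      rw [inv_mul_cancel, map_one] at h1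
      exact (LinearMap.congr_fun h1 u).symm
    rw [AffineMap.comp_linear, LinearMap.comp_apply, h, hu]
  · rw [apply_mul, apply_mul, ha, AffineMap.comp_apply]
    have h := (ρ g).linearMap_vsub (ρ g⁻¹ v - F (ρ g⁻¹ v) • u) (ρ g⁻¹ v)
    rw [vsub_eq_sub, vsub_eq_sub, apply_apply_inv, sub_sub_cancel_left, map_neg, map_smul] at h
    rw [sub_eq_iff_eq_add.1 h.symm]
    abel

variable {ρ} {S : Set W}

namespace IsReflectionSet

theorem conj_mem' (hS : IsReflectionSet ρ S) (g : W) {r : W} (hr : r ∈ S) : g⁻¹ * r * g ∈ S := by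
  simpa using hS.conj_mem g⁻¹ r hr

theorem trans (hS : IsReflectionSet ρ S) {r : W} (hr : r ∈ S) {x y z : V}
    (h : SameSide (ρ r) x y) (h' : SameSide (ρ r) y z) : SameSide (ρ r) x z := by
  obtain ⟨F, u, hu, ha⟩ := hS.isRefl r hr
  rw [sameSide_iff hu ha] at h h' ⊢
  have h1 : 0 < (F x * F z) * (F y * F y) := by nlinarith [mul_pos h h']
  have h2 : 0 ≤ F y * F y := mul_self_nonneg _
  exact pos_of_mul_pos_left h1 h2

/-- The reflections whose hyperplane separates a chamber from its translate. -/
def inversions (ρ : W →* (V →ᵃ[ℝ] V)) (S : Set W) (x₀ : V) (w : W) : Set W :=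
  {r | r ∈ S ∧ ¬ SameSide (ρ r) x₀ (ρ w x₀)}

theorem generic_apply (hS : IsReflectionSet ρ S) {x₀ : V} (hx₀ : ∀ r ∈ S, ρ r x₀ ≠ x₀)
    {r : W} (hr : r ∈ S) (w : W) : ρ r (ρ w x₀) ≠ ρ w x₀ := by
  rw [ne_eq, ← conj_fixed_iff]
  exact hx₀ _ (hS.conj_mem' w hr)

/-- Let `y = w x₀`. The segment from `x₀` to `r y` crosses the hyperplane of `r`; reflecting the
part beyond the crossing gives a broken path from `x₀` to `y`. A hyperplane separating `x₀` from `y`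
meets this path, so either it or its reflection by `r` meets the segment. This injects the
inversions of `w` into those of `r w`, missing `r`. The contrapositive is used: if the length drops,
`r` separates. -/
theorem ncard_inversions_lt (hS : IsReflectionSet ρ S) {x₀ : V} (hx₀ : ∀ r ∈ S, ρ r x₀ ≠ x₀)
    {r w : W} (hr : r ∈ S) (hrw : r ∉ inversions ρ S x₀ w) :
    (inversions ρ S x₀ w).ncard < (inversions ρ S x₀ (r * w)).ncard := by
  classical
  set y := ρ w x₀ with hy
  have hsame : SameSide (ρ r) x₀ y := by
    by_contra h
    exact hrw ⟨hr, h⟩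
  obtain ⟨F, u, hu, ha⟩ := hS.isRefl r hr
  have hrwy : ρ (r * w) x₀ = ρ r y := apply_mul ρ r w x₀
  have hFry : F (ρ r y) = - F y := by
    have h1 : ρ r y = (- F y • u) +ᵥ y := by rw [ha, vadd_eq_add]; module
    rw [h1, AffineMap.map_vadd, map_smul, hu, vadd_eq_add, smul_eq_mul]
    ring
  have hpos := (sameSide_iff hu ha).1 hsame
  obtain ⟨t₀, ht0, ht1, hq⟩ := exists_zero (F := F) (x := x₀) (y := ρ r y)
    (by rw [hFry]; linarith)
  set p : ℝ → V := fun t => AffineMap.lineMap x₀ (ρ r y) t with hp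
  have hpseg : ∀ t, 0 ≤ t → t ≤ 1 → p t ∈ segment ℝ x₀ (ρ r y) := fun t h h' =>
    lineMap_mem_segment' h h'
  have hrq : ρ r (p t₀) = p t₀ := (fixed_iff hu ha _).2 hq
  -- the reflected crossing point lies on the second half of the segment
  have hcross : ∀ s ∈ inversions ρ S x₀ w, (¬ ∃ t, 0 ≤ t ∧ t < t₀ ∧ ρ s (p t) = p t) →
      ∃ t, t₀ ≤ t ∧ t ≤ 1 ∧ ρ (r * s * r⁻¹) (p t) = p t := by
    rintro s ⟨hs, hsep⟩ hno
    obtain ⟨E, e, he, hE⟩ := hS.isRefl s hs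
    have hEx : E x₀ ≠ 0 := fun h => hx₀ s hs ((fixed_iff he hE _).2 h)
    have hEy : E y ≠ 0 := fun h => hS.generic_apply hx₀ hs w ((fixed_iff he hE _).2 h)
    rw [sameSide_iff he hE, not_lt] at hsep
    have hsep' : E x₀ * E y < 0 := lt_of_le_of_ne hsep (mul_ne_zero hEx hEy)
    -- No zero occurs strictly before `t₀`, so the sign change of `E` takes place between `p t₀` and
    -- `y`; the crossing may be at `p t₀` itself, which is `τ = 0`.
    have h1 : 0 ≤ E x₀ * E (p t₀) := by
      by_contra h
      obtain ⟨t, h2, h3, h4⟩ := exists_zero (not_le.1 h)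
      refine hno ⟨t * t₀, by positivity, by nlinarith, ?_⟩
      rw [fixed_iff he hE]
      rw [apply_lineMap_real] at h4
      simp only [hp, apply_lineMap_real] at h4 ⊢
      linear_combination h4
    obtain ⟨τ, hτ0, hτ1, hτ⟩ : ∃ τ : ℝ, 0 ≤ τ ∧ τ ≤ 1 ∧ E (AffineMap.lineMap (p t₀) y τ) = 0 := by
      by_cases h2 : E (p t₀) = 0
      · exact ⟨0, le_rfl, zero_le_one, by simpa using h2⟩
      · have h3 : E (p t₀) * E y < 0 := by
          have h4 : 0 < E x₀ * E (p t₀) := lt_of_le_of_ne h1 (mul_ne_zero hEx h2).symm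
          have h5 : (E (p t₀) * E y) * (E x₀ * E x₀) < 0 := by nlinarith [mul_pos h4 (neg_pos.2 hsep')]
          by_contra h6
          have := mul_nonneg (not_lt.1 h6) (mul_self_nonneg (E x₀))
          linarith
        obtain ⟨t, h4, h5, h6⟩ := exists_zero h3
        exact ⟨t, h4.le, h5.le, h6⟩
    -- The reflection fixes `p t₀` and sends `y` to the end of the segment, so the crossing point
    -- returns to the segment.
    have h2 : ρ r (AffineMap.lineMap (p t₀) y τ) = p (t₀ + τ * (1 - t₀)) := by
      rw [AffineMap.apply_lineMap, hrq]
      simp only [hp, AffineMap.lineMap_apply, vsub_eq_sub, vadd_eq_add]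
      module
    refine ⟨t₀ + τ * (1 - t₀), by nlinarith, by nlinarith, ?_⟩
    rw [← h2]
    have h3 := (conj_fixed_iff ρ s r⁻¹ (ρ r (AffineMap.lineMap (p t₀) y τ)))
    rw [inv_inv, apply_inv_apply] at h3
    exact h3.2 ((fixed_iff he hE _).2 hτ)
  let ψ : W → W := fun s => if ∃ t, 0 ≤ t ∧ t < t₀ ∧ ρ s (p t) = p t then s else r * s * r⁻¹
  have hfin : (inversions ρ S x₀ (r * w)).Finite := hS.finite _ _
  have hmap : ∀ s ∈ inversions ρ S x₀ w, ψ s ∈ inversions ρ S x₀ (r * w) := by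
    intro s hs
    by_cases h : ∃ t, 0 ≤ t ∧ t < t₀ ∧ ρ s (p t) = p t
    · simp only [ψ, if_pos h]
      obtain ⟨t, h0, h1, h2⟩ := h
      refine ⟨hs.1, fun h3 => h3 (p t) ?_ h2⟩
      rw [hrwy]
      exact hpseg t h0 (by linarith)
    · simp only [ψ, if_neg h]
      obtain ⟨t, h0, h1, h2⟩ := hcross s hs h
      refine ⟨hS.conj_mem r s hs.1, fun h3 => h3 (p t) ?_ h2⟩
      rw [hrwy]
      exact hpseg t (by linarith) h1
  -- As `x₀` lies on no hyperplane, each hyperplane meets the segment at most once. So a reflection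
  -- kept by `ψ` cannot coincide with a conjugated one: one crosses before `t₀`, the other not.
  have huniq : ∀ s ∈ S, ∀ t t', t < t' → ρ s (p t) = p t → ρ s (p t') = p t' → False := by
    intro s hs t t' htt' h h'
    obtain ⟨E, e, he, hE⟩ := hS.isRefl s hs
    rw [fixed_iff he hE] at h h'
    simp only [hp, apply_lineMap_real] at h h'
    have h1 : (t' - t) * E x₀ = 0 := by linear_combination t' * h - t * h'
    rcases mul_eq_zero.1 h1 with h2 | h2
    · linarith
    · exact hx₀ s hs ((fixed_iff he hE _).2 h2)
  have hinj : Set.InjOn ψ (inversions ρ S x₀ w) := by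
    have key : ∀ s ∈ inversions ρ S x₀ w, ∀ s' ∈ inversions ρ S x₀ w,
        (∃ t, 0 ≤ t ∧ t < t₀ ∧ ρ s (p t) = p t) →
        (¬ ∃ t, 0 ≤ t ∧ t < t₀ ∧ ρ s' (p t) = p t) → s ≠ r * s' * r⁻¹ := by
      rintro s hs s' hs' ⟨t, h0, h1, h2⟩ hno rfl
      obtain ⟨t', h3, h4, h5⟩ := hcross s' hs' hno
      exact huniq _ hs.1 t t' (by linarith) h2 h5
    intro s hs s' hs' hss
    by_cases h : ∃ t, 0 ≤ t ∧ t < t₀ ∧ ρ s (p t) = p t <;>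
      by_cases h' : ∃ t, 0 ≤ t ∧ t < t₀ ∧ ρ s' (p t) = p t
    · simpa only [ψ, if_pos h, if_pos h'] using hss
    · refine absurd ?_ (key s hs s' hs' h h')
      simpa only [ψ, if_pos h, if_neg h'] using hss
    · refine absurd ?_ (key s' hs' s hs h' h)
      simpa only [ψ, if_neg h, if_pos h'] using hss.symm
    · have h1 : r * s * r⁻¹ = r * s' * r⁻¹ := by
        simpa only [ψ, if_neg h, if_neg h'] using hss
      exact mul_left_cancel (mul_right_cancel h1)
  have hrmem : r ∈ inversions ρ S x₀ (r * w) := by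
    refine ⟨hr, ?_⟩
    rw [hrwy, sameSide_iff hu ha, hFry]
    linarith
  rw [← hinj.ncard_image]
  refine Set.ncard_lt_ncard ?_ hfin
  refine ⟨Set.image_subset_iff.2 hmap, fun h => ?_⟩
  obtain ⟨s, hs, hsr⟩ := h hrmem
  have : s = r := by
    by_cases h : ∃ t, 0 ≤ t ∧ t < t₀ ∧ ρ s (p t) = p t
    · simpa only [ψ, if_pos h] using hsr
    · simp only [ψ, if_neg h] at hsr
      have h1 : r * s = r * r := by
        rw [mul_inv_eq_iff_eq_mul] at hsr
        exact hsr
      exact mul_left_cancel h1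
  exact hrw (this ▸ hs)

/-- A point is weakly on the same side of every hyperplane as `x₀`. -/
def IsWeaklyDominant (ρ : W →* (V →ᵃ[ℝ] V)) (S : Set W) (x₀ v : V) : Prop :=
  ∀ r ∈ S, ρ r v = v ∨ SameSide (ρ r) x₀ v

theorem apply_average {E : Type*} [AddCommGroup E] [Module ℝ E] {κ : Type*} [Fintype κ]
    [Nonempty κ] (f : V →ᵃ[ℝ] E) (x : κ → V) :
    f ((Fintype.card κ : ℝ)⁻¹ • ∑ k, x k) = (Fintype.card κ : ℝ)⁻¹ • ∑ k, f (x k) := by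
  have h : ∀ v, f v = f.linear v + f 0 := fun v => congrFun f.decomp v
  have h0 : (Fintype.card κ : ℝ) ≠ 0 := by positivity
  rw [h, Finset.sum_congr rfl fun k _ => h (x k), Finset.sum_add_distrib, Finset.sum_const,
    Finset.card_univ, map_smul, map_sum, smul_add, ← Nat.cast_smul_eq_nsmul ℝ, smul_smul, inv_mul_cancel₀ h0,
    one_smul]

/-- A finite parabolic subgroup fixes a point in the closure of the chamber. -/
theorem exists_fixed_weaklyDominant (hS : IsReflectionSet ρ S) {x₀ : V}
    (hx₀ : ∀ r ∈ S, ρ r x₀ ≠ x₀) {K : Set W}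
    (hK : ∀ s ∈ K, s ∈ S ∧ ∃ y, ρ s y = y ∧ ∀ r ∈ S, r ≠ s → SameSide (ρ r) x₀ y)
    [Finite (Subgroup.closure K)] :
    ∃ v, (∀ k ∈ Subgroup.closure K, ρ k v = v) ∧ IsWeaklyDominant ρ S x₀ v := by
  have := Fintype.ofFinite (Subgroup.closure K)
  -- Only hyperplanes of reflections in `W_K` can separate `x₀` from `k x₀`. In the inductive step,
  -- a point `y` on the wall of `s`, strictly inside all other half-spaces, links `x₀` to `g x₀`,
  -- and the induction hypothesis moved by `g` links `g x₀` to `g k x₀`.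
  have hside : ∀ k ∈ Subgroup.closure K, ∀ r ∈ S, r ∉ Subgroup.closure K →
      SameSide (ρ r) x₀ (ρ k x₀) := by
    have step : ∀ s ∈ K, ∀ g, (g = s ∨ g = s⁻¹) → ∀ k ∈ Subgroup.closure K,
        (∀ r ∈ S, r ∉ Subgroup.closure K → SameSide (ρ r) x₀ (ρ k x₀)) →
        ∀ r ∈ S, r ∉ Subgroup.closure K → SameSide (ρ r) x₀ (ρ (g * k) x₀) := by
      intro s hs g hg k _ ih r hr hrK
      obtain ⟨-, y, hy, hyr⟩ := hK s hs
      have hsK : s ∈ Subgroup.closure K := Subgroup.subset_closure hs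
      have hgK : g ∈ Subgroup.closure K := by
        rcases hg with rfl | rfl
        exacts [hsK, inv_mem hsK]
      have hgy : ρ g y = y := by
        rcases hg with rfl | rfl
        · exact hy
        · conv_lhs => rw [← hy]
          exact apply_inv_apply ρ s y
      have hr'S : g⁻¹ * r * g ∈ S := hS.conj_mem' g hr
      have hr'K : g⁻¹ * r * g ∉ Subgroup.closure K := fun h => hrK (by
        have := mul_mem (mul_mem hgK h) (inv_mem hgK)
        simpa [mul_assoc] using this)
      have h1 : SameSide (ρ r) x₀ y := hyr r hr fun h => hrK (h ▸ hsK)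
      have h2 : SameSide (ρ r) (ρ g x₀) y := by
        have := hyr _ hr'S fun h => hr'K (h ▸ hsK)
        rw [sameSide_conj_iff, hgy] at this
        exact this
      have h3 : SameSide (ρ r) (ρ g x₀) (ρ (g * k) x₀) := by
        rw [apply_mul, ← sameSide_conj_iff]
        exact ih _ hr'S hr'K
      exact hS.trans hr h1 (hS.trans hr h2.symm h3)
    intro k hk
    induction hk using Subgroup.closure_induction_left with
    | one =>
      intro r hr _
      obtain ⟨F, u, hu, ha⟩ := hS.isRefl r hr
      rw [map_one, AffineMap.coe_one, id_eq, sameSide_iff hu ha]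
      exact mul_self_pos.2 fun h => hx₀ r hr ((fixed_iff hu ha _).2 h)
    | mul_left s hs k hk ih => exact step s hs s (Or.inl rfl) k hk ih
    | inv_mul_cancel s hs k hk ih => exact step s hs s⁻¹ (Or.inr rfl) k hk ih
  -- The fixed point is the barycentre of the orbit of `x₀`. It lies on the hyperplanes of
  -- reflections in `W_K`, and for any other reflection the whole orbit is on the side of `x₀`.
  refine ⟨(Fintype.card (Subgroup.closure K) : ℝ)⁻¹ • ∑ k : Subgroup.closure K, ρ k x₀, ?_, ?_⟩
  · intro k hk
    rw [apply_average]
    congr 1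
    refine Fintype.sum_equiv (Equiv.mulLeft ⟨k, hk⟩) _ _ fun k' => ?_
    rw [← apply_mul]
    rfl
  · intro r hr
    by_cases hrK : r ∈ Subgroup.closure K
    · left
      rw [apply_average]
      congr 1
      refine Fintype.sum_equiv (Equiv.mulLeft ⟨r, hrK⟩) _ _ fun k' => ?_
      rw [← apply_mul]
      rfl
    · right
      obtain ⟨F, u, hu, ha⟩ := hS.isRefl r hr
      rw [sameSide_iff hu ha, apply_average, smul_eq_mul, mul_left_comm, Finset.mul_sum]
      refine mul_pos (by positivity) (Finset.sum_pos (fun k _ => ?_) Finset.univ_nonempty)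
      rw [← sameSide_iff hu ha]
      exact hside k k.2 r hr hrK

/-- Reflecting in a hyperplane that separates the chamber from its translate keeps the displacement
of a weakly dominant point in a convex set stable under the linear parts. -/
theorem displacement_mem (hS : IsReflectionSet ρ S) {x₀ v : V} (hx₀ : ∀ r ∈ S, ρ r x₀ ≠ x₀)
    (hv : IsWeaklyDominant ρ S x₀ v) {C : Set V} (hC : Convex ℝ C)
    (hCW : ∀ g, ∀ d ∈ C, (ρ g).linear d ∈ C) {r w : W} (hr : r ∈ inversions ρ S x₀ w)
    (hw : ρ w v - v ∈ C) : ρ (r * w) v - v ∈ C := by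
  obtain ⟨hrS, hsep⟩ := hr
  obtain ⟨F, u, hu, ha⟩ := hS.isRefl r hrS
  set y := ρ w v with hy
  have hFx : F x₀ ≠ 0 := fun h => hx₀ r hrS ((fixed_iff hu ha _).2 h)
  have hFwx : F (ρ w x₀) ≠ 0 := fun h => hS.generic_apply hx₀ hrS w ((fixed_iff hu ha _).2 h)
  rw [sameSide_iff hu ha, not_lt] at hsep
  have hsep' : F x₀ * F (ρ w x₀) < 0 := lt_of_le_of_ne hsep (mul_ne_zero hFx hFwx)
  have h1 : 0 ≤ F x₀ * F v := by
    rcases hv r hrS with h | h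
    · rw [(fixed_iff hu ha _).1 h, mul_zero]
    · exact ((sameSide_iff hu ha).1 h).le
  have h2 : 0 ≤ F (ρ w x₀) * F y := by
    rcases hv _ (hS.conj_mem' w hrS) with h | h
    · rw [conj_fixed_iff] at h
      rw [hy, (fixed_iff hu ha _).1 h, mul_zero]
    · rw [sameSide_conj_iff] at h
      exact ((sameSide_iff hu ha).1 h).le
  -- The point `v` is weakly on the side of `x₀` and `y = w v` weakly on the side of `w x₀`, which
  -- are opposite sides.
  have h3 : F v * F y ≤ 0 := by
    have h4 : (F x₀ * F (ρ w x₀)) * (F v * F y) ≥ 0 := by nlinarith [mul_nonneg h1 h2]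
    by_contra h5
    have := mul_neg_of_neg_of_pos hsep' (not_le.1 h5)
    linarith
  have hlin : F.linear (y - v) = F y - F v := by
    have := F.linearMap_vsub y v
    simpa using this
  have hrlin : (ρ r).linear (y - v) = (y - v) - (F y - F v) • u := by
    have := (ρ r).linearMap_vsub y v
    simp only [vsub_eq_sub] at this
    rw [this, ha, ha]
    module
  have hmem := hCW r _ hw
  rw [hrlin] at hmem
  rw [apply_mul, ← hy, ha]
  by_cases h4 : F y - F v = 0
  · have h5 : F y = 0 := by
      have h6 : F v = F y := by linarith
      rw [h6] at h3
      exact mul_self_eq_zero.1 (le_antisymm h3 (mul_self_nonneg _))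
    rw [h5, zero_smul, sub_zero]
    exact hw
  -- With `c = F y / (F y - F v)` in `[0, 1]`, the new displacement is `(1 - c)` times the old one
  -- plus `c` times its image under the linear part of `r`.
  · have h5 : 0 ≤ F y / (F y - F v) := by
      rw [div_nonneg_iff]
      rcases lt_or_gt_of_ne h4 with h6 | h6
      · right; exact ⟨by nlinarith [mul_self_nonneg (F y)], h6.le⟩
      · left; exact ⟨by nlinarith [mul_self_nonneg (F y)], h6.le⟩
    have h6 : 0 ≤ 1 - F y / (F y - F v) := by
      have h7 : 1 - F y / (F y - F v) = (- F v) / (F y - F v) := by field_simp; ring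
      rw [h7, div_nonneg_iff]
      rcases lt_or_gt_of_ne h4 with h6 | h6
      · right; exact ⟨by nlinarith [mul_self_nonneg (F v)], h6.le⟩
      · left; exact ⟨by nlinarith [mul_self_nonneg (F v)], h6.le⟩
    have h7 := hC hw hmem h6 h5 (by ring)
    convert h7 using 1
    have h8 : F y = F y / (F y - F v) * (F y - F v) := by field_simp
    conv_lhs => rw [h8]
    module

end IsReflectionSet

end AffineReflection
end

/-! ### Finiteness of the Weyl group and separation of the coroot image by norm pairings. -/

noncomputable section

namespace RootPairing

variable {ι M N : Type*} [AddCommGroup M] [AddCommGroup N] {P : RootPairing ι ℤ M N}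
  {B : LinearMap.BilinForm ℤ N}

theorem eq_zero_of_mem_span_coroot (hB : ∀ ν, ν ≠ 0 → 0 < B ν ν)
    (hBc : ∀ i ν, 2 * B ν (P.coroot i) =
      P.toLinearMap (P.root i) ν * B (P.coroot i) (P.coroot i))
    {δ : N} (hδ : δ ∈ Submodule.span ℤ (Set.range P.coroot))
    (h : ∀ i, P.toLinearMap (P.root i) δ = 0) : δ = 0 := by
  have h1 : ∀ θ ∈ Submodule.span ℤ (Set.range P.coroot), B δ θ = 0 := by
    intro θ hθ
    induction hθ using Submodule.span_induction with
    | mem x hx =>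
      obtain ⟨i, rfl⟩ := hx
      have := hBc i δ
      rw [h, zero_mul] at this
      omega
    | zero => simp
    | add x y _ _ hx hy => rw [map_add, hx, hy, add_zero]
    | smul a x _ hx => rw [map_smul, hx, smul_zero]
  by_contra h2
  exact absurd (h1 δ hδ) (hB δ h2).ne'

/-- A Weyl element is determined by its permutation of the roots: two with the same permutation
differ at any `ν` by an element of the coroot lattice killed by all roots, which is zero. -/
theorem finite_coweyl [Finite ι] (hB : ∀ ν, ν ≠ 0 → 0 < B ν ν)
    (hBc : ∀ i ν, 2 * B ν (P.coroot i) =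
      P.toLinearMap (P.root i) ν * B (P.coroot i) (P.coroot i)) : Finite P.coweyl := by
  choose e he using fun u : P.coweyl => exists_isCompatible_of_mem_coweyl u.2
  refine Finite.of_injective e fun u u' huu => ?_
  refine Subtype.ext (LinearEquiv.ext fun ν => sub_eq_zero.1 ?_)
  refine eq_zero_of_mem_span_coroot hB hBc ?_ fun i => ?_
  · have h := sub_mem (sub_weyl_mem_span_coroot u'.2 ν) (sub_weyl_mem_span_coroot u.2 ν)
    rwa [sub_sub_sub_cancel_left] at h
  · obtain ⟨i, rfl⟩ := (e u).surjective i
    rw [map_sub, (he u).2, huu, (he u').2, sub_self]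

namespace IsCoinvariantKernel

variable {H : Type*} [Group H] [Fintype H] {ρ : H →* Equiv.Perm ι} {K : AddSubgroup N}

theorem normPairing_sum_coroot (hK : P.IsCoinvariantKernel ρ K) (b : P.Base)
    (hb : ∀ h, ∀ i ∈ b.support, ρ h i ∈ b.support) (n : ι → ℤ) (i : ι) :
    normPairing P ρ i (∑ j ∈ b.support, n j • P.coroot j) =
      ∑ j ∈ b.support, (∑ h, n (ρ h j)) * P.pairing i j := by
  simp only [map_sum, map_smul, smul_eq_mul, hK.normPairing_coroot, Finset.mul_sum, Finset.sum_mul]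
  rw [Finset.sum_comm, Finset.sum_comm (s := b.support)]
  refine Fintype.sum_equiv (Equiv.inv H) _ _ fun h => ?_
  refine Finset.sum_bij' (fun j _ => ρ h j) (fun j _ => ρ h⁻¹ j) (fun j hj => hb h j hj)
    (fun j hj => hb _ j hj) (by simp) (by simp) fun j _ => ?_
  simp

theorem norm_coeff_eq_zero [Finite ι] (hK : P.IsCoinvariantKernel ρ K) (b : P.Base)
    (hb : ∀ h, ∀ i ∈ b.support, ρ h i ∈ b.support) (hB : ∀ ν, ν ≠ 0 → 0 < B ν ν)
    (hBc : ∀ i ν, 2 * B ν (P.coroot i) =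
      P.toLinearMap (P.root i) ν * B (P.coroot i) (P.coroot i)) {n : ι → ℤ}
    (hn : ∀ i, normPairing P ρ i (∑ j ∈ b.support, n j • P.coroot j) = 0) :
    ∀ a ∈ b.support, ∑ h, n (ρ h a) = 0 := by
  intro a ha
  have h := eq_zero_of_pairing_eq_zero b hB hBc (fun j => ((∑ h, n (ρ h j) : ℤ) : ℚ))
    (fun i _ => by
      have h1 := hn i
      rw [hK.normPairing_sum_coroot b hb] at h1
      exact_mod_cast h1) a ha
  exact_mod_cast h

/-- The norm pairings separate the image of the coroot lattice in the coinvariants. -/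
theorem mem_of_normPairing_eq_zero [Finite ι] (hK : P.IsCoinvariantKernel ρ K) (b : P.Base)
    (hb : ∀ h, ∀ i ∈ b.support, ρ h i ∈ b.support) (hB : ∀ ν, ν ≠ 0 → 0 < B ν ν)
    (hBc : ∀ i ν, 2 * B ν (P.coroot i) =
      P.toLinearMap (P.root i) ν * B (P.coroot i) (P.coroot i)) {θ : N}
    (hθ : θ ∈ Submodule.span ℤ (Set.range P.coroot)) (h : ∀ i, normPairing P ρ i θ = 0) :
    θ ∈ K := by
  obtain ⟨n, rfl⟩ := exists_eq_sum_coroot b hθ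
  -- All orbit sums of coefficients vanish, so `θ` is congruent modulo `K` to a combination with
  -- nonnegative coefficients whose orbit sums vanish too, that is, to zero.
  obtain ⟨k, hk⟩ := hK.exists_nonneg_coeff b hb n fun a ha =>
    (hK.norm_coeff_eq_zero b hb hB hBc h a ha).ge
  have h1 : ∀ i, normPairing P ρ i (∑ j ∈ b.support, (k j : ℤ) • P.coroot j) = 0 := by
    intro i
    have h2 : normPairing P ρ i (∑ j ∈ b.support, n j • P.coroot j -
        ∑ j ∈ b.support, k j • P.coroot j) = 0 := by
      rw [normPairing_apply]
      exact hK.norm_eq_zero i _ hk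
    rw [map_sub, h, zero_sub, neg_eq_zero] at h2
    simpa using h2
  have h3 : ∀ j ∈ b.support, k j = 0 := by
    intro j hj
    have h4 := hK.norm_coeff_eq_zero b hb hB hBc h1 j hj
    rw [Finset.sum_eq_zero_iff_of_nonneg fun _ _ => by positivity] at h4
    simpa using h4 1 (Finset.mem_univ 1)
  have h5 : ∑ j ∈ b.support, k j • P.coroot j = 0 :=
    Finset.sum_eq_zero fun j hj => by rw [h3 j hj, zero_smul]
  rwa [h5, sub_zero] at hk

end IsCoinvariantKernel

end RootPairing

namespace AffineReflection

variable {V : Type*} [AddCommGroup V] [Module ℝ V]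

theorem abs_le_of_mem_segment (G : V →ₗ[ℝ] ℝ) {x y m : V} (hm : m ∈ segment ℝ x y) :
    |G m| ≤ |G x| + |G y| := by
  obtain ⟨s, t, hs, ht, hst, rfl⟩ := hm
  rw [map_add, map_smul, map_smul, smul_eq_mul, smul_eq_mul]
  refine (abs_add_le _ _).trans ?_
  rw [abs_mul, abs_mul, abs_of_nonneg hs, abs_of_nonneg ht]
  have := mul_le_of_le_one_left (abs_nonneg (G x)) (show s ≤ 1 by linarith)
  have := mul_le_of_le_one_left (abs_nonneg (G y)) (show t ≤ 1 by linarith)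
  linarith

end AffineReflection
end

/-! ### The Iwahori–Weyl group and its action on the apartment. -/

noncomputable section

open AlgGroup

theorem map_mul_mul_of_eq_one {G M : Type*} [Group G] [Monoid M] (f : G →* M) {h k : G}
    (hh : f h = 1) (hk : f k = 1) (w : G) : f (h * w * k) = f w := by
  rw [map_mul, map_mul, hh, hk, one_mul, mul_one]

namespace QuasiSplitGroup

variable {L Ω : Type*} [Field L] [Field Ω] [Algebra L Ω] {n : ℕ} {D : QuasiSplitGroup L Ω n}
  {ι : Type*} (R : RootPairing ι ℤ D.Char D.Cochar)

/-- The linear action of the relative Weyl group on the apartment. -/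
def linAct (w : relWeyl R) : Apartment D →ₗ[ℝ] Apartment D :=
  LinearMap.baseChange ℝ (coinvEquiv R w).toAddMonoidHom.toIntLinearMap

theorem linAct_tmul (w : relWeyl R) (c : ℝ) (l : D.Coinv) :
    linAct R w (c ⊗ₜ l) = c ⊗ₜ coinvEquiv R w l := rfl

theorem coinvEquiv_mk (w : relWeyl R) (ν : D.Cochar) :
    coinvEquiv R w (QuotientAddGroup.mk ν) = QuotientAddGroup.mk (w.1 ν) := rfl

theorem coinvEquiv_mul (w w' : relWeyl R) (l : D.Coinv) :
    coinvEquiv R (w * w') l = coinvEquiv R w (coinvEquiv R w' l) := by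
  induction l using QuotientAddGroup.induction_on
  rfl

theorem coinvEquiv_one (l : D.Coinv) : coinvEquiv R 1 l = l := by
  induction l using QuotientAddGroup.induction_on
  rfl

theorem linAct_mul (w w' : relWeyl R) (v : Apartment D) :
    linAct R (w * w') v = linAct R w (linAct R w' v) := by
  induction v using TensorProduct.induction_on with
  | zero => simp
  | tmul c l => simp only [linAct_tmul, coinvEquiv_mul]
  | add x y hx hy => simp only [map_add, hx, hy]

theorem linAct_one (v : Apartment D) : linAct R 1 v = v := by
  induction v using TensorProduct.induction_on with
  | zero => simp
  | tmul c l => simp only [linAct_tmul, coinvEquiv_one]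
  | add x y hx hy => simp only [map_add, hx, hy]

/-- The canonical map from the coinvariants to the apartment. -/
def toApartment : D.Coinv →+ Apartment D := (TensorProduct.mk ℤ ℝ D.Coinv 1).toAddMonoidHom

theorem linAct_toApartment (w : relWeyl R) (l : D.Coinv) :
    linAct R w (toApartment l) = toApartment (coinvEquiv R w l) := rfl

theorem act_apply (g : IwahoriWeyl R) (v : Apartment D) :
    act R g v = linAct R g.right v + toApartment g.left.toAdd := rfl

/-- A homomorphism on the coinvariants extends to the apartment. -/
def extendHom (ψ : D.Coinv →+ ℝ) : Apartment D →ₗ[ℝ] ℝ :=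
  ψ.toIntLinearMap.liftBaseChange ℝ

theorem extendHom_toApartment (ψ : D.Coinv →+ ℝ) (l : D.Coinv) :
    extendHom ψ (toApartment l) = ψ l := by
  simp [extendHom, toApartment]

attribute [irreducible] linAct toApartment extendHom

theorem act_transl (l : D.Coinv) (v : Apartment D) :
    act R (transl R l) v = v + toApartment l := by
  have h : act R (transl R l) v = linAct R 1 v + toApartment l := act_apply R _ v
  rw [h, linAct_one]

theorem act_one (v : Apartment D) : act R 1 v = v := by
  have h : act R 1 v = linAct R 1 v + toApartment (0 : D.Coinv) := act_apply R 1 v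
  rw [h, linAct_one, map_zero, add_zero]

theorem toAdd_left_mul (g h : IwahoriWeyl R) : (g * h).left.toAdd =
    g.left.toAdd + coinvEquiv R g.right h.left.toAdd := rfl

theorem act_mul (g h : IwahoriWeyl R) (v : Apartment D) :
    act R (g * h) v = act R g (act R h v) := by
  have h1 : act R (g * h) v = linAct R (g.right * h.right) v +
      toApartment (g.left.toAdd + coinvEquiv R g.right h.left.toAdd) := act_apply R _ v
  have h2 : linAct R g.right (linAct R h.right v + toApartment h.left.toAdd) =
      linAct R g.right (linAct R h.right v) + toApartment (coinvEquiv R g.right h.left.toAdd) :=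
    (map_add _ _ _).trans (congrArg _ (linAct_toApartment R g.right h.left.toAdd))
  have h3 : linAct R g.right (linAct R h.right v) + toApartment (g.left.toAdd +
      coinvEquiv R g.right h.left.toAdd) = linAct R g.right (linAct R h.right v +
      toApartment h.left.toAdd) + toApartment g.left.toAdd := by
    rw [h2, AddMonoidHom.map_add, add_assoc]
    exact congrArg _ (add_comm _ _)
  exact (h1.trans (congrArg (· + _) (linAct_mul R g.right h.right v))).trans (h3.trans
    ((congrArg (act R g) (act_apply R h v)).trans (act_apply R g _)).symm)

/-- The translation vector is the displacement of `v`. As `k` fixes `v`, the translate of `v` is `h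
(w v)`; subtracting `v = h v` leaves the linear part of `h`. -/
theorem toApartment_eq_of_transl_eq {l : D.Coinv} {h w k : IwahoriWeyl R}
    (heq : transl R l = h * w * k) {v : Apartment D} (hh : act R h v = v) (hk : act R k v = v) :
    toApartment l = linAct R h.right (act R w v - v) := by
  have h1 : act R (transl R l) v = act R h (act R w v) :=
    (congrArg (act R · v) heq).trans (((act_mul R (h * w) k v).trans
      (congrArg (act R (h * w)) hk)).trans (act_mul R h w v))
  have h2 : act R h (act R w v) - act R h v = linAct R h.right (act R w v - v) := by
    rw [act_apply R h, act_apply R h, add_sub_add_right_eq_sub]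
    exact (map_sub _ _ _).symm
  rw [hh, ← h1, act_transl, add_sub_cancel_left] at h2
  exact h2

/-- The action of the Iwahori--Weyl group on the apartment by affine maps. -/
def actHom : IwahoriWeyl R →* (Apartment D →ᵃ[ℝ] Apartment D) where
  toFun g :=
    { toFun := act R g
      linear := linAct R g.right
      map_vadd' := fun v u => by
        simp only [act_apply, vadd_eq_add, map_add]
        abel }
  map_one' := by
    exact AffineMap.ext fun v => act_one R v
  map_mul' g h := AffineMap.ext fun v => act_mul R g h v

theorem actHom_apply (g : IwahoriWeyl R) (v : Apartment D) : actHom R g v = act R g v := rfl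

/-- The image of the coroot lattice in the coinvariants. -/
def corootCoinv : Submodule ℤ D.Coinv :=
  (Submodule.span ℤ (Set.range R.coroot)).map (QuotientAddGroup.mk' D.coinvKer).toIntLinearMap

variable {R} in
theorem mk_sub_mem_corootCoinv {u : D.Cochar ≃ₗ[ℤ] D.Cochar} (hu : u ∈ R.coweyl) (ν : D.Cochar) :
    (QuotientAddGroup.mk ν - QuotientAddGroup.mk (u ν) : D.Coinv) ∈ corootCoinv R :=
  ⟨ν - u ν, RootPairing.sub_weyl_mem_span_coroot hu ν, rfl⟩

theorem sub_coinvEquiv_mem (w : relWeyl R) (l : D.Coinv) :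
    l - coinvEquiv R w l ∈ corootCoinv R := by
  induction l using QuotientAddGroup.induction_on with | H ν
  exact mk_sub_mem_corootCoinv w.2.1 ν

/-- The class of an element of the Iwahori--Weyl group modulo the affine Weyl group. -/
def classHom : IwahoriWeyl R →* Multiplicative (D.Coinv ⧸ corootCoinv R) where
  toFun g := Multiplicative.ofAdd ((corootCoinv R).mkQ g.left.toAdd)
  map_one' := congrArg Multiplicative.ofAdd (map_zero (corootCoinv R).mkQ)
  map_mul' g h := by
    rw [← ofAdd_add, toAdd_left_mul, map_add]
    refine congrArg (fun l => Multiplicative.ofAdd (_ + l)) (Eq.symm ?_)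
    exact (Submodule.Quotient.eq _).2 (sub_coinvEquiv_mem R g.right h.left.toAdd)

theorem classHom_eq_one_iff (g : IwahoriWeyl R) :
    classHom R g = 1 ↔ g.left.toAdd ∈ corootCoinv R :=
  have h : (corootCoinv R).mkQ g.left.toAdd = 0 ↔ g.left.toAdd ∈ corootCoinv R :=
    Submodule.Quotient.mk_eq_zero _
  h

theorem transl_mem_affineWeyl {θ : D.Cochar} (hθ : θ ∈ Submodule.span ℤ (Set.range R.coroot)) :
    transl R (QuotientAddGroup.mk θ) ∈ affineWeyl R := by
  let f : Multiplicative D.Coinv →* IwahoriWeyl R := SemidirectProduct.inl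
  let Q : AddSubgroup D.Cochar :=
    (Subgroup.toAddSubgroup' ((affineWeyl R).comap f)).comap (QuotientAddGroup.mk' D.coinvKer)
  have hQ : Submodule.span ℤ (Set.range R.coroot) ≤ AddSubgroup.toIntSubmodule Q := by
    rw [Submodule.span_le]
    rintro _ ⟨i, rfl⟩
    exact Subgroup.subset_closure (Or.inl ⟨i, rfl⟩)
  exact hQ hθ

/-- Being a kernel makes `W_a` normal, so its reflections are stable under conjugation by `W`, and
it makes the class modulo coroots constant under multiplication by `W_a`. -/
theorem affineWeyl_eq_ker : affineWeyl R = (classHom R).ker := by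
  apply le_antisymm
  · rw [affineWeyl, Subgroup.closure_le]
    rintro _ (⟨i, rfl⟩ | ⟨w, rfl⟩)
    · refine (classHom_eq_one_iff R _).2 ?_
      exact ⟨R.coroot i, Submodule.subset_span ⟨i, rfl⟩, rfl⟩
    · refine (classHom_eq_one_iff R _).2 ?_
      exact zero_mem (corootCoinv R)
  · intro g hg
    obtain ⟨θ, hθ, h⟩ := (classHom_eq_one_iff R g).1 hg
    have h1 : SemidirectProduct.inl g.left = transl R (QuotientAddGroup.mk θ) :=
      congrArg (transl R) h.symm
    have h2 : g = transl R (QuotientAddGroup.mk θ) * SemidirectProduct.inr g.right :=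
      (SemidirectProduct.inl_left_mul_inr_right g).symm.trans (congrArg (· * _) h1)
    have h3 : SemidirectProduct.inr g.right ∈ affineWeyl R :=
      Subgroup.subset_closure (Or.inr ⟨g.right, rfl⟩)
    have h4 := mul_mem (transl_mem_affineWeyl R hθ) h3
    exact Set.mem_of_eq_of_mem h2 h4

theorem isAffineReflection_iff (r : IwahoriWeyl R) :
    IsAffineReflection R r ↔ r ∈ affineWeyl R ∧ AffineReflection.IsRefl (actHom R r) := by
  refine and_congr_right fun _ => ⟨?_, ?_⟩
  · rintro ⟨f, c, u, hu, h⟩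
    refine ⟨f.toAffineMap - AffineMap.const ℝ _ c, u, ?_, fun v => ?_⟩
    · simpa using hu
    · rw [actHom_apply, h]
      simp
  · rintro ⟨F, u, hu, h⟩
    refine ⟨F.linear, - F 0, u, hu, fun v => ?_⟩
    have h1 : F v = F.linear v + F 0 := congrFun F.decomp v
    rw [← actHom_apply, h, h1, sub_neg_eq_add]

theorem sameSide_iff' (r : IwahoriWeyl R) (x y : Apartment D) :
    SameSide R r x y ↔ AffineReflection.SameSide (actHom R r) x y := Iff.rfl

variable {R}

/-- Norm pairings are integer-valued and descend to the coinvariants. Although the coinvariants may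
have torsion, the image of the coroot lattice is detected by these integers. -/
theorem exists_separating [CharZero Ω] [Finite ι] (hR : IsRootDatum R) {b : R.Base}
    (hb : IsGaloisStable b) :
    ∃ N : ι → (D.Coinv →+ ℤ), ∀ l ∈ corootCoinv R, (∀ i, N i l = 0) → l = 0 := by
  obtain ⟨P, hP⟩ : ∃ P : GL (Fin n) Ω, ∀ t ∈ D.T, (P * t * P⁻¹).1.IsDiag := D.quasiSplit.2
  have := Fintype.ofFinite (rootPerm hR).range
  have hK := isCoinvariantKernel_coinvKer hR
  refine ⟨fun i => QuotientAddGroup.lift D.coinvKer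
    (RootPairing.normPairing R (rootPerm hR).range.subtype i).toAddMonoidHom fun ν hν => ?_, ?_⟩
  · refine (RootPairing.normPairing_apply _ _ _).trans (hK.norm_eq_zero i ν hν)
  · rintro _ ⟨θ, hθ, rfl⟩ h
    refine (QuotientAddGroup.eq_zero_iff θ).2 ?_
    refine hK.mem_of_normPairing_eq_zero b ?_ (hR.traceForm_pos hP) (hR.traceForm_coroot hP) hθ h
    rintro ⟨_, σ, rfl⟩ i hi
    exact rootPerm_mem_support hR hb σ hi

theorem finite_relWeyl [CharZero Ω] [Finite ι] (hR : IsRootDatum R) : Finite (relWeyl R) := by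
  obtain ⟨P, hP⟩ : ∃ P : GL (Fin n) Ω, ∀ t ∈ D.T, (P * t * P⁻¹).1.IsDiag := D.quasiSplit.2
  have := RootPairing.finite_coweyl (hR.traceForm_pos hP) (hR.traceForm_coroot hP)
  exact Finite.of_injective (fun w : relWeyl R => (⟨w.1, w.2.1⟩ : R.coweyl)) fun w w' h =>
    Subtype.ext (Subtype.ext_iff.1 h :)

/-- A reflection with linear part `w` fixing a point `m` of the segment has translation part `m - w
m`, whose norm pairings are bounded by the values at the endpoints. Finitely many integers and
finitely many `w` are possible, and together they determine the reflection. -/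
theorem finite_crossing [CharZero Ω] [Finite ι] (hR : IsRootDatum R) {b : R.Base}
    (hb : IsGaloisStable b) (x y : Apartment D) :
    {r | IsAffineReflection R r ∧ ¬ SameSide R r x y}.Finite := by
  have := finite_relWeyl hR
  obtain ⟨N, hN⟩ := exists_separating hR hb
  let G : relWeyl R → ι → Apartment D →ₗ[ℝ] ℝ := fun w i =>
    extendHom ((Int.castAddHom ℝ).comp (N i)) ∘ₗ (LinearMap.id - linAct R w)
  have hsub : {r | IsAffineReflection R r ∧ ¬ SameSide R r x y} ⊆
      ⋃ w : relWeyl R, {r | r.right = w ∧ r.left.toAdd ∈ corootCoinv R ∧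
        ∀ i, |(N i r.left.toAdd : ℝ)| ≤ |G w i x| + |G w i y|} := by
    rintro r ⟨hr, hxy⟩
    simp only [SameSide, not_forall, not_not] at hxy
    obtain ⟨m, hm, hrm⟩ := hxy
    have hr1 := hr.1
    rw [affineWeyl_eq_ker, MonoidHom.mem_ker, classHom_eq_one_iff] at hr1
    refine Set.mem_iUnion.2 ⟨r.right, rfl, hr1, fun i => ?_⟩
    have h1 : toApartment r.left.toAdd = m - linAct R r.right m := by
      rw [act_apply] at hrm
      exact eq_sub_of_add_eq' hrm
    have h2 : (N i r.left.toAdd : ℝ) = G r.right i m := by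
      have h3 := extendHom_toApartment ((Int.castAddHom ℝ).comp (N i)) r.left.toAdd
      rw [h1] at h3
      exact h3.symm
    rw [h2]
    exact AffineReflection.abs_le_of_mem_segment _ hm
  refine Set.Finite.subset (Set.finite_iUnion fun w => ?_) hsub
  refine Set.Finite.of_finite_image (f := fun r i => N i r.left.toAdd) ?_ ?_
  · refine Set.Finite.subset (Set.Finite.pi' fun i => Set.finite_Icc
      (-⌈|G w i x| + |G w i y|⌉) ⌈|G w i x| + |G w i y|⌉) ?_
    rintro _ ⟨r, ⟨-, -, h⟩, rfl⟩ i
    have h1 := (h i).trans (Int.le_ceil _)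
    rw [← Int.cast_abs, Int.cast_le, abs_le] at h1
    exact h1
  · rintro r ⟨hr, hr1, -⟩ r' ⟨hr', hr1', -⟩ h
    refine SemidirectProduct.ext ?_ (hr.trans hr'.symm)
    have h1 := hN _ (sub_mem hr1 hr1') fun i => by
      rw [map_sub, sub_eq_zero]
      exact congrFun h i
    exact Multiplicative.toAdd.injective (sub_eq_zero.1 h1)

theorem isReflectionSet [CharZero Ω] [Finite ι] (hR : IsRootDatum R) {b : R.Base}
    (hb : IsGaloisStable b) :
    AffineReflection.IsReflectionSet (actHom R) {r | IsAffineReflection R r} := by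
  refine ⟨fun r hr => ((isAffineReflection_iff R r).1 hr).2, fun g r hr => ?_,
    fun x y => finite_crossing hR hb x y⟩
  have h := (isAffineReflection_iff R r).1 hr
  refine (isAffineReflection_iff R _).2 ⟨?_, h.2.conj _ g⟩
  have h1 := h.1
  rw [affineWeyl_eq_ker] at h1 ⊢
  exact (MonoidHom.normal_ker (classHom R)).conj_mem r h1 g

/-! ### From admissibility to the convex hull of the orbit. -/

open AffineReflection AffineReflection.IsReflectionSet

theorem IsAlcove.exists_base {A : Set (Apartment D)} (hA : IsAlcove R A) :
    ∃ x₀, (∀ r ∈ {r | IsAffineReflection R r}, actHom R r x₀ ≠ x₀) ∧ x₀ ∈ A ∧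
      ∀ x ∈ A, ∀ r, IsAffineReflection R r → SameSide R r x₀ x := by
  obtain ⟨x₀, hx₀, rfl⟩ := hA
  refine ⟨x₀, hx₀, fun r hr v hv => ?_, fun x hx => hx⟩
  rw [segment_same, Set.mem_singleton_iff] at hv
  subst hv
  exact hx₀ r hr

/-- The alcove lies on one side of every hyperplane, so separation of `A` from `w A` may be tested
at the single point `x₀`. -/
theorem length_eq_ncard_inversions
    (hS : IsReflectionSet (actHom R) {r | IsAffineReflection R r})
    {A : Set (Apartment D)} {x₀ : Apartment D} (hx₀ : x₀ ∈ A)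
    (hA : ∀ x ∈ A, ∀ r, IsAffineReflection R r → SameSide R r x₀ x) (w : IwahoriWeyl R) :
    length R A w = (inversions (actHom R) {r | IsAffineReflection R r} x₀ w).ncard := by
  refine congrArg Set.ncard (Set.ext fun r => and_congr_right fun hr => ?_)
  refine ⟨fun h => h x₀ hx₀ x₀ hx₀, fun h x hx y hy hxy => h ?_⟩
  refine hS.trans hr (hA x hx r hr) (hS.trans hr hxy ?_)
  have h1 := hA y hy _ (hS.conj_mem' w hr)
  rw [sameSide_iff', sameSide_conj_iff] at h1
  exact h1.symm

/-- Induction down the chain from `t`. Each step multiplies by a reflection of `W_a`, which keeps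
the class, and lowers the length, so the reflection separates and the displacement stays in `C`. -/
theorem BruhatLE.displacement_mem
    (hS : IsReflectionSet (actHom R) {r | IsAffineReflection R r})
    {A : Set (Apartment D)} {x₀ : Apartment D}
    (hx₀ : ∀ r ∈ {r | IsAffineReflection R r}, actHom R r x₀ ≠ x₀) (hx₀A : x₀ ∈ A)
    (hA : ∀ x ∈ A, ∀ r, IsAffineReflection R r → SameSide R r x₀ x) {v : Apartment D}
    (hv : IsWeaklyDominant (actHom R) {r | IsAffineReflection R r} x₀ v) {C : Set (Apartment D)}
    (hC : Convex ℝ C) (hCW : ∀ g, ∀ d ∈ C, linAct R g d ∈ C) {w t : IwahoriWeyl R}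
    (hwt : BruhatLE R A w t) (ht : act R t v - v ∈ C) :
    classHom R w = classHom R t ∧ act R w v - v ∈ C := by
  induction hwt using Relation.ReflTransGen.head_induction_on with
  | refl => exact ⟨rfl, ht⟩
  | head h _ ih =>
    obtain ⟨r, hr, rfl, hlt⟩ := h
    refine ⟨?_, ?_⟩
    · have h1 := hr.1
      rw [affineWeyl_eq_ker, MonoidHom.mem_ker] at h1
      rw [map_mul, h1, one_mul, ih.1]
    · refine hS.displacement_mem hx₀ hv hC (fun g => hCW g.right) ?_ ih.2
      by_contra h
      have h1 := hS.ncard_inversions_lt hx₀ hr h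
      rw [length_eq_ncard_inversions hS hx₀A hA, length_eq_ncard_inversions hS hx₀A hA] at hlt
      exact absurd h1 hlt.asymm

/-- The convex hull of the Weyl orbit of a cocharacter in the apartment. -/
def orbitHull (R : RootPairing ι ℤ D.Char D.Cochar) (ν : D.Cochar) : Set (Apartment D) :=
  convexHull ℝ {v | ∃ u ∈ R.coweyl, v = toApartment (QuotientAddGroup.mk (u ν) : D.Coinv)}

theorem linAct_mem_orbitHull (ν : D.Cochar) (w : relWeyl R) {d : Apartment D}
    (hd : d ∈ orbitHull R ν) : linAct R w d ∈ orbitHull R ν := by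
  have h := Set.mem_image_of_mem (linAct R w) hd
  rw [orbitHull, LinearMap.image_convexHull] at h
  refine convexHull_mono ?_ h
  rintro _ ⟨_, ⟨u, hu, rfl⟩, rfl⟩
  exact ⟨w.1 * u, mul_mem w.2.1 hu, linAct_toApartment R w _⟩

/-- Otherwise the extension of `φ` to the apartment would be less than `φ l` on all orbit points,
hence on their convex hull, which contains the image of `l`. -/
theorem exists_le_of_mem_orbitHull {ν l : D.Cochar}
    (h : toApartment (QuotientAddGroup.mk l : D.Coinv) ∈ orbitHull R ν)
    (φ : D.Cochar →+ ℚ) (hφ : ∀ ν ∈ D.coinvKer, φ ν = 0) : ∃ u ∈ R.coweyl, φ l ≤ φ (u ν) := by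
  by_contra! hlt
  let Φ := extendHom (QuotientAddGroup.lift D.coinvKer ((Rat.castHom ℝ).toAddMonoidHom.comp φ)
    fun ν hν => by simp [hφ ν hν])
  have hΦ : ∀ ξ : D.Cochar, Φ (toApartment (QuotientAddGroup.mk ξ : D.Coinv)) = (φ ξ : ℝ) :=
    fun ξ => extendHom_toApartment _ _
  have hsub : orbitHull R ν ⊆ {v | Φ v < φ l} := by
    refine convexHull_min ?_ (convex_halfSpace_lt Φ.isLinear _)
    rintro _ ⟨u, hu, rfl⟩
    rw [Set.mem_ofPred_eq, hΦ]
    exact_mod_cast hlt u hu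
  have h1 := hsub h
  rw [Set.mem_ofPred_eq, hΦ] at h1
  exact lt_irrefl _ h1

/-- A translation whose double coset is admissible displaces the apartment by a vector in the convex
hull of the orbit, and is congruent to the cocharacter modulo coroots. -/
theorem exists_of_transl_mem_AdmK [CharZero Ω] [Finite ι] (hR : IsRootDatum R) {b : R.Base}
    (hb : IsGaloisStable b) {A : Set (Apartment D)} (hA : IsAlcove R A)
    {K : Set (IwahoriWeyl R)} (hK : K ⊆ simpleReflections R A)
    [Finite (Subgroup.closure K)] {μ : Ωˣ →* GL (Fin n) Ω} {l : D.Coinv}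
    (hl : DoubleCoset.mk (Subgroup.closure K) (Subgroup.closure K) (transl R l) ∈ AdmK b A K μ) :
    ∃ ν : D.Cochar, IsConjIn D.G μ (D.toGL ν) ∧ IsDominant b ν ∧
      toApartment l ∈ orbitHull R ν ∧ QuotientAddGroup.mk ν - l ∈ corootCoinv R := by
  obtain ⟨w, ⟨ν, hν, hdom, x, hwx⟩, hw⟩ := hl
  obtain ⟨h, hh, k, hk, heq⟩ := (DoubleCoset.eq _ _ _ _).1 hw
  have hS := isReflectionSet hR hb
  obtain ⟨x₀, hx₀, hx₀A, hA'⟩ := hA.exists_base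
  obtain ⟨v, hv, hvdom⟩ := hS.exists_fixed_weaklyDominant hx₀ (K := K) (by
    intro s hs
    obtain ⟨h1, y, hy, h2⟩ := hK hs
    exact ⟨h1, y, hy, fun r hr hrs => h2 r hr hrs x₀ hx₀A⟩)
  have hconv : Convex ℝ (orbitHull R ν) := convex_convexHull ℝ _
  have hstab : ∀ g, ∀ d ∈ orbitHull R ν, linAct R g d ∈ orbitHull R ν :=
    fun g d hd => linAct_mem_orbitHull ν g hd
  obtain ⟨hcls, hdisp⟩ := BruhatLE.displacement_mem hS hx₀ hx₀A hA' hvdom hconv hstab hwx (by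
    rw [act_transl, add_sub_cancel_left, coinvEquiv_mk]
    exact subset_convexHull ℝ _ ⟨x.1, x.2.1, rfl⟩)
  have hKle : Subgroup.closure K ≤ (classHom R).ker := by
    rw [← affineWeyl_eq_ker, Subgroup.closure_le]
    exact fun s hs => (hK hs).1.1
  refine ⟨ν, hν, hdom, ?_, ?_⟩
  · have h1 : toApartment l = linAct R h.right (act R w v - v) := by
      have hh' : act R h v = v := (actHom_apply R h v).symm.trans (hv h hh)
      have hk' : act R k v = v := (actHom_apply R k v).symm.trans (hv k hk)
      exact toApartment_eq_of_transl_eq R heq hh' hk'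
    rw [h1]
    exact hstab _ _ hdisp
  -- `W_K` lies in `W_a`, so the factors `h` and `k` do not affect the class, and the Bruhat chain
  -- preserves it; the relative Weyl element `x` is removed in the same way modulo coroots.
  · have h1 : classHom R (transl R l) = classHom R (transl R (coinvEquiv R x
        (QuotientAddGroup.mk ν))) := by
      exact (congrArg (classHom R) heq).trans
        ((map_mul_mul_of_eq_one (classHom R) (hKle hh) (hKle hk) w).trans hcls)
    have h2 : l - coinvEquiv R x (QuotientAddGroup.mk ν) ∈ corootCoinv R :=
      (Submodule.Quotient.eq _).1 (Multiplicative.ofAdd.injective h1)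
    have h3 := sub_mem (sub_coinvEquiv_mem R x (QuotientAddGroup.mk ν)) h2
    rwa [sub_sub_sub_cancel_right] at h3

end QuasiSplitGroup
end

theorem mainTheorem12 {L Ω : Type*} [Field L] [CharZero L] [Field Ω] [Algebra L Ω]
    [IsAlgClosure L Ω] {n : ℕ} (D : QuasiSplitGroup L Ω n) {ι : Type*} [Finite ι]
    (R : RootPairing ι ℤ D.Char D.Cochar) (hR : QuasiSplitGroup.IsRootDatum R)
    (b : R.Base) (hb : QuasiSplitGroup.IsGaloisStable b)
    (A : Set (QuasiSplitGroup.Apartment D)) (hA : QuasiSplitGroup.IsAlcove R A)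
    (K : Set (QuasiSplitGroup.IwahoriWeyl R)) (hK : K ⊆ QuasiSplitGroup.simpleReflections R A)
    (hKfin : Finite (Subgroup.closure K))
    (μ : Ωˣ →* GL (Fin n) Ω) (hμ : AlgGroup.IsCocharacter D.G μ)
    (hmin : AlgGroup.IsMinuscule D.G μ)
    (l : D.Coinv)
    (hl : DoubleCoset.mk (Subgroup.closure K) (Subgroup.closure K)
      (QuasiSplitGroup.transl R l) ∈ QuasiSplitGroup.AdmK b A K μ) :
    ∃ v₂ : D.Cochar, (QuotientAddGroup.mk v₂ : D.Coinv) = l ∧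
      AlgGroup.IsConjIn D.G μ (D.toGL v₂) := by
  have : CharZero Ω := charZero_of_injective_algebraMap (algebraMap L Ω).injective
  obtain ⟨ν, hν, hdom, hhull, θ, hθ, hlθ⟩ :=
    QuasiSplitGroup.exists_of_transl_mem_AdmK hR hb hA hK hl
  induction l using QuotientAddGroup.induction_on with | H l
  obtain ⟨v, hv, hconj⟩ := QuasiSplitGroup.exists_conj_lift hR hb hmin hν hdom l
    ⟨θ, hθ, (QuotientAddGroup.eq_zero_iff _).1 (by
      rw [QuotientAddGroup.mk_sub, QuotientAddGroup.mk_sub, ← hlθ]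
      exact sub_self _)⟩
    fun φ hφ => QuasiSplitGroup.exists_le_of_mem_orbitHull hhull φ hφ
  refine ⟨v, ?_, hconj⟩
  rw [← sub_eq_zero, ← QuotientAddGroup.mk_sub]
  exact (QuotientAddGroup.eq_zero_iff _).2 hv
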